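/- Let $d\ge2$, $k\ge1$, $p\ge 1$ and $1\le q\le\min\{p,k\}$ be integers, and $\Omega=[0,1]^d$. Write $h_n=2^{-n}$. *One-dimensional spaces.* For an interval $[a,b]$ let $V_n^k([a,b])$ be the space of piecewise polynomials of degree at most $k$ on the uniform partition of $[a,b]$ into $2^n$ cells, and for $n\ge1$ let $W_n^k([a,b])$ be the $L^2([a,b])$-orthogonal complement of $V_{n-1}^k([a,b])$ in $V_n^k([a,b])$. For $N\ge1$ let $W_{0,N,D}^k$ be the space of piecewise polynomials of degree at most $k$ on the two cells $[0,1-\tfrac{h_N}{2}]$ and $[1-\tfrac{h_N}{2},1]$. For $l\ge1$ let $W_{l,N,D}^k$ be the restriction to $[0,1]$ of $W_l^k([-\tfrac{h_N}{2},1-\tfrac{h_N}{2}])$, whose functions are extended by $0$ to $(1-\tfrac{h_N}{2},1]$. *Sparse space.* Let $$\hat{\tilde{\mathbf V}}_{N,D}^k=\sum_{\mathbf l\in\mathbb N_0^d,\ |\mathbf l|_1\le N} W_{l_1,N,D}^k\otimes\cdots\otimes W_{l_d,N,D}^k ,$$ where the $i$-th factor consists of functions of $x_i$. *Norms.* The dual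 mesh $\Omega_{N,D}$ consists of the $(2^N+1)^d$ products of the intervals $[0,\tfrac{h_N}{2}]$, $[(j-\tfrac12)h_N,(j+\tfrac12)h_N]$ for $1\le j\le 2^N-1$, and $[1-\tfrac{h_N}{2},1]$. The broken semi-norm is given by $$|w|_{H^s(\Omega_{N,D})}^2=\sum_{T\in\Omega_{N,D}}\ \sum_{|\alpha|_1=s}\|D^\alpha w\|_{L^2(T)}^2,$$ with weak derivatives taken inside each cell. Let $\mathcal H^{m}(\Omega)$ be the space of $v\in L^2(\Omega)$ all of whose weak derivatives $D^\alpha v$ with $\alpha_i\le m$ for every $i$ exist and belong to $L^2(\Omega)$, and let $$|v|_{\mathcal H^m(\Omega)}=\max_{\emptyset\ne L\subset\{1,\dots,d\}}\Big\|\Big(\prod_{i\in L}\partial_{x_i}^{m}\Big)v\Big\|_{L^2(\Omega)} .$$ *Claim.* There is a constant $C>0$, independent of $N$ and $v$, such that for every $N\ge1$ and every $v\in\mathcal H^{p+1}(\Omega)$ the $L^2(\Omega)$-orthogonal projection $\tilde{\mathbf P}_Dv$ of $v$ onto $\hat{\tilde{\mathbf V}}_{N,D}^k$ exists and satisfies $$|\tilde{\mathbf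 P}_Dv-v|_{H^0(\Omega_{N,D})}\le C\,N^d\,2^{-N(q+1)}\,|v|_{\mathcal H^{q+1}(\Omega)},\qquad |\tilde{\mathbf P}_Dv-v|_{H^1(\Omega_{N,D})}\le C\,2^{-Nq}\,|v|_{\mathcal H^{q+1}(\Omega)} .$$ -/

import Mathlib

open MeasureTheory Set
open scoped ENNReal ContDiff

noncomputable section

namespace SparseDual

/-! ### Weak derivatives and Sobolev semi-norms -/

/-- The classical partial derivative `∂f/∂xᵢ`. -/
def partialDeriv {d : ℕ} (i : Fin d) (f : (Fin d → ℝ) → ℝ) : (Fin d → ℝ) → ℝ :=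
  fun x => fderiv ℝ f x (Pi.single i 1)

/-- The classical derivative `∂₁^{α₁} ⋯ ∂_d^{α_d} f` (only applied to smooth `f`). -/
def multiDeriv {d : ℕ} (α : Fin d → ℕ) (f : (Fin d → ℝ) → ℝ) : (Fin d → ℝ) → ℝ :=
  (List.finRange d).foldr (fun i g => (partialDeriv i)^[α i] g) f

/-- `g` is the weak derivative `D^α v` on the open set `U`. -/
structure IsWeakDeriv {d : ℕ} (U : Set (Fin d → ℝ)) (α : Fin d → ℕ)
    (v g : (Fin d → ℝ) → ℝ) : Prop where
  locallyIntegrableOn : LocallyIntegrableOn v U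
  locallyIntegrableOn_deriv : LocallyIntegrableOn g U
  integral_eq : ∀ φ : (Fin d → ℝ) → ℝ, ContDiff ℝ ∞ φ → HasCompactSupport φ → tsupport φ ⊆ U →
    ∫ x in U, v x * multiDeriv α φ x = (-1) ^ (∑ i, α i) * ∫ x in U, g x * φ x

/-- `‖D^α v‖_{L²(U)}` as an element of `[0, ∞]`. Weak derivatives are unique almost everywhere, so
the infimum is over a single value; it is `∞` if there is no weak derivative. -/
def derivNorm {d : ℕ} (U : Set (Fin d → ℝ)) (α : Fin d → ℕ) (v : (Fin d → ℝ) → ℝ) : ℝ≥0∞ :=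
  ⨅ (g : (Fin d → ℝ) → ℝ) (_ : IsWeakDeriv U α v g), eLpNorm g 2 (volume.restrict U)

/-- The open unit cube `(0,1)^d`, the interior of the domain `Ω = [0,1]^d`. -/
def unitCube (d : ℕ) : Set (Fin d → ℝ) := Set.univ.pi fun _ => Ioo 0 1

/-- The Sobolev space `𝓗^m(U)` of dominating mixed smoothness: all weak derivatives `D^α v` of
order at most `m` in each direction exist and lie in `L²(U)` (`α = 0` is `v` itself). -/
def MemMixedSobolev {d : ℕ} (U : Set (Fin d → ℝ)) (m : ℕ) (v : (Fin d → ℝ) → ℝ) : Prop :=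
  MemLp v 2 (volume.restrict U) ∧
    ∀ α : Fin d → ℕ, (∀ i, α i ≤ m) →
      ∃ g : (Fin d → ℝ) → ℝ, IsWeakDeriv U α v g ∧ MemLp g 2 (volume.restrict U)

/-- `|v|_{𝓗^m(U)}`: the maximum, over all nonempty sets `L` of directions, of
`‖(∏_{i ∈ L} ∂_i^m) v‖_{L²(U)}`. -/
def mixedSeminorm {d : ℕ} (U : Set (Fin d → ℝ)) (m : ℕ) (v : (Fin d → ℝ) → ℝ) : ℝ≥0∞ :=
  ⨆ (L : Finset (Fin d)) (_ : L.Nonempty), derivNorm U (fun i => if i ∈ L then m else 0) v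

/-! ### One-dimensional spaces

Functions on an interval are extended by zero, and cells are taken half-open, which only
fixes values on a null set. -/

/-- Piecewise polynomials of degree at most `k` on the `n` cells `[t j, t (j + 1))`, `j < n`. -/
def piecewisePoly (k n : ℕ) (t : ℕ → ℝ) : Set (ℝ → ℝ) :=
  {v | (∀ j < n, ∃ P : Polynomial ℝ, P.natDegree ≤ k ∧
          ∀ x ∈ Ico (t j) (t (j + 1)), v x = P.eval x) ∧
        ∀ x ∉ Ico (t 0) (t n), v x = 0}

/-- Grid points of the uniform partition of `[a, b]` into `2 ^ n` cells. -/
def uniformGrid (a b : ℝ) (n : ℕ) (j : ℕ) : ℝ := a + j * ((b - a) / 2 ^ n)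

/-- `V_n^k([a, b])`. -/
def primalV (k : ℕ) (a b : ℝ) (n : ℕ) : Set (ℝ → ℝ) := piecewisePoly k (2 ^ n) (uniformGrid a b n)

/-- The multiwavelet space `W_n^k([a, b])`: `V_0^k` for `n = 0`, and the `L²([a, b])`-orthogonal
complement of `V_{n-1}^k` in `V_n^k` for `n ≥ 1`. -/
def primalW (k : ℕ) (a b : ℝ) : ℕ → Set (ℝ → ℝ)
  | 0 => primalV k a b 0
  | n + 1 => {w | w ∈ primalV k a b (n + 1) ∧ ∀ u ∈ primalV k a b n, ∫ x in a..b, w x * u x = 0}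

/-- The mesh size `h_n = 2^{-n}` on the unit interval. -/
def meshSize (n : ℕ) : ℝ := 1 / 2 ^ n

/-- Grid points `0, h_l - h_N/2, 2 h_l - h_N/2, …, 1 - h_N/2, 1` of the level-`l` dual grid on
`[0, 1]` with finest level `N`; it has the `2 ^ l + 1` cells with indices `0, …, 2 ^ l`. -/
def dualGrid (l N : ℕ) (j : ℕ) : ℝ :=
  if j = 0 then 0 else if j ≤ 2 ^ l then j * meshSize l - meshSize N / 2 else 1

/-- `V_{l,N,D}^k`. -/
def dualV (k l N : ℕ) : Set (ℝ → ℝ) := piecewisePoly k (2 ^ l + 1) (dualGrid l N)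

/-- `W_{l,N,D}^k`: `V_{0,N,D}^k` for `l = 0`, and the restriction to the unit interval of the
shifted space `W_l^k([-h_N/2, 1 - h_N/2])` for `l ≥ 1`. -/
def dualW (k N : ℕ) : ℕ → Set (ℝ → ℝ)
  | 0 => dualV k 0 N
  | l + 1 => (fun w => (Ico (0 : ℝ) 1).indicator w) ''
      primalW k (-(meshSize N / 2)) (1 - meshSize N / 2) (l + 1)

/-! ### The sparse space in dimension `d` and the `L²` projection -/

/-- The tensor product `W_{l₁,N,D,x₁}^k × ⋯ × W_{l_d,N,D,x_d}^k`. -/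
def tensorW {d : ℕ} (k N : ℕ) (l : Fin d → ℕ) : Submodule ℝ ((Fin d → ℝ) → ℝ) :=
  Submodule.span ℝ {f | ∃ w : Fin d → ℝ → ℝ,
    (∀ i, w i ∈ dualW k N (l i)) ∧ f = fun x => ∏ i, w i (x i)}

/-- The sparse space on the dual mesh: the sum of the tensor products over `|l|₁ ≤ N`. -/
def sparseSpace (d k N : ℕ) : Submodule ℝ ((Fin d → ℝ) → ℝ) :=
  ⨆ (l : Fin d → ℕ) (_ : ∑ i, l i ≤ N), tensorW k N l

/-- `u` is the `L²(U)` projection of `v` onto `V`: `u ∈ V` and `u - v` is orthogonal to `V`. -/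
def IsL2Projection {d : ℕ} (U : Set (Fin d → ℝ)) (V : Submodule ℝ ((Fin d → ℝ) → ℝ))
    (v u : (Fin d → ℝ) → ℝ) : Prop :=
  u ∈ V ∧ ∀ w ∈ V, ∫ x in U, (u x - v x) * w x = 0

/-! ### Broken semi-norms on the finest dual mesh -/

/-- The (open) cell with index `j` of the dual mesh `Ω_{N,D}` of `[0,1]^d`. -/
def dualCell {d : ℕ} (N : ℕ) (j : Fin d → Fin (2 ^ N + 1)) : Set (Fin d → ℝ) :=
  Set.univ.pi fun i => Ioo (dualGrid N N (j i)) (dualGrid N N (j i + 1))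

/-- The broken semi-norm `|w|_{H^s(Ω_{N,D})}`, the square root of
`∑_cells ∑_{|α|₁ = s} ‖D^α w‖²_{L²(cell)}`, with weak derivatives taken in each cell. -/
def brokenSeminorm {d : ℕ} (N s : ℕ) (w : (Fin d → ℝ) → ℝ) : ℝ≥0∞ :=
  (∑ j : Fin d → Fin (2 ^ N + 1), ∑ α ∈ Finset.piAntidiag (Finset.univ : Finset (Fin d)) s,
    derivNorm (dualCell N j) α w ^ 2) ^ (1 / 2 : ℝ)

end SparseDual

end

/-!
The idea is to write the error of the orthogonal projection onto the sparse space through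
one-dimensional projections, and each of these through a high weak derivative.

Let `P_n` be the one-dimensional `L²` projection onto the piecewise polynomials on the dual grid of
level `n` (`dualProj`, one operator on `L²((0,1)^d)` for each coordinate), and let
`Q_0 = P_0`, `Q_n = P_n - P_{n-1}`. The dual grids are nested, and the spaces `W_l` up to level `n`
span the range of `P_n` (`exists_dualW_sum`), so the sparse projection is the sum of the tensor
products `Q_{l_1} ⊗ ⋯ ⊗ Q_{l_d}` over `l_1 + ⋯ + l_d ≤ N`. Its error obeys the recursion
`E_{i::s}(n) = (1 - P_n^i) + ∑_{a ≤ n} Q_a^i E_s(n - a)` (`sparseErr`, `sub_eq_neg_sparseErr`).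

In one coordinate, the transpose of `1 - P_n` produces functions orthogonal on each cell to the
polynomials of degree at most `k`. Such functions can be integrated `q + 1 ≤ k + 1` times, cell by
cell, without boundary terms, and each integration gains a factor `2^{-n}`; so `1 - P_n` is an
operator of norm of order `2^{-n(q+1)}` applied to the weak derivative of order `q + 1`
(`one_sub_proj_apply`). In the same way the derivative minus the cellwise derivative of `P_n` is of
order `2^{-nq}` (`norm_sub_deriv_proj_le`). All these operators are integral operators with kernels
supported on the squares of the cells, bounded by Schur's test (`exists_kernelOp`) and identified by
pairing with tensor products, which are total in `L²` (`ae_eq_zero_of_forall_tens`).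

Inserting this into the recursion bounds the error: as the factors `2^{-a(q+1)}` and
`2^{-(n-a)(q+1)}` multiply to `2^{-n(q+1)}`, each coordinate costs a factor `n + 1`, the number of
summands (`norm_sparseErr_le`). For the derivative in the coordinate `m`, the recursion is run with
`m` as the last coordinate; there the order is `q` only, so the summands have a surplus `2^{-a}` and
the sum over `a` stays bounded (`norm_sparseErrDeriv_le`). The mixed derivatives that occur have
orders `0` and `q + 1` only, apart from first derivatives in `m`, which are controlled by
interpolation (`exists_interpolation_const`).

On a cell of the finest mesh the sparse functions are smooth, so the error has a weak derivative
there, and testing with tensor products identifies it with the differentiated recursion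
(`cellPair_sparseErr`, `isWeakDeriv_dualCell`). The projection exists because the sparse space is
finite-dimensional.
-/

noncomputable section

namespace SparseDual

/-! ### Tensor products of test functions are total -/

/-- Smooth test functions with compact support in the open interval `(a, b)`. -/
structure IsTest (a b : ℝ) (φ : ℝ → ℝ) : Prop where
  smooth : ContDiff ℝ ∞ φ
  compact : HasCompactSupport φ
  supp : tsupport φ ⊆ Ioo a b

/-- The tensor product `x ↦ ∏ i, φ i (x i)`. -/
def tens {d : ℕ} (φ : Fin d → ℝ → ℝ) : (Fin d → ℝ) → ℝ := fun x => ∏ i, φ i (x i)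

/-- A function on a box that is orthogonal to all tensor products of test functions vanishes almost
everywhere: cubes are balls of the sup norm and limits of tensor products of bump functions, so all
averages vanish, and these converge to the function at its Lebesgue points. -/
theorem ae_eq_zero_of_forall_tens {d : ℕ} {a b : Fin d → ℝ} {f : (Fin d → ℝ) → ℝ}
    (hf : IntegrableOn f (univ.pi fun i => Ioo (a i) (b i)))
    (h : ∀ φ : Fin d → ℝ → ℝ, (∀ i, IsTest (a i) (b i) (φ i)) →
      ∫ x in univ.pi fun i => Ioo (a i) (b i), f x * tens φ x = 0) :
    ∀ᵐ x ∂volume.restrict (univ.pi fun i => Ioo (a i) (b i)), f x = 0 := by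
  set U : Set (Fin d → ℝ) := univ.pi fun i => Ioo (a i) (b i) with hU
  have hUo : IsOpen U := isOpen_set_pi finite_univ fun i _ => isOpen_Ioo
  have hint : Integrable (U.indicator f) := (integrable_indicator_iff hUo.measurableSet).2 hf
  rw [ae_restrict_iff' hUo.measurableSet]
  filter_upwards [IsUnifLocDoublingMeasure.ae_tendsto_average volume hint.locallyIntegrable 1]
    with x hx hxU
  obtain ⟨ε, hε, hball⟩ := Metric.isOpen_iff.1 hUo x hxU
  have key : ∀ r : ℝ, 0 < r → 2 * r < ε → ∫ y in Metric.closedBall x r, U.indicator f y = 0 := by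
    intro r hr hrε
    -- bump functions equal to `1` on `[c - r, c + r]` that decrease to its indicator function
    let β : ℕ → ∀ i, ContDiffBump (x i) := fun n i =>
      ⟨r, r * (1 + 1 / ((n : ℝ) + 1)), hr, by
        have : (0 : ℝ) < 1 / ((n : ℝ) + 1) := by positivity
        nlinarith⟩
    have hrout : ∀ n i, (β n i).rOut ≤ 2 * r := by
      intro n i
      have : (1 : ℝ) / ((n : ℝ) + 1) ≤ 1 := by
        rw [div_le_one (by positivity)]; linarith [n.cast_nonneg (α := ℝ)]
      change r * (1 + 1 / ((n : ℝ) + 1)) ≤ 2 * r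
      nlinarith
    have htest : ∀ n i, IsTest (a i) (b i) (β n i) := by
      intro n i
      refine ⟨(β n i).contDiff, (β n i).hasCompactSupport, ?_⟩
      rw [(β n i).tsupport_eq]
      intro t ht
      have h1 : Function.update x i t ∈ U := by
        apply hball
        rw [Metric.mem_ball, dist_pi_lt_iff hε]
        intro j
        by_cases hj : j = i
        · subst hj
          rw [Function.update_self]
          exact lt_of_le_of_lt ((Metric.mem_closedBall.1 ht).trans (hrout n j)) hrε
        · rw [Function.update_of_ne hj]; simpa using hε
      have := h1 i (mem_univ i)
      simpa using this
    have hz : ∀ n, ∫ y, U.indicator f y * tens (fun i => β n i) y = 0 := by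
      intro n
      rw [← h (fun i => β n i) (htest n), ← integral_indicator hUo.measurableSet]
      congr 1; ext y
      by_cases hy : y ∈ U <;> simp [hy]
    have hlim : Filter.Tendsto (fun n : ℕ => ∫ y, U.indicator f y * tens (fun i => β n i) y)
        Filter.atTop (nhds (∫ y, (Metric.closedBall x r).indicator (U.indicator f) y)) := by
      apply tendsto_integral_of_dominated_convergence (fun y => ‖U.indicator f y‖)
      · intro n
        refine hint.aestronglyMeasurable.mul (Continuous.aestronglyMeasurable ?_)
        exact continuous_finsetProd _ fun i _ => (β n i).continuous.comp (continuous_apply i)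
      · exact hint.norm
      · intro n
        filter_upwards with y
        rw [norm_mul]
        apply mul_le_of_le_one_right (norm_nonneg _)
        rw [tens, Real.norm_of_nonneg (Finset.prod_nonneg fun i _ => (β n i).nonneg)]
        exact Finset.prod_le_one (fun i _ => (β n i).nonneg) fun i _ => (β n i).le_one
      · filter_upwards with y
        by_cases hy : y ∈ Metric.closedBall x r
        · rw [indicator_of_mem hy]
          have : ∀ n, tens (fun i => β n i) y = 1 := by
            intro n
            apply Finset.prod_eq_one
            intro i _
            apply (β n i).one_of_mem_closedBall
            exact (dist_le_pi_dist y x i).trans (Metric.mem_closedBall.1 hy)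
          simp [this]
        · rw [indicator_of_notMem hy]
          apply tendsto_const_nhds.congr'
          obtain ⟨i, hi⟩ : ∃ i, r < dist (y i) (x i) := by
            by_contra! hcon
            exact hy ((dist_pi_le_iff hr.le).2 hcon)
          have hl : Filter.Tendsto (fun n : ℕ => r * (1 + 1 / ((n : ℝ) + 1))) Filter.atTop
              (nhds (r * (1 + 0))) :=
            (tendsto_const_nhds.add tendsto_one_div_add_atTop_nhds_zero_nat).const_mul r
          filter_upwards [hl.eventually (gt_mem_nhds (by simpa using hi))] with n hn
          have : β n i (y i) = 0 := (β n i).zero_of_le_dist hn.le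
          rw [tens, Finset.prod_eq_zero (Finset.mem_univ i) this, mul_zero]
    simp only [hz] at hlim
    rw [← integral_indicator measurableSet_closedBall]
    exact (tendsto_nhds_unique hlim tendsto_const_nhds)
  have hδ : Filter.Tendsto (fun n : ℕ => ε / 3 * (1 / ((n : ℝ) + 1))) Filter.atTop
      (nhdsWithin 0 (Ioi 0)) := by
    apply tendsto_nhdsWithin_of_tendsto_nhds_of_eventually_within
    · simpa using tendsto_one_div_add_atTop_nhds_zero_nat.const_mul (ε / 3)
    · exact Filter.Eventually.of_forall fun n => by
        have : (0 : ℝ) < 1 / ((n : ℝ) + 1) := by positivity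
        exact mem_Ioi.2 (by positivity)
  have h2 := hx (fun _ => x) _ hδ (Filter.Eventually.of_forall fun n => by
    apply Metric.mem_closedBall_self; positivity)
  have h3 : ∀ n : ℕ, ⨍ y in Metric.closedBall x (ε / 3 * (1 / ((n : ℝ) + 1))),
      U.indicator f y = 0 := by
    intro n
    have hle : (1 : ℝ) / ((n : ℝ) + 1) ≤ 1 := by
      rw [div_le_one (by positivity)]; linarith [n.cast_nonneg (α := ℝ)]
    have hpos : (0 : ℝ) < 1 / ((n : ℝ) + 1) := by positivity
    rw [setAverage_eq, key _ (by positivity) (by nlinarith), smul_zero]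
  simp only [h3] at h2
  have := tendsto_nhds_unique h2 tendsto_const_nhds
  rwa [indicator_of_mem hxU] at this

/-! ### The cube as a product of probability spaces -/

/-- Lebesgue measure on `(0, 1)`. -/
def lam : Measure ℝ := volume.restrict (Ioo 0 1)

/-- Lebesgue measure on the unit cube, as a product measure. -/
def mu (d : ℕ) : Measure (Fin d → ℝ) := Measure.pi fun _ => lam

instance : IsProbabilityMeasure lam := ⟨by simp [lam]⟩

instance (d : ℕ) : IsProbabilityMeasure (mu d) := by unfold mu; infer_instance

theorem restrict_unitCube (d : ℕ) : volume.restrict (unitCube d) = mu d := by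
  rw [unitCube, volume_pi, Measure.restrict_pi_pi]; rfl

/-- Averaging over one coordinate does not change an integral over the cube. -/
theorem lintegral_update {d : ℕ} (i : Fin d) {F : (Fin d → ℝ) → ℝ≥0∞} (hF : Measurable F) :
    ∫⁻ x, ∫⁻ s, F (Function.update x i s) ∂lam ∂mu d = ∫⁻ x, F x ∂mu d := by
  classical
  have hG : Measurable fun x : Fin d → ℝ => ∫⁻ s, F (Function.update x i s) ∂lam := by
    apply Measurable.lintegral_prod_right' (f := fun p : (Fin d → ℝ) × ℝ =>
      F (Function.update p.1 i p.2))
    exact hF.comp measurable_update'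
  rw [mu, lintegral_eq_lmarginal_univ (0 : Fin d → ℝ), lintegral_eq_lmarginal_univ (0 : Fin d → ℝ),
    lmarginal_erase' _ hF (Finset.mem_univ i), lmarginal_erase' _ hG (Finset.mem_univ i)]
  congr 1
  ext x
  simp

/-- Exchanging the coordinate `x i` with an independent variable. -/
def swapCoord {d : ℕ} (i : Fin d) (p : (Fin d → ℝ) × ℝ) : (Fin d → ℝ) × ℝ :=
  (Function.update p.1 i p.2, p.1 i)

theorem measurable_swapCoord {d : ℕ} (i : Fin d) : Measurable (swapCoord i) :=
  measurable_update'.prodMk ((measurable_pi_apply i).comp measurable_fst)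

theorem measurePreserving_swapCoord {d : ℕ} (i : Fin d) :
    MeasurePreserving (swapCoord i) ((mu d).prod lam) ((mu d).prod lam) := by
  refine ⟨measurable_swapCoord i, Measure.ext_of_lintegral _ fun F hF => ?_⟩
  rw [lintegral_map hF (measurable_swapCoord i), lintegral_prod _ hF.aemeasurable,
    lintegral_prod (fun p => F (swapCoord i p)) (hF.comp (measurable_swapCoord i)).aemeasurable]
  have h1 : Measurable fun x : Fin d → ℝ => ∫⁻ t, F (swapCoord i (x, t)) ∂lam :=
    (hF.comp (measurable_swapCoord i)).lintegral_prod_right'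
  have h2 : Measurable fun x : Fin d → ℝ => ∫⁻ t, F (x, t) ∂lam := hF.lintegral_prod_right'
  rw [← lintegral_update i h1, ← lintegral_update i h2]
  congr 1; ext x
  simp only [swapCoord, Function.update_idem, Function.update_self]
  exact lintegral_lintegral_swap (f := fun s t => F (Function.update x i t, s)) <| by
    refine Measurable.aemeasurable (hF.comp ?_)
    exact ((measurable_update x).comp measurable_snd).prodMk measurable_fst

/-! ### Pairing of square-integrable functions with tensor products -/

/-- The Hilbert space `L²((0,1)^d)`. -/
abbrev L2Cube (d : ℕ) : Type := Lp ℝ 2 (mu d)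

/-- Bounded measurable functions of one variable. -/
structure BddMeas (φ : ℝ → ℝ) : Prop where
  measurable : Measurable φ
  bound : ∃ C, ∀ x, |φ x| ≤ C

theorem BddMeas.sub {φ ψ : ℝ → ℝ} (hφ : BddMeas φ) (hψ : BddMeas ψ) :
    BddMeas (fun x => φ x - ψ x) := by
  obtain ⟨C, hC⟩ := hφ.bound
  obtain ⟨D, hD⟩ := hψ.bound
  exact ⟨hφ.measurable.sub hψ.measurable, C + D, fun x => (abs_sub _ _).trans
    (add_le_add (hC x) (hD x))⟩

theorem BddMeas.add {φ ψ : ℝ → ℝ} (hφ : BddMeas φ) (hψ : BddMeas ψ) :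
    BddMeas (fun x => φ x + ψ x) := by
  obtain ⟨C, hC⟩ := hφ.bound
  obtain ⟨D, hD⟩ := hψ.bound
  exact ⟨hφ.measurable.add hψ.measurable, C + D, fun x => (abs_add_le _ _).trans
    (add_le_add (hC x) (hD x))⟩

theorem BddMeas.mul {φ ψ : ℝ → ℝ} (hφ : BddMeas φ) (hψ : BddMeas ψ) :
    BddMeas (fun x => φ x * ψ x) := by
  obtain ⟨C, hC⟩ := hφ.bound
  obtain ⟨D, hD⟩ := hψ.bound
  refine ⟨hφ.measurable.mul hψ.measurable, C * D, fun x => ?_⟩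
  rw [abs_mul]
  exact mul_le_mul (hC x) (hD x) (abs_nonneg _) ((abs_nonneg _).trans (hC x))

theorem BddMeas.integrable {φ : ℝ → ℝ} (hφ : BddMeas φ) : Integrable φ lam := by
  obtain ⟨C, hC⟩ := hφ.bound
  exact Integrable.of_bound hφ.measurable.aestronglyMeasurable C (ae_of_all _ hC)

theorem IsTest.bddMeas {a b : ℝ} {φ : ℝ → ℝ} (h : IsTest a b φ) : BddMeas φ := by
  obtain ⟨C, hC⟩ := h.compact.exists_bound_of_continuous h.smooth.continuous
  exact ⟨h.smooth.continuous.measurable, C, hC⟩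

theorem BddMeas.forall_update {d : ℕ} {φ : Fin d → ℝ → ℝ} (hφ : ∀ j, BddMeas (φ j)) (i : Fin d)
    {ψ : ℝ → ℝ} (hψ : BddMeas ψ) (j : Fin d) : BddMeas (Function.update φ i ψ j) := by
  by_cases h : j = i
  · subst h; simpa using hψ
  · simpa [h] using hφ j

theorem tens_update {d : ℕ} (φ : Fin d → ℝ → ℝ) (i : Fin d) (ψ : ℝ → ℝ) (x : Fin d → ℝ) :
    tens (Function.update φ i ψ) x = ψ (x i) * ∏ j ∈ Finset.univ.erase i, φ j (x j) := by
  rw [tens, ← Finset.mul_prod_erase _ _ (Finset.mem_univ i)]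
  congr 1
  · simp
  · exact Finset.prod_congr rfl fun j hj => by rw [Function.update_of_ne (Finset.ne_of_mem_erase hj)]

theorem tens_apply_update {d : ℕ} (φ : Fin d → ℝ → ℝ) (i : Fin d) (t : ℝ) (x : Fin d → ℝ) :
    tens φ (Function.update x i t) = φ i t * ∏ j ∈ Finset.univ.erase i, φ j (x j) := by
  rw [tens, ← Finset.mul_prod_erase _ _ (Finset.mem_univ i)]
  congr 1
  · simp
  · exact Finset.prod_congr rfl fun j hj => by rw [Function.update_of_ne (Finset.ne_of_mem_erase hj)]

theorem measurable_tens {d : ℕ} {φ : Fin d → ℝ → ℝ} (hφ : ∀ j, BddMeas (φ j)) :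
    Measurable (tens φ) :=
  Finset.measurable_fun_prod _ fun j _ => (hφ j).measurable.comp (measurable_pi_apply j)

theorem exists_bound_tens {d : ℕ} {φ : Fin d → ℝ → ℝ} (hφ : ∀ j, BddMeas (φ j)) :
    ∃ C, ∀ x, |tens φ x| ≤ C := by
  choose C hC using fun j => (hφ j).bound
  refine ⟨∏ j, C j, fun x => ?_⟩
  rw [tens, Finset.abs_prod]
  exact Finset.prod_le_prod (fun _ _ => abs_nonneg _) fun j _ => hC j _

theorem memLp_tens {d : ℕ} {φ : Fin d → ℝ → ℝ} (hφ : ∀ j, BddMeas (φ j)) :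
    MemLp (tens φ) 2 (mu d) := by
  obtain ⟨C, hC⟩ := exists_bound_tens hφ
  exact MemLp.of_bound (measurable_tens hφ).aestronglyMeasurable C (ae_of_all _ hC)

open Classical in
/-- The class in `L²` of a tensor product (zero if it is not square-integrable). -/
def tensLp {d : ℕ} (φ : Fin d → ℝ → ℝ) : L2Cube d :=
  if h : MemLp (tens φ) 2 (mu d) then h.toLp else 0

theorem coeFn_tensLp {d : ℕ} {φ : Fin d → ℝ → ℝ} (hφ : ∀ j, BddMeas (φ j)) :
    tensLp φ =ᵐ[mu d] tens φ := by
  rw [tensLp, dif_pos (memLp_tens hφ)]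
  exact (memLp_tens hφ).coeFn_toLp

/-- The pairing `∫ f * (φ₁ ⊗ ⋯ ⊗ φ_d)`. -/
def pr {d : ℕ} (f : L2Cube d) (φ : Fin d → ℝ → ℝ) : ℝ := inner ℝ f (tensLp φ)

theorem pr_eq_integral {d : ℕ} (f : L2Cube d) {φ : Fin d → ℝ → ℝ} (hφ : ∀ j, BddMeas (φ j)) :
    pr f φ = ∫ x, f x * tens φ x ∂mu d := by
  rw [pr, L2.inner_def]
  apply integral_congr_ae
  filter_upwards [coeFn_tensLp hφ] with x hx
  rw [hx]; simp [mul_comm]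

theorem pr_add {d : ℕ} (f g : L2Cube d) (φ : Fin d → ℝ → ℝ) : pr (f + g) φ = pr f φ + pr g φ :=
  inner_add_left _ _ _

theorem pr_sub {d : ℕ} (f g : L2Cube d) (φ : Fin d → ℝ → ℝ) : pr (f - g) φ = pr f φ - pr g φ :=
  inner_sub_left _ _ _

theorem pr_neg {d : ℕ} (f : L2Cube d) (φ : Fin d → ℝ → ℝ) : pr (-f) φ = -pr f φ :=
  inner_neg_left _ _

theorem pr_smul {d : ℕ} (c : ℝ) (f : L2Cube d) (φ : Fin d → ℝ → ℝ) : pr (c • f) φ = c * pr f φ := by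
  simp [pr, inner_smul_left]

theorem pr_sum {d : ℕ} {ι : Type*} (s : Finset ι) (f : ι → L2Cube d) (φ : Fin d → ℝ → ℝ) :
    pr (∑ j ∈ s, f j) φ = ∑ j ∈ s, pr (f j) φ := sum_inner _ _ _

theorem ext_pr_test {d : ℕ} {f g : L2Cube d}
    (h : ∀ φ : Fin d → ℝ → ℝ, (∀ j, IsTest 0 1 (φ j)) → pr f φ = pr g φ) : f = g := by
  rw [← sub_eq_zero]
  refine Lp.ext ?_
  have hU : (univ.pi fun _ : Fin d => Ioo (0 : ℝ) 1) = unitCube d := rfl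
  have key := ae_eq_zero_of_forall_tens (d := d) (a := fun _ => 0) (b := fun _ => 1)
    (f := (f - g : L2Cube d)) ?_ ?_
  · rw [hU, restrict_unitCube] at key
    filter_upwards [key, Lp.coeFn_zero ℝ 2 (mu d)] with x hx h0
    rw [hx, h0]; rfl
  · rw [IntegrableOn, hU, restrict_unitCube]
    exact (Lp.memLp (f - g)).integrable one_le_two
  · intro φ hφ
    rw [hU, restrict_unitCube, ← pr_eq_integral _ fun j => (hφ j).bddMeas, pr_sub, h φ hφ, sub_self]

theorem ext_pr {d : ℕ} {f g : L2Cube d}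
    (h : ∀ φ : Fin d → ℝ → ℝ, (∀ j, BddMeas (φ j)) → pr f φ = pr g φ) : f = g :=
  ext_pr_test fun φ hφ => h φ fun j => (hφ j).bddMeas

theorem ae_mem_unitCube (d : ℕ) : ∀ᵐ x ∂mu d, ∀ i, x i ∈ Ioo (0 : ℝ) 1 := by
  rw [← restrict_unitCube]
  filter_upwards [ae_restrict_mem (MeasurableSet.univ_pi fun _ => measurableSet_Ioo)] with x hx i
  exact hx i (mem_univ i)

theorem integrable_mul_tens {d : ℕ} (f : L2Cube d) {φ : Fin d → ℝ → ℝ} (hφ : ∀ j, BddMeas (φ j)) :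
    Integrable (fun x => f x * tens φ x) (mu d) :=
  (Lp.memLp f).integrable_mul (memLp_tens hφ)

theorem pr_congr {d : ℕ} (f : L2Cube d) {φ ψ : Fin d → ℝ → ℝ} (hφ : ∀ j, BddMeas (φ j))
    (hψ : ∀ j, BddMeas (ψ j)) (h : ∀ j, ∀ t ∈ Ioo (0 : ℝ) 1, φ j t = ψ j t) :
    pr f φ = pr f ψ := by
  rw [pr_eq_integral f hφ, pr_eq_integral f hψ]
  apply integral_congr_ae
  filter_upwards [ae_mem_unitCube d] with x hx
  simp only [tens]
  rw [Finset.prod_congr rfl fun j _ => h j _ (hx j)]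

theorem pr_update_congr {d : ℕ} (f : L2Cube d) {φ : Fin d → ℝ → ℝ} (hφ : ∀ j, BddMeas (φ j))
    (i : Fin d) {ψ χ : ℝ → ℝ} (hψ : BddMeas ψ) (hχ : BddMeas χ)
    (h : ∀ t ∈ Ioo (0 : ℝ) 1, ψ t = χ t) :
    pr f (Function.update φ i ψ) = pr f (Function.update φ i χ) := by
  refine pr_congr f (BddMeas.forall_update hφ i hψ) (BddMeas.forall_update hφ i hχ) fun j t ht => ?_
  by_cases hj : j = i
  · subst hj; simpa using h t ht
  · simp [hj]

theorem pr_update_sub {d : ℕ} (f : L2Cube d) {φ : Fin d → ℝ → ℝ} (hφ : ∀ j, BddMeas (φ j))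
    (i : Fin d) {ψ χ : ℝ → ℝ} (hψ : BddMeas ψ) (hχ : BddMeas χ) :
    pr f (Function.update φ i fun t => ψ t - χ t) =
      pr f (Function.update φ i ψ) - pr f (Function.update φ i χ) := by
  rw [pr_eq_integral f (BddMeas.forall_update hφ i (hψ.sub hχ)),
    pr_eq_integral f (BddMeas.forall_update hφ i hψ),
    pr_eq_integral f (BddMeas.forall_update hφ i hχ),
    ← integral_sub (integrable_mul_tens f (BddMeas.forall_update hφ i hψ))
      (integrable_mul_tens f (BddMeas.forall_update hφ i hχ))]
  congr 1; ext x
  simp only [tens_update]; ring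

/-! ### Operators acting in one coordinate -/

/-- `A` acts in the coordinate `i`, its transpose being `a` on the `i`-th factor of tensor
products of bounded measurable functions. -/
structure Acts {d : ℕ} (i : Fin d) (A : L2Cube d →L[ℝ] L2Cube d) (a : (ℝ → ℝ) → ℝ → ℝ) : Prop where
  bdd : ∀ φ, BddMeas φ → BddMeas (a φ)
  pr_eq : ∀ f φ, (∀ j, BddMeas (φ j)) → pr (A f) φ = pr f (Function.update φ i (a (φ i)))

theorem Acts.one {d : ℕ} (i : Fin d) : Acts i (1 : L2Cube d →L[ℝ] L2Cube d) fun φ => φ :=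
  ⟨fun _ h => h, fun f φ _ => by simp⟩

theorem Acts.sub {d : ℕ} {i : Fin d} {A B : L2Cube d →L[ℝ] L2Cube d} {a b : (ℝ → ℝ) → ℝ → ℝ}
    (hA : Acts i A a) (hB : Acts i B b) : Acts i (A - B) fun φ t => a φ t - b φ t :=
  ⟨fun φ h => (hA.bdd φ h).sub (hB.bdd φ h), fun f φ hφ => by
    rw [sub_apply, pr_sub, hA.pr_eq f φ hφ, hB.pr_eq f φ hφ,
      ← pr_update_sub f hφ i (hA.bdd _ (hφ i)) (hB.bdd _ (hφ i))]⟩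

theorem Acts.mul {d : ℕ} {i : Fin d} {A B : L2Cube d →L[ℝ] L2Cube d} {a b : (ℝ → ℝ) → ℝ → ℝ}
    (hA : Acts i A a) (hB : Acts i B b) : Acts i (A * B) fun φ => b (a φ) :=
  ⟨fun φ h => hB.bdd _ (hA.bdd φ h), fun f φ hφ => by
    rw [mul_apply_eq_comp, hA.pr_eq _ φ hφ,
      hB.pr_eq _ _ (BddMeas.forall_update hφ i (hA.bdd _ (hφ i))), Function.update_self,
      Function.update_idem]⟩

theorem Acts.pow {d : ℕ} {i : Fin d} {A : L2Cube d →L[ℝ] L2Cube d} {a : (ℝ → ℝ) → ℝ → ℝ}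
    (hA : Acts i A a) (n : ℕ) : Acts i (A ^ n) a^[n] := by
  induction n with
  | zero => exact Acts.one i
  | succ n ih =>
    rw [pow_succ']
    exact hA.mul ih

theorem Acts.comm {d : ℕ} {i j : Fin d} (hij : i ≠ j) {A B : L2Cube d →L[ℝ] L2Cube d}
    {a b : (ℝ → ℝ) → ℝ → ℝ} (hA : Acts i A a) (hB : Acts j B b) (f : L2Cube d) :
    A (B f) = B (A f) := by
  refine ext_pr fun φ hφ => ?_
  rw [hA.pr_eq _ φ hφ, hB.pr_eq _ φ hφ,
    hB.pr_eq _ _ (BddMeas.forall_update hφ i (hA.bdd _ (hφ i))),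
    hA.pr_eq _ _ (BddMeas.forall_update hφ j (hB.bdd _ (hφ j))),
    Function.update_of_ne hij.symm, Function.update_of_ne hij, Function.update_comm hij]

theorem Acts.ext {d : ℕ} {i : Fin d} {A B : L2Cube d →L[ℝ] L2Cube d} {a b : (ℝ → ℝ) → ℝ → ℝ}
    (hA : Acts i A a) (hB : Acts i B b)
    (h : ∀ φ, BddMeas φ → ∀ t ∈ Ioo (0 : ℝ) 1, a φ t = b φ t) : A = B := by
  refine ContinuousLinearMap.ext fun f => ext_pr fun φ hφ => ?_
  rw [hA.pr_eq f φ hφ, hB.pr_eq f φ hφ]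
  exact pr_update_congr f hφ i (hA.bdd _ (hφ i)) (hB.bdd _ (hφ i)) (h _ (hφ i))

/-! ### Integral operators in one coordinate -/

/-- A bounded measurable kernel satisfying Schur's condition with constant `M` on `(0, 1)`. -/
structure SchurKernel (K : ℝ → ℝ → ℝ) (M : ℝ) : Prop where
  measurable : Measurable (Function.uncurry K)
  bound : ∃ B, ∀ x t, |K x t| ≤ B
  left : ∀ x, ∫ t, |K x t| ∂lam ≤ M
  right : ∀ t, ∫ x, |K x t| ∂lam ≤ M

/-- The transpose of the integral operator with kernel `K`. -/
def kact (K : ℝ → ℝ → ℝ) (φ : ℝ → ℝ) (t : ℝ) : ℝ := ∫ x, K x t * φ x ∂lam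

theorem SchurKernel.nonneg {K : ℝ → ℝ → ℝ} {M : ℝ} (hK : SchurKernel K M) : 0 ≤ M :=
  (integral_nonneg fun _ => abs_nonneg _).trans (hK.left 0)

theorem SchurKernel.bddMeas_left {K : ℝ → ℝ → ℝ} {M : ℝ} (hK : SchurKernel K M) (x : ℝ) :
    BddMeas (K x) :=
  ⟨hK.measurable.comp measurable_prodMk_left, hK.bound.imp fun _ h => h x⟩

theorem SchurKernel.bddMeas_kact {K : ℝ → ℝ → ℝ} {M : ℝ} (hK : SchurKernel K M) {φ : ℝ → ℝ}
    (hφ : BddMeas φ) : BddMeas (kact K φ) := by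
  obtain ⟨B, hB⟩ := hK.bound
  obtain ⟨C, hC⟩ := hφ.bound
  constructor
  · have : Measurable (Function.uncurry fun t x => K x t * φ x) :=
      (hK.measurable.comp measurable_swap).mul (hφ.measurable.comp measurable_snd)
    exact (StronglyMeasurable.integral_prod_right (ν := lam) this.stronglyMeasurable).measurable
  · refine ⟨B * C, fun t => ?_⟩
    have h := norm_integral_le_of_norm_le_const (μ := lam) (f := fun x => K x t * φ x) (C := B * C)
      (ae_of_all _ fun x => by
        rw [norm_mul]
        exact mul_le_mul (hB x t) (hC x) (norm_nonneg _) ((abs_nonneg _).trans (hB x t)))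
    simpa [kact] using h

/-- Multiplication by `κ (x, t)`, as an operator from functions of `x` to functions of `(x, t)`. -/
theorem exists_mulOp {d : ℕ} {κ : (Fin d → ℝ) × ℝ → ℝ} (hκ : Measurable κ) {B M : ℝ}
    (hM : 0 ≤ M) (hB : ∀ p, |κ p| ≤ B) (h : ∀ x, ∫ t, κ (x, t) ^ 2 ∂lam ≤ M) :
    ∃ U : L2Cube d →L[ℝ] Lp ℝ 2 ((mu d).prod lam), ‖U‖ ≤ √M ∧
      ∀ f, U f =ᵐ[(mu d).prod lam] fun p => κ p * f p.1 := by
  have hfst : MeasurePreserving Prod.fst ((mu d).prod lam) (mu d) := measurePreserving_fst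
  have hmem : ∀ f : L2Cube d, MemLp (fun p : (Fin d → ℝ) × ℝ => κ p * f p.1) 2
      ((mu d).prod lam) := fun f =>
    MemLp.of_le_mul (c := B) ((Lp.memLp f).comp_measurePreserving hfst)
      (hκ.aestronglyMeasurable.mul ((Lp.aestronglyMeasurable f).comp_measurePreserving hfst))
      (ae_of_all _ fun p => by
        rw [norm_mul]
        exact mul_le_mul_of_nonneg_right (hB p) (norm_nonneg _))
  let U : L2Cube d →ₗ[ℝ] Lp ℝ 2 ((mu d).prod lam) :=
    { toFun := fun f => (hmem f).toLp
      map_add' := fun f g => by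
        refine Lp.ext ?_
        filter_upwards [(hmem (f + g)).coeFn_toLp, Lp.coeFn_add ((hmem f).toLp) ((hmem g).toLp),
          (hmem f).coeFn_toLp, (hmem g).coeFn_toLp,
          hfst.quasiMeasurePreserving.ae (Lp.coeFn_add f g)] with p h1 h2 h3 h4 h5
        rw [h1, h2, Pi.add_apply, h3, h4, h5, Pi.add_apply, mul_add]
      map_smul' := fun c f => by
        refine Lp.ext ?_
        filter_upwards [(hmem (c • f)).coeFn_toLp, Lp.coeFn_smul c ((hmem f).toLp),
          (hmem f).coeFn_toLp, hfst.quasiMeasurePreserving.ae (Lp.coeFn_smul c f)] with p h1 h2 h3 h5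
        rw [h1, RingHom.id_apply, h2, Pi.smul_apply, h3, h5, Pi.smul_apply, smul_eq_mul, smul_eq_mul]
        ring }
  have hU : ∀ f, ‖U f‖ ≤ √M * ‖f‖ := by
    intro f
    rw [← sq_le_sq₀ (norm_nonneg _) (by positivity)]
    rw [mul_pow, Real.sq_sqrt hM, ← real_inner_self_eq_norm_sq, ← real_inner_self_eq_norm_sq,
      L2.inner_def, L2.inner_def]
    have h1 : ∫ p, inner ℝ (U f p) (U f p) ∂(mu d).prod lam =
        ∫ p, (κ p * f p.1) ^ 2 ∂(mu d).prod lam := by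
      apply integral_congr_ae
      filter_upwards [(hmem f).coeFn_toLp] with p hp
      change inner ℝ (((hmem f).toLp) p) (((hmem f).toLp) p) = _
      rw [hp, real_inner_self_eq_norm_sq, Real.norm_eq_abs, sq_abs]
    rw [h1, integral_prod _ (hmem f).integrable_sq, ← integral_const_mul]
    apply integral_mono (hmem f).integrable_sq.integral_prod_left
      ((L2.integrable_inner f f).const_mul M)
    intro x
    simp only [mul_pow, integral_mul_const, real_inner_self_eq_norm_sq, Real.norm_eq_abs, sq_abs]
    exact mul_le_mul_of_nonneg_right (h x) (sq_nonneg _)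
  exact ⟨U.mkContinuous _ hU, U.mkContinuous_norm_le (Real.sqrt_nonneg _) hU,
    fun f => (hmem f).coeFn_toLp⟩

/-- **Schur's test** for an integral operator acting in one coordinate. Splitting the kernel as
`K = |K|^{1/2} · (sign K |K|^{1/2})` factors the operator through functions of one more variable. -/
theorem exists_kernelOp {d : ℕ} (i : Fin d) {K : ℝ → ℝ → ℝ} {M : ℝ} (hK : SchurKernel K M) :
    ∃ A : L2Cube d →L[ℝ] L2Cube d, ‖A‖ ≤ M ∧ Acts i A (kact K) := by
  obtain ⟨B, hB⟩ := hK.bound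
  have hB0 : 0 ≤ B := (abs_nonneg _).trans (hB 0 0)
  have hi : Measurable fun p : (Fin d → ℝ) × ℝ => p.1 i :=
    (measurable_pi_apply i).comp measurable_fst
  have hm1 : Measurable fun p : (Fin d → ℝ) × ℝ => K p.2 (p.1 i) :=
    hK.measurable.comp (measurable_snd.prodMk hi)
  have hm2 : Measurable fun p : (Fin d → ℝ) × ℝ => K (p.1 i) p.2 :=
    hK.measurable.comp (hi.prodMk measurable_snd)
  obtain ⟨U, hUn, hU⟩ := exists_mulOp (d := d) (κ := fun p => √|K p.2 (p.1 i)|) (B := √B) (M := M)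
    (hm1.norm.sqrt) hK.nonneg (fun p => by
      rw [abs_of_nonneg (Real.sqrt_nonneg _)]; exact Real.sqrt_le_sqrt (hB _ _))
    (fun x => by simpa only [Real.sq_sqrt (abs_nonneg _)] using hK.right (x i))
  obtain ⟨V, hVn, hV⟩ := exists_mulOp (d := d)
    (κ := fun p => SignType.sign (K (p.1 i) p.2) * √|K (p.1 i) p.2|) (B := √B) (M := M)
    (by
      refine Measurable.mul ?_ hm2.norm.sqrt
      have : Measurable fun y : ℝ => ((SignType.sign y : SignType) : ℝ) := by
        have he : (fun y : ℝ => ((SignType.sign y : SignType) : ℝ)) =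
            fun y => if 0 < y then 1 else if y < 0 then -1 else 0 := by
          ext y; rw [sign_apply]; split_ifs <;> simp
        rw [he]
        exact Measurable.ite measurableSet_Ioi measurable_const
          (Measurable.ite measurableSet_Iio measurable_const measurable_const)
      exact this.comp hm2) hK.nonneg
    (fun p => by
      have h1 : |((SignType.sign (K (p.1 i) p.2) : SignType) : ℝ)| ≤ 1 := by
        rcases SignType.sign (K (p.1 i) p.2) with _ | _ | _ <;> simp
      rw [abs_mul, abs_of_nonneg (Real.sqrt_nonneg _)]
      calc _ ≤ 1 * √B := mul_le_mul h1 (Real.sqrt_le_sqrt (hB _ _)) (Real.sqrt_nonneg _) zero_le_one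
        _ = √B := one_mul _)
    (fun x => by
      refine le_trans (integral_mono_of_nonneg (ae_of_all _ fun t => sq_nonneg _)
        (hK.bddMeas_left (x i)).integrable.norm (ae_of_all _ fun t => ?_)) (hK.left (x i))
      have h1 : ((SignType.sign (K (x i) t) : SignType) : ℝ) ^ 2 ≤ 1 := by
        rcases SignType.sign (K (x i) t) with _ | _ | _ <;> simp
      simp only [mul_pow, Real.sq_sqrt (abs_nonneg _)]
      exact mul_le_of_le_one_left (abs_nonneg _) h1)
  let σ := Lp.compMeasurePreservingₗᵢ (E := ℝ) (p := 2) ℝ (swapCoord i)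
    (measurePreserving_swapCoord i)
  let A : L2Cube d →L[ℝ] L2Cube d :=
    (ContinuousLinearMap.adjoint V).comp (σ.toContinuousLinearMap.comp U)
  refine ⟨A, ?_, fun φ hφ => hK.bddMeas_kact hφ, fun f φ hφ => ?_⟩
  · calc ‖A‖ ≤ ‖ContinuousLinearMap.adjoint V‖ * (‖σ.toContinuousLinearMap‖ * ‖U‖) :=
        (ContinuousLinearMap.opNorm_comp_le _ _).trans
          (mul_le_mul_of_nonneg_left (ContinuousLinearMap.opNorm_comp_le _ _) (norm_nonneg _))
      _ ≤ √M * (1 * √M) := by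
        rw [LinearIsometryEquiv.norm_map]
        gcongr
        exact σ.norm_toContinuousLinearMap_le
      _ = M := by rw [one_mul, Real.mul_self_sqrt hK.nonneg]
  · have hsw : ∀ p : (Fin d → ℝ) × ℝ, swapCoord i (swapCoord i p) = p := fun p => by
      simp [swapCoord]
    let G : (Fin d → ℝ) × ℝ → ℝ := fun p => f p.1 * K p.2 (p.1 i) * tens φ (swapCoord i p).1
    have hfst : MeasurePreserving Prod.fst ((mu d).prod lam) (mu d) := measurePreserving_fst
    obtain ⟨C, hC⟩ := exists_bound_tens hφ
    have hG : Integrable G ((mu d).prod lam) := by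
      have h1 : Integrable (fun p : (Fin d → ℝ) × ℝ => f p.1) ((mu d).prod lam) :=
        hfst.integrable_comp_of_integrable ((Lp.memLp f).integrable one_le_two)
      refine (h1.mul_bdd (c := B) hm1.aestronglyMeasurable (ae_of_all _ fun p => hB _ _)).mul_bdd
        (c := C) ?_ (ae_of_all _ fun p => hC _)
      exact ((measurable_tens hφ).comp
        (measurable_fst.comp (measurable_swapCoord i))).aestronglyMeasurable
    have h1 : pr (A f) φ = ∫ p, G (swapCoord i p) ∂(mu d).prod lam := by
      rw [pr]
      change inner ℝ (ContinuousLinearMap.adjoint V (σ (U f))) (tensLp φ) = _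
      rw [ContinuousLinearMap.adjoint_inner_left, L2.inner_def]
      apply integral_congr_ae
      filter_upwards [hV (tensLp φ), hfst.quasiMeasurePreserving.ae (coeFn_tensLp hφ),
        Lp.coeFn_compMeasurePreserving (U f) (measurePreserving_swapCoord i),
        (measurePreserving_swapCoord i).quasiMeasurePreserving.ae (hU f)] with p h1 h2 h3 h4
      have h5 : σ (U f) p = U f (swapCoord i p) := h3
      rw [h5, h1, h2, h4]
      simp only [G, hsw, RCLike.inner_apply, conj_trivial]
      simp only [swapCoord, Function.update_self]
      have h6 : ((SignType.sign (K (p.1 i) p.2) : SignType) : ℝ) * √|K (p.1 i) p.2| *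
          √|K (p.1 i) p.2| = K (p.1 i) p.2 := by
        rw [mul_assoc, Real.mul_self_sqrt (abs_nonneg _), sign_mul_abs]
      linear_combination (f (Function.update p.1 i p.2) * tens φ p.1) * h6
    have h2 : ∫ p, G (swapCoord i p) ∂(mu d).prod lam = ∫ p, G p ∂(mu d).prod lam := by
      have := integral_map (μ := (mu d).prod lam) (f := G) (measurable_swapCoord i).aemeasurable
        (by rw [(measurePreserving_swapCoord i).map_eq]; exact hG.aestronglyMeasurable)
      rw [← this, (measurePreserving_swapCoord i).map_eq]
    rw [h1, h2, integral_prod _ hG,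
      pr_eq_integral _ (BddMeas.forall_update hφ i (hK.bddMeas_kact (hφ i)))]
    congr 1; ext x
    simp only [G, swapCoord, tens_update, tens_apply_update]
    rw [kact, ← integral_mul_const, ← integral_const_mul]
    congr 1; ext t; ring

/-! ### Reproducing kernels of polynomials -/

open Polynomial in
theorem exists_antiderivative (p : ℝ[X]) :
    ∃ R : ℝ[X], derivative R = p ∧ R.natDegree ≤ p.natDegree + 1 := by
  refine ⟨∑ n ∈ Finset.range (p.natDegree + 1), monomial (n + 1) (p.coeff n / (n + 1)), ?_, ?_⟩
  · rw [derivative_sum]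
    conv_rhs => rw [p.as_sum_range]
    refine Finset.sum_congr rfl fun n _ => ?_
    rw [derivative_monomial, Nat.add_sub_cancel]
    congr 1
    push_cast
    field_simp
  · refine natDegree_sum_le_of_forall_le _ _ fun n hn => ?_
    have := Finset.mem_range.1 hn
    exact (natDegree_monomial_le _).trans (by omega)

theorem intervalIntegral_eval_mul (p r : Polynomial ℝ) (a b : ℝ) :
    IntervalIntegrable (fun x => p.eval x * r.eval x) volume a b :=
  (p.continuous.mul r.continuous).intervalIntegrable _ _

open Polynomial in
/-- Polynomials `e₀, …, e_k` with the reproducing property of an `L²(0,1)`-orthonormal basis of the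
polynomials of degree at most `k`. -/
theorem exists_reproducing (k : ℕ) : ∃ e : ℕ → ℝ[X],
    (∀ n ∈ Finset.range (k + 1), (e n).natDegree ≤ k) ∧ ∀ r : ℝ[X], r.natDegree ≤ k →
      ∑ n ∈ Finset.range (k + 1), C (∫ x in (0 : ℝ)..1, (e n).eval x * r.eval x) * e n = r := by
  induction k with
  | zero =>
    refine ⟨fun _ => 1, fun _ _ => by simp, fun r hr => ?_⟩
    rw [eq_C_of_natDegree_le_zero hr]
    simp
  | succ k ih =>
    obtain ⟨e, he, hrep⟩ := ih
    let ip : ℝ[X] → ℝ[X] → ℝ := fun p r => ∫ x in (0 : ℝ)..1, p.eval x * r.eval x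
    have ip_add : ∀ p r s, ip p (r + s) = ip p r + ip p s := fun p r s => by
      simp only [ip]
      rw [← intervalIntegral.integral_add (intervalIntegral_eval_mul p r 0 1)
        (intervalIntegral_eval_mul p s 0 1)]
      simp [mul_add]
    have ip_C : ∀ p r c, ip p (C c * r) = c * ip p r := fun p r c => by
      simp only [ip]
      rw [← intervalIntegral.integral_const_mul]
      congr 1; ext x; simp; ring
    have ip_comm : ∀ p r, ip p r = ip r p := fun p r => by simp only [ip, mul_comm]
    have ip_sum : ∀ p (f : ℕ → ℝ[X]) (s : Finset ℕ), ip p (∑ n ∈ s, f n) = ∑ n ∈ s, ip p (f n) := by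
      intro p f s
      induction s using Finset.induction_on with
      | empty => simp [ip]
      | insert a s ha ih => rw [Finset.sum_insert ha, Finset.sum_insert ha, ip_add, ih]
    -- one step of Gram–Schmidt: `E` is `X ^ (k + 1)` minus its projection to lower degree
    let S : ℝ[X] := ∑ n ∈ Finset.range (k + 1), C (ip (e n) (X ^ (k + 1))) * e n
    have hS : S.natDegree ≤ k := natDegree_sum_le_of_forall_le _ _ fun n hn =>
      (natDegree_C_mul_le _ _).trans (he n hn)
    let E : ℝ[X] := X ^ (k + 1) + C (-1) * S
    have hEd : E.natDegree ≤ k + 1 :=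
      natDegree_add_le_of_degree_le (natDegree_X_pow_le _)
        (((natDegree_C_mul_le _ _).trans hS).trans k.le_succ)
    have hEc : E.coeff (k + 1) = 1 := by
      simp only [E, coeff_add, coeff_X_pow, coeff_C_mul, if_true]
      rw [coeff_eq_zero_of_natDegree_lt (Nat.lt_succ_of_le hS)]; simp
    have hEo : ∀ p : ℝ[X], p.natDegree ≤ k → ip p E = 0 := by
      intro p hp
      simp only [E, ip_add, ip_C, S, ip_sum]
      have h1 : ip (X ^ (k + 1)) p = ip p (X ^ (k + 1)) := ip_comm _ _
      conv_lhs at h1 => rw [← hrep p hp]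
      rw [ip_sum] at h1
      rw [← h1, neg_one_mul, ← sub_eq_add_neg, sub_eq_zero]
      refine Finset.sum_congr rfl fun n _ => ?_
      rw [ip_C, ip_comm (X ^ (k + 1)) (e n), ip_comm p (e n), mul_comm]
    have hγ : 0 < ip E E := by
      have h0 : 0 ≤ ip E E :=
        intervalIntegral.integral_nonneg zero_le_one fun x _ => mul_self_nonneg _
      rcases h0.lt_or_eq with h | h
      · exact h
      · exfalso
        have hne : E ≠ 0 := fun h => by simp [h] at hEc
        have hz : ∀ x ∈ Ioo (0 : ℝ) 1, E.eval x = 0 := by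
          by_contra! hcon
          obtain ⟨c, hc, hc0⟩ := hcon
          have := intervalIntegral.integral_pos (a := 0) (b := 1)
            (f := fun x => E.eval x * E.eval x) zero_lt_one
            (E.continuous.mul E.continuous).continuousOn (fun x _ => mul_self_nonneg _)
            ⟨c, Ioo_subset_Icc_self hc, mul_self_pos.2 hc0⟩
          exact absurd h this.ne
        exact hne (eq_zero_of_infinite_isRoot E ((Ioo_infinite zero_lt_one).mono hz))
    refine ⟨fun n => if n ≤ k then e n else C (1 / √(ip E E)) * E, ?_, ?_⟩
    · intro n hn
      by_cases h : n ≤ k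
      · simp only [h, if_true]
        exact (he n (Finset.mem_range.2 (Nat.lt_succ_of_le h))).trans k.le_succ
      · simp only [h, if_false]
        exact (natDegree_C_mul_le _ _).trans hEd
    · intro r hr
      let c := r.coeff (k + 1)
      let r0 : ℝ[X] := r - C c * E
      have hr0 : r0.natDegree ≤ k := by
        rw [natDegree_le_iff_coeff_eq_zero]
        intro m hm
        simp only [r0, coeff_sub, coeff_C_mul]
        rcases (Nat.succ_le_of_lt hm).eq_or_lt with h | h
        · rw [← h, Nat.succ_eq_add_one, hEc]; simp [c]
        · rw [coeff_eq_zero_of_natDegree_lt (lt_of_le_of_lt hr h),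
            coeff_eq_zero_of_natDegree_lt (lt_of_le_of_lt hEd h)]; simp
      have hrr : r = r0 + C c * E := by simp [r0]
      rw [Finset.sum_range_succ]
      have h1 : ∑ n ∈ Finset.range (k + 1), C (∫ x in (0 : ℝ)..1,
          (if n ≤ k then e n else C (1 / √(ip E E)) * E).eval x * r.eval x) *
            (if n ≤ k then e n else C (1 / √(ip E E)) * E) = r0 := by
        rw [← hrep r0 hr0]
        refine Finset.sum_congr rfl fun n hn => ?_
        rw [if_pos (Nat.le_of_lt_succ (Finset.mem_range.1 hn))]
        have : ip (e n) r = ip (e n) r0 := by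
          conv_lhs => rw [hrr]
          rw [ip_add, ip_C, hEo _ (he n hn), mul_zero, add_zero]
        congr 2
      rw [h1]
      simp only [show ¬ k + 1 ≤ k by omega, if_false]
      have h2 : ip (C (1 / √(ip E E)) * E) r = 1 / √(ip E E) * (c * ip E E) := by
        have h5 : ip E r = c * ip E E := by
          conv_lhs => rw [hrr]
          rw [ip_add, ip_C, ip_comm E r0, hEo _ hr0, zero_add]
        rw [ip_comm, ip_C, ip_comm r E, h5]
      have h3 : C (∫ x in (0 : ℝ)..1, (C (1 / √(ip E E)) * E).eval x * r.eval x) *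
          (C (1 / √(ip E E)) * E) = C c * E := by
        change C (ip (C (1 / √(ip E E)) * E) r) * _ = _
        rw [h2, ← mul_assoc, ← C_mul]
        congr 2
        have := Real.mul_self_sqrt hγ.le
        have h4 : √(ip E E) ≠ 0 := (Real.sqrt_pos.2 hγ).ne'
        field_simp
        rw [sq, this, mul_comm]
      rw [h3, ← hrr]

/-- A family as in `exists_reproducing`. -/
def refBasis (k : ℕ) : ℕ → Polynomial ℝ := Classical.choose (exists_reproducing k)

theorem natDegree_refBasis {k n : ℕ} (hn : n ∈ Finset.range (k + 1)) :
    (refBasis k n).natDegree ≤ k :=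
  (Classical.choose_spec (exists_reproducing k)).1 n hn

/-- The reproducing kernel of the polynomials of degree at most `k` in `L²(a, a + ℓ)`. -/
def polyKer (k : ℕ) (a ℓ x t : ℝ) : ℝ :=
  ℓ⁻¹ * ∑ n ∈ Finset.range (k + 1),
    (refBasis k n).eval ((x - a) / ℓ) * (refBasis k n).eval ((t - a) / ℓ)

/-- The derivative of `polyKer` in its first variable, with the two powers of `ℓ⁻¹` kept apart. -/
def polyKerDeriv (k : ℕ) (a ℓ x t : ℝ) : ℝ :=
  ℓ⁻¹ * (ℓ⁻¹ * ∑ n ∈ Finset.range (k + 1),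
    (refBasis k n).derivative.eval ((x - a) / ℓ) * (refBasis k n).eval ((t - a) / ℓ))

theorem hasDerivAt_polyKer (k : ℕ) (a ℓ x t : ℝ) :
    HasDerivAt (fun x => polyKer k a ℓ x t) (polyKerDeriv k a ℓ x t) x := by
  unfold polyKer polyKerDeriv
  refine HasDerivAt.const_mul _ ?_
  rw [Finset.mul_sum]
  refine HasDerivAt.fun_sum fun n _ => ?_
  have h1 : HasDerivAt (fun x : ℝ => (x - a) / ℓ) (1 / ℓ) x :=
    ((hasDerivAt_id x).sub_const a).div_const ℓ
  have := (((refBasis k n).hasDerivAt ((x - a) / ℓ)).comp x h1).mul_const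
    ((refBasis k n).eval ((t - a) / ℓ))
  convert! this using 1
  ring

theorem continuous_polyKer (k : ℕ) (a ℓ : ℝ) :
    Continuous (Function.uncurry (polyKer k a ℓ)) := by
  unfold polyKer Function.uncurry
  fun_prop

theorem continuous_polyKerDeriv (k : ℕ) (a ℓ : ℝ) :
    Continuous (Function.uncurry (polyKerDeriv k a ℓ)) := by
  unfold polyKerDeriv Function.uncurry
  fun_prop

theorem exists_bound_polyKer (k : ℕ) : ∃ B : ℝ, 0 ≤ B ∧ ∀ a ℓ x t : ℝ, 0 < ℓ →
    x ∈ Icc a (a + ℓ) → t ∈ Icc a (a + ℓ) →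
      |polyKer k a ℓ x t| ≤ ℓ⁻¹ * B ∧ |polyKerDeriv k a ℓ x t| ≤ ℓ⁻¹ * (ℓ⁻¹ * B) := by
  have h1 : ∀ p : Polynomial ℝ, ∃ B : ℝ, 0 ≤ B ∧ ∀ y ∈ Icc (0 : ℝ) 1, |p.eval y| ≤ B := by
    intro p
    obtain ⟨B, hB⟩ := (isCompact_Icc (a := (0 : ℝ)) (b := 1)).exists_bound_of_continuousOn
      p.continuous.continuousOn
    exact ⟨B, (norm_nonneg _).trans (hB 0 ⟨le_rfl, zero_le_one⟩), hB⟩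
  choose β hβ0 hβ using fun n => h1 (refBasis k n)
  choose γ hγ0 hγ using fun n => h1 (refBasis k n).derivative
  refine ⟨∑ n ∈ Finset.range (k + 1), (β n + γ n) * β n,
    Finset.sum_nonneg fun n _ => mul_nonneg (add_nonneg (hβ0 n) (hγ0 n)) (hβ0 n), ?_⟩
  intro a ℓ x t hℓ hx ht
  have hy : ∀ x ∈ Icc a (a + ℓ), (x - a) / ℓ ∈ Icc (0 : ℝ) 1 := fun x hx =>
    ⟨div_nonneg (by linarith [hx.1]) hℓ.le, by rw [div_le_one hℓ]; linarith [hx.2]⟩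
  have hℓ' : 0 ≤ ℓ⁻¹ := (inv_pos.2 hℓ).le
  constructor
  · rw [polyKer, abs_mul, abs_of_nonneg hℓ']
    refine mul_le_mul_of_nonneg_left ((Finset.abs_sum_le_sum_abs _ _).trans
      (Finset.sum_le_sum fun n _ => ?_)) hℓ'
    rw [abs_mul]
    refine mul_le_mul ((hβ n _ (hy x hx)).trans (le_add_of_nonneg_right (hγ0 n)))
      (hβ n _ (hy t ht)) (abs_nonneg _) (add_nonneg (hβ0 n) (hγ0 n))
  · rw [polyKerDeriv, abs_mul, abs_of_nonneg hℓ', abs_mul, abs_of_nonneg hℓ']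
    refine mul_le_mul_of_nonneg_left (mul_le_mul_of_nonneg_left
      ((Finset.abs_sum_le_sum_abs _ _).trans (Finset.sum_le_sum fun n _ => ?_)) hℓ') hℓ'
    rw [abs_mul]
    refine mul_le_mul ((hγ n _ (hy x hx)).trans (le_add_of_nonneg_left (hβ0 n)))
      (hβ n _ (hy t ht)) (abs_nonneg _) (add_nonneg (hβ0 n) (hγ0 n))

open Polynomial in
/-- The reproducing property transported from `(0, 1)` to `(a, a + ℓ)`. -/
theorem refBasis_scaled {k : ℕ} {a ℓ : ℝ} (hℓ : 0 < ℓ) {r : ℝ[X]} (hr : r.natDegree ≤ k) :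
    ∑ n ∈ Finset.range (k + 1), C (ℓ⁻¹ * ∫ t in a..a + ℓ,
      (refBasis k n).eval ((t - a) / ℓ) * r.eval t) * refBasis k n = r.comp (C ℓ * X + C a) := by
  have hd : (r.comp (C ℓ * X + C a)).natDegree ≤ k := by
    refine natDegree_comp_le.trans ?_
    refine (Nat.mul_le_mul hr (natDegree_linear_le (a := ℓ) (b := a))).trans (by simp)
  rw [← (Classical.choose_spec (exists_reproducing k)).2 _ hd]
  refine Finset.sum_congr rfl fun n _ => ?_
  congr 2
  have h2 := intervalIntegral.integral_comp_mul_add (a := 0) (b := 1)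
    (fun t => (refBasis k n).eval ((t - a) / ℓ) * r.eval t) hℓ.ne' a
  rw [mul_zero, zero_add, mul_one, smul_eq_mul, add_comm ℓ a] at h2
  rw [← h2]
  congr 1; ext y
  have : (ℓ * y + a - a) / ℓ = y := by field_simp; ring
  rw [this, eval_comp]
  simp [refBasis]

theorem integral_polyKer_mul {k : ℕ} {a ℓ : ℝ} (hℓ : 0 < ℓ) {r : Polynomial ℝ}
    (hr : r.natDegree ≤ k) (x : ℝ) :
    ∫ t in a..a + ℓ, polyKer k a ℓ x t * r.eval t = r.eval x := by
  have h1 := congrArg (Polynomial.eval ((x - a) / ℓ)) (refBasis_scaled (a := a) hℓ hr)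
  rw [Polynomial.eval_comp, Polynomial.eval_finsetSum] at h1
  have h2 : ℓ * ((x - a) / ℓ) + a = x := by field_simp; ring
  simp only [Polynomial.eval_add, Polynomial.eval_mul, Polynomial.eval_C, Polynomial.eval_X, h2]
    at h1
  rw [← h1]
  simp only [polyKer, mul_assoc, Finset.sum_mul, Finset.mul_sum]
  rw [intervalIntegral.integral_finsetSum]
  · refine Finset.sum_congr rfl fun n _ => ?_
    rw [intervalIntegral.integral_const_mul, intervalIntegral.integral_const_mul]; ring
  · intro n _
    apply Continuous.intervalIntegrable
    fun_prop

theorem integral_polyKerDeriv_mul {k : ℕ} {a ℓ : ℝ} (hℓ : 0 < ℓ) {r : Polynomial ℝ}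
    (hr : r.natDegree ≤ k) (x : ℝ) :
    ∫ t in a..a + ℓ, polyKerDeriv k a ℓ x t * r.eval t = r.derivative.eval x := by
  have h1 := congrArg (fun p => Polynomial.eval ((x - a) / ℓ) (Polynomial.derivative p))
    (refBasis_scaled (a := a) hℓ hr)
  have h2 : ℓ * ((x - a) / ℓ) + a = x := by field_simp; ring
  simp only [Polynomial.derivative_comp, Polynomial.derivative_sum, Polynomial.derivative_C_mul,
    Polynomial.eval_finsetSum, Polynomial.eval_comp, Polynomial.derivative_add,
    Polynomial.derivative_C, Polynomial.derivative_X,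
    Polynomial.eval_add, Polynomial.eval_mul, Polynomial.eval_C, Polynomial.eval_X, h2, mul_one,
    add_zero] at h1
  have h3 : r.derivative.eval x = ℓ⁻¹ * (ℓ * r.derivative.eval x) := by field_simp
  rw [h3, ← h1]
  simp only [polyKerDeriv, mul_assoc, Finset.sum_mul, Finset.mul_sum]
  rw [intervalIntegral.integral_finsetSum]
  · refine Finset.sum_congr rfl fun n _ => ?_
    rw [intervalIntegral.integral_const_mul, intervalIntegral.integral_const_mul,
      intervalIntegral.integral_const_mul]; ring
  · intro n _
    apply Continuous.intervalIntegrable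
    fun_prop

section Grids

/-! ### Kernels that act cell by cell on a grid -/

/-- A grid `0 = τ 0 < τ 1 < ⋯ < τ M = 1` with mesh size at most `h`. -/
structure IsGrid (τ : ℕ → ℝ) (M : ℕ) (h : ℝ) : Prop where
  zero : τ 0 = 0
  last : τ M = 1
  lt : ∀ j < M, τ j < τ (j + 1)
  len : ∀ j < M, τ (j + 1) - τ j ≤ h

variable {τ : ℕ → ℝ} {M : ℕ} {h : ℝ}

theorem grid_mono (hlt : ∀ j < M, τ j < τ (j + 1)) {i j : ℕ} (hij : i ≤ j) (hj : j ≤ M) :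
    τ i ≤ τ j := by
  induction j, hij using Nat.le_induction with
  | base => exact le_rfl
  | succ j _ ih => exact (ih (by omega)).trans (hlt j (by omega)).le

theorem grid_cell_unique (hlt : ∀ j < M, τ j < τ (j + 1)) {t : ℝ} {i j : ℕ} (hi : i < M)
    (hj : j < M) (hti : t ∈ Ico (τ i) (τ (i + 1))) (htj : t ∈ Ico (τ j) (τ (j + 1))) : i = j := by
  by_contra hne
  rcases Nat.lt_or_gt_of_ne hne with h | h
  · exact absurd (hti.2.trans_le (grid_mono hlt (Nat.succ_le_of_lt h) hj.le)) (not_lt.2 htj.1)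
  · exact absurd (htj.2.trans_le (grid_mono hlt (Nat.succ_le_of_lt h) hi.le)) (not_lt.2 hti.1)

theorem exists_grid_cell {t : ℝ} (ht : t ∈ Ico (τ 0) (τ M)) :
    ∃ j < M, t ∈ Ico (τ j) (τ (j + 1)) := by
  classical
  have hex : ∃ j, t < τ j := ⟨M, ht.2⟩
  have h0 : Nat.find hex ≠ 0 := fun h0 => by
    have := Nat.find_spec hex
    rw [h0] at this
    exact absurd ht.1 (not_le.2 this)
  obtain ⟨j, hj⟩ := Nat.exists_eq_succ_of_ne_zero h0
  refine ⟨j, ?_, ?_, ?_⟩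
  · have : Nat.find hex ≤ M := Nat.find_min' hex ht.2
    omega
  · exact not_lt.1 (Nat.find_min hex (m := j) (by omega))
  · rw [← Nat.succ_eq_add_one, ← hj]; exact Nat.find_spec hex

theorem IsGrid.mono (G : IsGrid τ M h) {i j : ℕ} (hij : i ≤ j) (hj : j ≤ M) : τ i ≤ τ j :=
  grid_mono G.lt hij hj

theorem IsGrid.nonneg (G : IsGrid τ M h) {j : ℕ} (hj : j ≤ M) : 0 ≤ τ j :=
  G.zero ▸ G.mono (Nat.zero_le j) hj

theorem IsGrid.le_one (G : IsGrid τ M h) {j : ℕ} (hj : j ≤ M) : τ j ≤ 1 :=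
  G.last ▸ G.mono hj le_rfl

theorem IsGrid.mesh_pos (G : IsGrid τ M h) : 0 < h := by
  have hM : 0 < M := by
    rcases Nat.eq_zero_or_pos M with h0 | h0
    · have h1 := G.last
      rw [h0, G.zero] at h1
      exact absurd h1 zero_ne_one
    · exact h0
  linarith [G.lt 0 hM, G.len 0 hM]

theorem IsGrid.exists_cell (G : IsGrid τ M h) {t : ℝ} (ht : t ∈ Ico (0 : ℝ) 1) :
    ∃ j < M, t ∈ Ico (τ j) (τ (j + 1)) :=
  exists_grid_cell (by rwa [G.zero, G.last])

theorem IsGrid.cell_unique (G : IsGrid τ M h) {t : ℝ} {i j : ℕ} (hi : i < M) (hj : j < M)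
    (hti : t ∈ Ico (τ i) (τ (i + 1))) (htj : t ∈ Ico (τ j) (τ (j + 1))) : i = j :=
  grid_cell_unique G.lt hi hj hti htj

theorem IsGrid.cell_subset (G : IsGrid τ M h) {j : ℕ} (hj : j < M) :
    Ico (τ j) (τ (j + 1)) ⊆ Ico (0 : ℝ) 1 := fun _ ht =>
  ⟨(G.nonneg hj.le).trans ht.1, ht.2.trans_le (G.le_one hj)⟩

open Classical in
/-- The kernel equal to `κ j` on the square of the `j`-th cell of the grid, and to zero off the
squares of the cells. -/
def cellKer (τ : ℕ → ℝ) (M : ℕ) (κ : ℕ → ℝ → ℝ → ℝ) (x t : ℝ) : ℝ :=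
  ∑ j ∈ Finset.range M, if x ∈ Ico (τ j) (τ (j + 1)) ∧ t ∈ Ico (τ j) (τ (j + 1)) then κ j x t else 0

theorem cellKer_right (G : IsGrid τ M h) (κ : ℕ → ℝ → ℝ → ℝ) {j : ℕ} (hj : j < M) {t : ℝ}
    (ht : t ∈ Ico (τ j) (τ (j + 1))) (x : ℝ) :
    cellKer τ M κ x t = (Ico (τ j) (τ (j + 1))).indicator (fun x => κ j x t) x := by
  classical
  rw [cellKer, Finset.sum_eq_single_of_mem j (Finset.mem_range.2 hj)]
  · by_cases hx : x ∈ Ico (τ j) (τ (j + 1))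
    · rw [if_pos ⟨hx, ht⟩, indicator_of_mem hx]
    · rw [if_neg fun hc => hx hc.1, indicator_of_notMem hx]
  · intro i hi hij
    exact if_neg fun hc => hij (G.cell_unique (Finset.mem_range.1 hi) hj hc.2 ht)

theorem cellKer_swap (κ : ℕ → ℝ → ℝ → ℝ) (x t : ℝ) :
    cellKer τ M κ x t = cellKer τ M (fun j x t => κ j t x) t x := by
  simp only [cellKer, and_comm]

theorem cellKer_right_eq_zero (G : IsGrid τ M h) (κ : ℕ → ℝ → ℝ → ℝ) {t : ℝ}
    (ht : t ∉ Ico (0 : ℝ) 1) (x : ℝ) : cellKer τ M κ x t = 0 :=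
  Finset.sum_eq_zero fun _ hj => if_neg fun hc => ht (G.cell_subset (Finset.mem_range.1 hj) hc.2)

theorem integral_lam_indicator (f : ℝ → ℝ) {a b : ℝ} (h0 : 0 ≤ a) (hab : a ≤ b) (h1 : b ≤ 1) :
    ∫ x, (Ico a b).indicator f x ∂lam = ∫ x in a..b, f x := by
  rw [integral_indicator measurableSet_Ico, lam, Measure.restrict_congr_set Ioo_ae_eq_Ico,
    Measure.restrict_restrict measurableSet_Ico,
    inter_eq_left.2 (Ico_subset_Ico h0 h1), intervalIntegral.integral_of_le hab,
    restrict_Ico_eq_restrict_Ioc]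

/-- On a cell, the operator with a kernel `cellKer` only sees this cell. -/
theorem kact_cellKer (G : IsGrid τ M h) (κ : ℕ → ℝ → ℝ → ℝ) (φ : ℝ → ℝ) {j : ℕ} (hj : j < M)
    {t : ℝ} (ht : t ∈ Ico (τ j) (τ (j + 1))) :
    kact (cellKer τ M κ) φ t = ∫ x in τ j..τ (j + 1), κ j x t * φ x := by
  rw [kact, ← integral_lam_indicator _ (G.nonneg hj.le) (G.lt j hj).le (G.le_one hj)]
  congr 1; ext x
  rw [cellKer_right G κ hj ht, indicator_mul_left]

theorem kact_cellKer_eq_zero (G : IsGrid τ M h) (κ : ℕ → ℝ → ℝ → ℝ) (φ : ℝ → ℝ) {t : ℝ}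
    (ht : t ∉ Ico (0 : ℝ) 1) : kact (cellKer τ M κ) φ t = 0 := by
  simp [kact, cellKer_right_eq_zero G κ ht]

theorem integral_abs_cellKer_le (G : IsGrid τ M h) {κ : ℕ → ℝ → ℝ → ℝ} {β : ℕ → ℝ} {S : ℝ}
    (hS : 0 ≤ S)
    (hβ : ∀ j < M, ∀ x ∈ Ico (τ j) (τ (j + 1)), ∀ t ∈ Ico (τ j) (τ (j + 1)), |κ j x t| ≤ β j)
    (hβS : ∀ j < M, β j * (τ (j + 1) - τ j) ≤ S) (t : ℝ) :
    ∫ x, |cellKer τ M κ x t| ∂lam ≤ S := by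
  by_cases ht : t ∈ Ico (0 : ℝ) 1
  · obtain ⟨j, hj, htj⟩ := G.exists_cell ht
    refine le_trans ?_ (hβS j hj)
    have hb : β j * (τ (j + 1) - τ j) =
        ∫ x, (Ico (τ j) (τ (j + 1))).indicator (fun _ => β j) x ∂lam := by
      rw [integral_lam_indicator _ (G.nonneg hj.le) (G.lt j hj).le (G.le_one hj)]
      simp [mul_comm]
    rw [hb]
    apply integral_mono_of_nonneg (ae_of_all _ fun _ => abs_nonneg _)
      ((integrable_const _).indicator measurableSet_Ico)
    refine ae_of_all _ fun x => ?_
    simp only [cellKer_right G κ hj htj]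
    by_cases hx : x ∈ Ico (τ j) (τ (j + 1))
    · rw [indicator_of_mem hx, indicator_of_mem hx]; exact hβ j hj x hx t htj
    · rw [indicator_of_notMem hx, indicator_of_notMem hx]; simp
  · simpa [cellKer_right_eq_zero G κ ht] using hS

theorem schurKernel_cellKer (G : IsGrid τ M h) {κ : ℕ → ℝ → ℝ → ℝ}
    (hm : ∀ j, Measurable (Function.uncurry (κ j))) {β : ℕ → ℝ} {S : ℝ} (hS : 0 ≤ S)
    (hβ : ∀ j < M, ∀ x ∈ Ico (τ j) (τ (j + 1)), ∀ t ∈ Ico (τ j) (τ (j + 1)), |κ j x t| ≤ β j)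
    (hβS : ∀ j < M, β j * (τ (j + 1) - τ j) ≤ S) : SchurKernel (cellKer τ M κ) S := by
  classical
  refine ⟨?_, ⟨∑ j ∈ Finset.range M, |β j|, fun x t => ?_⟩, fun x => ?_,
    integral_abs_cellKer_le G hS hβ hβS⟩
  · change Measurable fun p : ℝ × ℝ => ∑ j ∈ Finset.range M,
      if p.1 ∈ Ico (τ j) (τ (j + 1)) ∧ p.2 ∈ Ico (τ j) (τ (j + 1)) then κ j p.1 p.2 else 0
    refine Finset.measurable_fun_sum _ fun j _ => ?_
    refine Measurable.ite ?_ (hm j) measurable_const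
    exact (measurable_fst measurableSet_Ico).inter (measurable_snd measurableSet_Ico)
  · refine (Finset.abs_sum_le_sum_abs _ _).trans (Finset.sum_le_sum fun j hj => ?_)
    split_ifs with hc
    · exact (hβ j (Finset.mem_range.1 hj) x hc.1 t hc.2).trans (le_abs_self _)
    · simp
  · simp only [cellKer_swap κ x]
    exact integral_abs_cellKer_le G hS (fun j hj t ht x hx => hβ j hj x hx t ht) hβS x

/-- Kernel of the `L²`-orthogonal projection onto the piecewise polynomials on a grid. -/
def projKer (k : ℕ) (τ : ℕ → ℝ) (M : ℕ) : ℝ → ℝ → ℝ :=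
  cellKer τ M fun j => polyKer k (τ j) (τ (j + 1) - τ j)

/-- Kernel of the cellwise derivative of the projection onto the piecewise polynomials. -/
def derivKer (k : ℕ) (τ : ℕ → ℝ) (M : ℕ) : ℝ → ℝ → ℝ :=
  cellKer τ M fun j => polyKerDeriv k (τ j) (τ (j + 1) - τ j)

/-- `derivKer` multiplied by the length of the cell. The Schur bound of `derivKer` itself grows like
the inverse of the smallest cell, while the cells of a grid need not have comparable lengths. -/
def derivKerScaled (k : ℕ) (τ : ℕ → ℝ) (M : ℕ) : ℝ → ℝ → ℝ :=
  cellKer τ M fun j x t => (τ (j + 1) - τ j) * polyKerDeriv k (τ j) (τ (j + 1) - τ j) x t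

open Classical in
/-- Kernel whose transpose is integration from the left end point of the cell. -/
def antiKer (τ : ℕ → ℝ) (M : ℕ) : ℝ → ℝ → ℝ := cellKer τ M fun _ x t => if x < t then 1 else 0

open Classical in
/-- `antiKer` divided by the length of the cell, to be composed with `derivKerScaled`. -/
def antiKerScaled (τ : ℕ → ℝ) (M : ℕ) : ℝ → ℝ → ℝ :=
  cellKer τ M fun j x t => (τ (j + 1) - τ j)⁻¹ * if x < t then 1 else 0

theorem measurable_uncurry_lt :
    Measurable (Function.uncurry fun x t : ℝ => (open Classical in if x < t then (1 : ℝ) else 0)) := by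
  classical
  exact Measurable.ite (measurableSet_lt measurable_fst measurable_snd) measurable_const
    measurable_const

theorem mem_Icc_of_mem_cell {j : ℕ} {x : ℝ} (hx : x ∈ Ico (τ j) (τ (j + 1))) :
    x ∈ Icc (τ j) (τ j + (τ (j + 1) - τ j)) := by
  rw [add_sub_cancel]; exact Ico_subset_Icc_self hx

/-- Schur bounds, uniform over all grids, for the kernels above. -/
theorem exists_schur_bound (k : ℕ) : ∃ B : ℝ, 0 ≤ B ∧ ∀ (τ : ℕ → ℝ) (M : ℕ) (h : ℝ),
    IsGrid τ M h → SchurKernel (projKer k τ M) B ∧ SchurKernel (derivKerScaled k τ M) B := by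
  obtain ⟨B, hB0, hB⟩ := exists_bound_polyKer k
  refine ⟨B, hB0, fun τ M h G => ⟨?_, ?_⟩⟩
  · refine schurKernel_cellKer G (fun j => (continuous_polyKer _ _ _).measurable)
      (β := fun j => (τ (j + 1) - τ j)⁻¹ * B) hB0 ?_ ?_
    · intro j hj x hx t ht
      exact (hB _ _ x t (sub_pos.2 (G.lt j hj)) (mem_Icc_of_mem_cell hx) (mem_Icc_of_mem_cell ht)).1
    · intro j hj
      have := sub_pos.2 (G.lt j hj)
      apply le_of_eq; field_simp
  · refine schurKernel_cellKer G
      (fun j => (continuous_polyKerDeriv _ _ _).measurable.const_mul _)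
      (β := fun j => (τ (j + 1) - τ j)⁻¹ * B) hB0 ?_ ?_
    · intro j hj x hx t ht
      have hpos := sub_pos.2 (G.lt j hj)
      rw [abs_mul, abs_of_pos hpos]
      calc _ ≤ (τ (j + 1) - τ j) * ((τ (j + 1) - τ j)⁻¹ * ((τ (j + 1) - τ j)⁻¹ * B)) :=
            mul_le_mul_of_nonneg_left
              (hB _ _ x t hpos (mem_Icc_of_mem_cell hx) (mem_Icc_of_mem_cell ht)).2 hpos.le
        _ = _ := by field_simp
    · intro j hj
      have := sub_pos.2 (G.lt j hj)
      apply le_of_eq; field_simp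

theorem schurKernel_antiKer (G : IsGrid τ M h) : SchurKernel (antiKer τ M) h := by
  refine schurKernel_cellKer G (fun j => measurable_uncurry_lt) (β := fun _ => 1) G.mesh_pos.le
    (fun j _ x _ t _ => ?_) fun j hj => by rw [one_mul]; exact G.len j hj
  split_ifs <;> simp

theorem schurKernel_antiKerScaled (G : IsGrid τ M h) : SchurKernel (antiKerScaled τ M) 1 := by
  refine schurKernel_cellKer G (fun j => measurable_uncurry_lt.const_mul _)
    (β := fun j => (τ (j + 1) - τ j)⁻¹) zero_le_one (fun j hj x _ t _ => ?_) fun j hj => ?_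
  · have := sub_pos.2 (G.lt j hj)
    rw [abs_mul, abs_of_pos (inv_pos.2 this)]
    split_ifs <;> simp [this.le]
  · rw [inv_mul_cancel₀ (sub_pos.2 (G.lt j hj)).ne']

theorem exists_schurKernel_derivKer (k : ℕ) (G : IsGrid τ M h) :
    ∃ S, SchurKernel (derivKer k τ M) S := by
  obtain ⟨B, hB0, hB⟩ := exists_bound_polyKer k
  refine ⟨∑ j ∈ Finset.range M, (τ (j + 1) - τ j)⁻¹ * B,
    schurKernel_cellKer G (fun j => (continuous_polyKerDeriv _ _ _).measurable)
      (β := fun j => (τ (j + 1) - τ j)⁻¹ * ((τ (j + 1) - τ j)⁻¹ * B)) ?_ ?_ ?_⟩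
  · exact Finset.sum_nonneg fun j hj =>
      mul_nonneg (inv_nonneg.2 (sub_pos.2 (G.lt j (Finset.mem_range.1 hj))).le) hB0
  · intro j hj x hx t ht
    exact (hB _ _ x t (sub_pos.2 (G.lt j hj)) (mem_Icc_of_mem_cell hx) (mem_Icc_of_mem_cell ht)).2
  · intro j hj
    have hpos := sub_pos.2 (G.lt j hj)
    refine le_trans (le_of_eq ?_) (Finset.single_le_sum (s := Finset.range M)
      (f := fun j => (τ (j + 1) - τ j)⁻¹ * B) ?_ (Finset.mem_range.2 hj))
    · field_simp
    · exact fun j hj => mul_nonneg (inv_nonneg.2 (sub_pos.2 (G.lt j (Finset.mem_range.1 hj))).le) hB0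

/-! ### Cellwise orthogonality to polynomials -/

/-- `ψ` is orthogonal on each cell to the polynomials of degree less than `r`. -/
def CellOrth (τ : ℕ → ℝ) (M r : ℕ) (ψ : ℝ → ℝ) : Prop :=
  ∀ j < M, ∀ p : Polynomial ℝ, p.natDegree < r → ∫ x in τ j..τ (j + 1), ψ x * p.eval x = 0

theorem intervalIntegrable_mul_continuous {φ g : ℝ → ℝ} (hφ : BddMeas φ) (hg : Continuous g)
    (a b : ℝ) : IntervalIntegrable (fun x => φ x * g x) volume a b := by
  obtain ⟨C, hC⟩ := hφ.bound
  have h1 : IntervalIntegrable φ volume a b := by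
    refine (intervalIntegrable_const (c := C)).mono_fun hφ.measurable.aestronglyMeasurable ?_
    exact ae_of_all _ fun x => (hC x).trans (le_abs_self C)
  exact h1.mul_continuousOn hg.continuousOn

/-- Fubini on the square of a cell. -/
theorem integral_kernel_swap {κ : ℝ → ℝ → ℝ} (hm : Measurable (Function.uncurry κ)) {a b β : ℝ}
    (hab : a ≤ b) (hβ : ∀ x ∈ Ioc a b, ∀ t ∈ Ioc a b, |κ x t| ≤ β) {φ : ℝ → ℝ} (hφ : BddMeas φ)
    (p : Polynomial ℝ) :
    ∫ t in a..b, (∫ x in a..b, κ x t * φ x) * p.eval t =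
      ∫ x in a..b, φ x * ∫ t in a..b, κ x t * p.eval t := by
  obtain ⟨C, hC⟩ := hφ.bound
  obtain ⟨D, hD⟩ := (isCompact_Icc (a := a) (b := b)).exists_bound_of_continuousOn
    p.continuous.continuousOn
  simp only [intervalIntegral.integral_of_le hab, ← integral_mul_const, ← integral_const_mul]
  rw [integral_integral_swap]
  · congr 1; ext x; congr 1; ext t; ring
  · refine Integrable.of_bound (C := β * C * D) ?_ ?_
    · refine Measurable.aestronglyMeasurable ?_
      exact ((hm.comp measurable_swap).mul (hφ.measurable.comp measurable_snd)).mul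
        (p.continuous.measurable.comp measurable_fst)
    · rw [Measure.prod_restrict]
      filter_upwards [ae_restrict_mem (measurableSet_Ioc.prod measurableSet_Ioc)] with z hz
      have h1 := hβ z.2 hz.2 z.1 hz.1
      have h2 := hC z.2
      have h3 := hD z.1 (Ioc_subset_Icc_self hz.1)
      have hβ0 : 0 ≤ β := (abs_nonneg _).trans h1
      have hC0 : 0 ≤ C := (abs_nonneg _).trans h2
      simp only [Function.uncurry, norm_mul]
      exact mul_le_mul (mul_le_mul h1 h2 (abs_nonneg _) hβ0) h3 (norm_nonneg _)
        (mul_nonneg hβ0 hC0)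

theorem integral_congr_Ico {f g : ℝ → ℝ} {a b : ℝ} (hab : a ≤ b)
    (hfg : ∀ x ∈ Ico a b, f x = g x) : ∫ x in a..b, f x = ∫ x in a..b, g x := by
  rw [intervalIntegral.integral_of_le hab, intervalIntegral.integral_of_le hab,
    ← restrict_Ico_eq_restrict_Ioc]
  exact setIntegral_congr_fun measurableSet_Ico hfg

theorem exists_abs_le_of_continuous {κ : ℝ → ℝ → ℝ} (hκ : Continuous (Function.uncurry κ)) (a b : ℝ) :
    ∃ β, ∀ x ∈ Ioc a b, ∀ t ∈ Ioc a b, |κ x t| ≤ β := by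
  obtain ⟨β, hβ⟩ := ((isCompact_Icc (a := a) (b := b)).prod
    (isCompact_Icc (a := a) (b := b))).exists_bound_of_continuousOn hκ.continuousOn
  exact ⟨β, fun x hx t ht => hβ (x, t) ⟨Ioc_subset_Icc_self hx, Ioc_subset_Icc_self ht⟩⟩

theorem integral_projKer_mul (G : IsGrid τ M h) {k : ℕ} {φ : ℝ → ℝ} (hφ : BddMeas φ) {j : ℕ}
    (hj : j < M) {p : Polynomial ℝ} (hp : p.natDegree ≤ k) :
    ∫ t in τ j..τ (j + 1), kact (projKer k τ M) φ t * p.eval t =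
      ∫ x in τ j..τ (j + 1), φ x * p.eval x := by
  have hlt := G.lt j hj
  obtain ⟨β, hβ⟩ := exists_abs_le_of_continuous (continuous_polyKer k (τ j) (τ (j + 1) - τ j)) (τ j)
    (τ (j + 1))
  rw [integral_congr_Ico hlt.le fun t ht => by rw [projKer, kact_cellKer G _ φ hj ht],
    integral_kernel_swap (continuous_polyKer _ _ _).measurable hlt.le hβ hφ]
  congr 1; ext x
  have := integral_polyKer_mul (a := τ j) (sub_pos.2 hlt) hp x
  rw [add_sub_cancel] at this
  rw [this]

theorem integral_derivKer_mul (G : IsGrid τ M h) {k : ℕ} {φ : ℝ → ℝ} (hφ : BddMeas φ) {j : ℕ}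
    (hj : j < M) {p : Polynomial ℝ} (hp : p.natDegree ≤ k) :
    ∫ t in τ j..τ (j + 1), kact (derivKer k τ M) φ t * p.eval t =
      ∫ x in τ j..τ (j + 1), φ x * p.derivative.eval x := by
  have hlt := G.lt j hj
  obtain ⟨β, hβ⟩ := exists_abs_le_of_continuous (continuous_polyKerDeriv k (τ j) (τ (j + 1) - τ j)) (τ j)
    (τ (j + 1))
  rw [integral_congr_Ico hlt.le fun t ht => by rw [derivKer, kact_cellKer G _ φ hj ht],
    integral_kernel_swap (continuous_polyKerDeriv _ _ _).measurable hlt.le hβ hφ]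
  congr 1; ext x
  have := integral_polyKerDeriv_mul (a := τ j) (sub_pos.2 hlt) hp x
  rw [add_sub_cancel] at this
  rw [this]

theorem integral_antiKer_mul (G : IsGrid τ M h) {φ : ℝ → ℝ} (hφ : BddMeas φ) {j : ℕ}
    (hj : j < M) (R : Polynomial ℝ) :
    ∫ t in τ j..τ (j + 1), kact (antiKer τ M) φ t * R.derivative.eval t =
      ∫ x in τ j..τ (j + 1), φ x * (Polynomial.C (R.eval (τ (j + 1))) - R).eval x := by
  have hlt := G.lt j hj
  rw [integral_congr_Ico hlt.le fun t ht => by rw [antiKer, kact_cellKer G _ φ hj ht],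
    integral_kernel_swap measurable_uncurry_lt hlt.le
      (β := 1) (fun x _ t _ => by split_ifs <;> simp) hφ]
  apply integral_congr_Ico hlt.le
  intro x hx
  congr 1
  have h1 : ∀ t, (open Classical in if x < t then (1 : ℝ) else 0) * R.derivative.eval t =
      (Ioi x).indicator (fun t => R.derivative.eval t) t := fun t => by
    by_cases ht : x < t <;> simp [ht]
  simp only [h1]
  rw [intervalIntegral.integral_of_le hlt.le, integral_indicator measurableSet_Ioi,
    Measure.restrict_restrict measurableSet_Ioi]
  have h2 : Ioi x ∩ Ioc (τ j) (τ (j + 1)) = Ioc x (τ (j + 1)) := by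
    ext t
    simp only [mem_inter_iff, mem_Ioi, mem_Ioc]
    exact ⟨fun h => ⟨h.1, h.2.2⟩, fun h => ⟨h.1, hx.1.trans_lt h.1, h.2⟩⟩
  rw [h2, ← intervalIntegral.integral_of_le hx.2.le,
    intervalIntegral.integral_eq_sub_of_hasDerivAt (fun t _ => R.hasDerivAt t)
      (R.derivative.continuous.intervalIntegrable _ _)]
  simp

/-- The transpose of the projection error is orthogonal to piecewise polynomials. -/
theorem cellOrth_sub_proj (G : IsGrid τ M h) {k : ℕ} {φ : ℝ → ℝ} (hφ : BddMeas φ)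
    (hP : BddMeas (kact (projKer k τ M) φ)) :
    CellOrth τ M (k + 1) fun t => φ t - kact (projKer k τ M) φ t := by
  intro j hj p hp
  simp only [sub_mul]
  rw [intervalIntegral.integral_sub (intervalIntegrable_mul_continuous hφ p.continuous _ _)
    (intervalIntegrable_mul_continuous hP p.continuous _ _),
    integral_projKer_mul G hφ hj (Nat.le_of_lt_succ hp), sub_self]

/-- Cellwise integration of a function loses one order of orthogonality. -/
theorem CellOrth.anti (G : IsGrid τ M h) {r : ℕ} {ψ : ℝ → ℝ} (hψ : BddMeas ψ)
    (ho : CellOrth τ M (r + 1) ψ) : CellOrth τ M r (kact (antiKer τ M) ψ) := by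
  intro j hj p hp
  obtain ⟨R, rfl, hR⟩ := exists_antiderivative p
  rw [integral_antiKer_mul G hψ hj]
  refine ho j hj _ (lt_of_le_of_lt (Polynomial.natDegree_sub_le _ _) ?_)
  rw [Polynomial.natDegree_C, max_lt_iff]
  omega

theorem CellOrth.mono {r s : ℕ} {ψ : ℝ → ℝ} (ho : CellOrth τ M s ψ) (hrs : r ≤ s) :
    CellOrth τ M r ψ := fun j hj p hp => ho j hj p (hp.trans_le hrs)

theorem cellOrth_deriv (G : IsGrid τ M h) {k : ℕ} {φ : ℝ → ℝ} (hφ : BddMeas φ) :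
    CellOrth τ M 1 (kact (derivKer k τ M) φ) := by
  intro j hj p hp
  rw [Nat.lt_one_iff] at hp
  rw [integral_derivKer_mul G hφ hj (by omega), Polynomial.eq_C_of_natDegree_eq_zero hp]
  simp

/-- The derivative of the projection reproduces the derivatives of polynomials. -/
theorem cellOrth_add_anti_deriv (G : IsGrid τ M h) {k : ℕ} {φ : ℝ → ℝ} (hφ : BddMeas φ)
    (hD : BddMeas (kact (derivKer k τ M) φ)) :
    CellOrth τ M k fun t => φ t + kact (antiKer τ M) (kact (derivKer k τ M) φ) t := by
  intro j hj p hp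
  have hJ := (schurKernel_antiKer G).bddMeas_kact hD
  simp only [add_mul]
  rw [intervalIntegral.integral_add (intervalIntegrable_mul_continuous hφ p.continuous _ _)
    (intervalIntegrable_mul_continuous hJ p.continuous _ _)]
  obtain ⟨R, rfl, hR⟩ := exists_antiderivative p
  rw [integral_antiKer_mul G hD hj, integral_derivKer_mul G hφ hj]
  · simp
  · refine (Polynomial.natDegree_sub_le _ _).trans ?_
    rw [Polynomial.natDegree_C, max_le_iff]
    omega

theorem CellOrth.integral_eq_zero {ψ : ℝ → ℝ} (ho : CellOrth τ M 1 ψ) {j : ℕ} (hj : j < M) :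
    ∫ x in τ j..τ (j + 1), ψ x = 0 := by
  simpa using ho j hj 1 (by simp)

theorem CellOrth.integral_zero_grid (G : IsGrid τ M h) {ψ : ℝ → ℝ} (hψ : BddMeas ψ)
    (ho : CellOrth τ M 1 ψ) {j : ℕ} (hj : j ≤ M) : ∫ x in (0 : ℝ)..τ j, ψ x = 0 := by
  have hint : ∀ a b, IntervalIntegrable ψ volume a b := fun a b => by
    simpa using intervalIntegrable_mul_continuous hψ (continuous_const (y := (1 : ℝ))) a b
  induction j with
  | zero => simp [G.zero]
  | succ j ih =>
    rw [← intervalIntegral.integral_add_adjacent_intervals (hint 0 (τ j)) (hint _ _),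
      ih (by omega), ho.integral_eq_zero hj, add_zero]

/-- For functions of cellwise mean zero the integral from `0` is the cellwise integral. -/
theorem CellOrth.integral_eq_anti (G : IsGrid τ M h) {ψ : ℝ → ℝ} (hψ : BddMeas ψ)
    (ho : CellOrth τ M 1 ψ) {t : ℝ} (ht : t ∈ Ico (0 : ℝ) 1) :
    ∫ x in (0 : ℝ)..t, ψ x = kact (antiKer τ M) ψ t := by
  have hint : ∀ a b, IntervalIntegrable ψ volume a b := fun a b => by
    simpa using intervalIntegrable_mul_continuous hψ (continuous_const (y := (1 : ℝ))) a b
  obtain ⟨j, hj, htj⟩ := G.exists_cell ht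
  rw [← intervalIntegral.integral_add_adjacent_intervals (hint 0 (τ j)) (hint _ _),
    ho.integral_zero_grid G hψ hj.le,
    zero_add, antiKer, kact_cellKer G _ ψ hj htj]
  have h1 : ∀ x, (open Classical in if x < t then (1 : ℝ) else 0) * ψ x =
      (Iio t).indicator ψ x := fun x => by
    by_cases hx : x < t <;> simp [hx]
  simp only [h1]
  rw [intervalIntegral.integral_of_le htj.1, intervalIntegral.integral_of_le (G.lt j hj).le,
    ← restrict_Ico_eq_restrict_Ioc, ← restrict_Ico_eq_restrict_Ioc,
    integral_indicator measurableSet_Iio, Measure.restrict_restrict measurableSet_Iio]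
  congr 2
  ext x
  simp only [mem_inter_iff, mem_Iio, mem_Ico]
  exact ⟨fun h => ⟨h.2, h.1, h.2.trans htj.2⟩, fun h => ⟨h.2.1, h.1⟩⟩

theorem CellOrth.integral_zero_one (G : IsGrid τ M h) {ψ : ℝ → ℝ} (hψ : BddMeas ψ)
    (ho : CellOrth τ M 1 ψ) : ∫ x in (0 : ℝ)..1, ψ x = 0 := by
  rw [← G.last]; exact ho.integral_zero_grid G hψ le_rfl

theorem kact_antiKerScaled_derivKerScaled (G : IsGrid τ M h) (k : ℕ) (φ : ℝ → ℝ) {t : ℝ}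
    (ht : t ∈ Ico (0 : ℝ) 1) :
    kact (antiKerScaled τ M) (kact (derivKerScaled k τ M) φ) t =
      kact (antiKer τ M) (kact (derivKer k τ M) φ) t := by
  obtain ⟨j, hj, htj⟩ := G.exists_cell ht
  rw [antiKerScaled, antiKer, kact_cellKer G _ _ hj htj, kact_cellKer G _ _ hj htj]
  apply integral_congr_Ico (G.lt j hj).le
  intro x hx
  have hpos := sub_pos.2 (G.lt j hj)
  rw [derivKerScaled, derivKer, kact_cellKer G _ _ hj hx, kact_cellKer G _ _ hj hx]
  simp only [mul_assoc]
  rw [intervalIntegral.integral_const_mul]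
  field_simp

end Grids

section OneCoordinate

variable {d : ℕ} {τ : ℕ → ℝ} {M : ℕ} {h : ℝ}

/-! ### Weak derivatives in one coordinate -/

open Classical in
/-- The operator on `L²((0,1)^d)` that acts in the coordinate `i` as the integral operator with
kernel `K` (zero unless `K` is a Schur kernel). -/
def kernelOp (i : Fin d) (K : ℝ → ℝ → ℝ) : L2Cube d →L[ℝ] L2Cube d :=
  if hK : ∃ S, SchurKernel K S then (exists_kernelOp i hK.choose_spec).choose else 0

theorem acts_kernelOp (i : Fin d) {K : ℝ → ℝ → ℝ} {S : ℝ} (hK : SchurKernel K S) :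
    Acts i (kernelOp i K) (kact K) := by
  have h : ∃ S, SchurKernel K S := ⟨S, hK⟩
  rw [kernelOp, dif_pos h]
  exact (exists_kernelOp i h.choose_spec).choose_spec.2

theorem norm_kernelOp_le (i : Fin d) {K : ℝ → ℝ → ℝ} {S : ℝ} (hK : SchurKernel K S) :
    ‖kernelOp i K‖ ≤ S := by
  obtain ⟨A, hA, hA'⟩ := exists_kernelOp i hK
  rwa [(acts_kernelOp i hK).ext hA' fun _ _ _ _ => rfl]

theorem Acts.add {i : Fin d} {A B : L2Cube d →L[ℝ] L2Cube d} {a b : (ℝ → ℝ) → ℝ → ℝ}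
    (hA : Acts i A a) (hB : Acts i B b) : Acts i (A + B) fun φ t => a φ t + b φ t :=
  ⟨fun φ h => (hA.bdd φ h).add (hB.bdd φ h), fun f φ hφ => by
    have h1 := pr_update_sub f hφ i ((hA.bdd _ (hφ i)).add (hB.bdd _ (hφ i))) (hB.bdd _ (hφ i))
    simp only [add_sub_cancel_right] at h1
    rw [add_apply, pr_add, hA.pr_eq f φ hφ, hB.pr_eq f φ hφ]
    linarith⟩

/-- `w₁` is the weak derivative of `w` in the coordinate `m`, tested by tensor products. -/
def WeakPair (m : Fin d) (w w₁ : L2Cube d) : Prop :=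
  ∀ φ : Fin d → ℝ → ℝ, (∀ j, IsTest 0 1 (φ j)) →
    pr w (Function.update φ m (deriv (φ m))) = -pr w₁ φ

/-- The grid whose only cell is the unit interval. -/
theorem isGrid_unit : IsGrid (fun j => (j : ℝ)) 1 1 :=
  ⟨by simp, by simp, fun j _ => by push_cast; linarith, fun j _ => by push_cast; linarith⟩

theorem cellOrth_unit {ψ : ℝ → ℝ} (h : ∫ x in (0 : ℝ)..1, ψ x = 0) :
    CellOrth (fun j => (j : ℝ)) 1 1 ψ := by
  intro j hj p hp
  obtain rfl : j = 0 := by omega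
  rw [Nat.lt_one_iff] at hp
  rw [Polynomial.eq_C_of_natDegree_eq_zero hp]
  simp [h]

theorem IsTest.eq_zero {a b : ℝ} {φ : ℝ → ℝ} (hφ : IsTest a b φ) {t : ℝ} (ht : t ∉ Ioo a b) :
    φ t = 0 := image_eq_zero_of_notMem_tsupport fun hc => ht (hφ.supp hc)

theorem isTest_of_support {a b a' b' : ℝ} {φ : ℝ → ℝ} (hs : ContDiff ℝ ∞ φ) (ha : a < a')
    (hb : b' < b) (h : ∀ t ∉ Icc a' b', φ t = 0) : IsTest a b φ := by
  have hsub : tsupport φ ⊆ Icc a' b' :=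
    closure_minimal (fun t ht => by_contra fun hc => ht (h t hc)) isClosed_Icc
  exact ⟨hs, HasCompactSupport.of_support_subset_isCompact isCompact_Icc
      (subset_closure.trans hsub), hsub.trans (Icc_subset_Ioo ha hb)⟩

theorem IsTest.exists_Icc {a b : ℝ} (hab : a < b) {φ : ℝ → ℝ} (hφ : IsTest a b φ) :
    ∃ a' b', a < a' ∧ b' < b ∧ a' ≤ b' ∧ ∀ t ∉ Icc a' b', φ t = 0 := by
  rcases (tsupport φ).eq_empty_or_nonempty with h0 | hne
  · refine ⟨(a + b) / 2, (a + b) / 2, by linarith, by linarith, le_rfl, fun t _ => ?_⟩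
    exact image_eq_zero_of_notMem_tsupport (by simp [h0])
  · have hc : IsCompact (tsupport φ) := hφ.compact
    refine ⟨sInf (tsupport φ), sSup (tsupport φ), (hφ.supp (hc.sInf_mem hne)).1,
      (hφ.supp (hc.sSup_mem hne)).2, ?_, fun t ht => ?_⟩
    · exact csInf_le hc.bddBelow (hc.sSup_mem hne)
    · exact image_eq_zero_of_notMem_tsupport fun hct =>
        ht ⟨csInf_le hc.bddBelow hct, le_csSup hc.bddAbove hct⟩

/-- A test function of mean zero is the derivative of a test function. -/
theorem IsTest.antideriv {χ : ℝ → ℝ} (hχ : IsTest 0 1 χ) (h0 : ∫ x in (0 : ℝ)..1, χ x = 0) :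
    IsTest 0 1 (fun t => ∫ x in (0 : ℝ)..t, χ x) ∧
      deriv (fun t => ∫ x in (0 : ℝ)..t, χ x) = χ := by
  have hd : ∀ t, HasDerivAt (fun t => ∫ x in (0 : ℝ)..t, χ x) (χ t) t := fun t =>
    intervalIntegral.integral_hasDerivAt_right (hχ.smooth.continuous.intervalIntegrable _ _)
      (hχ.smooth.continuous.stronglyMeasurableAtFilter _ _) hχ.smooth.continuous.continuousAt
  have hder : deriv (fun t => ∫ x in (0 : ℝ)..t, χ x) = χ := funext fun t => (hd t).deriv
  refine ⟨?_, hder⟩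
  obtain ⟨a, b, ha, hb, hab, hz⟩ := hχ.exists_Icc zero_lt_one
  refine isTest_of_support ?_ ha hb fun t ht => ?_
  · rw [contDiff_infty_iff_deriv, hder]
    exact ⟨fun t => (hd t).differentiableAt, hχ.smooth⟩
  · have hii : ∀ a b, IntervalIntegrable χ volume a b :=
      fun a b => hχ.smooth.continuous.intervalIntegrable a b
    rcases lt_or_ge t a with hta | hta
    · apply intervalIntegral.integral_zero_ae
      refine ae_of_all _ fun x hx => hz x fun hc => ?_
      rcases mem_uIoc.1 hx with h | h
      · exact absurd (h.2.trans_lt hta) (not_lt.2 hc.1)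
      · exact absurd (h.2.trans_lt ha) (not_lt.2 hc.1)
    · have htb : b < t := by
        by_contra hc
        exact ht ⟨hta, not_lt.1 hc⟩
      have h1 : ∫ x in t..1, χ x = 0 := by
        apply intervalIntegral.integral_zero_ae
        refine ae_of_all _ fun x hx => hz x fun hc => ?_
        rcases mem_uIoc.1 hx with h | h
        · exact absurd (htb.trans h.1) (not_lt.2 hc.2)
        · exact absurd (hb.trans h.1) (not_lt.2 hc.2)
      have h2 := intervalIntegral.integral_add_adjacent_intervals (hii 0 t) (hii t 1)
      rw [h1, add_zero] at h2
      rw [h2, h0]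

theorem exists_isTest_integral_one : ∃ ρ, IsTest 0 1 ρ ∧ ∫ x in (0 : ℝ)..1, ρ x = 1 := by
  let β : ContDiffBump (1 / 2 : ℝ) := ⟨1 / 8, 1 / 4, by norm_num, by norm_num⟩
  have hs : ∀ t ∉ Icc (1 / 4 : ℝ) (3 / 4), β.normed volume t = 0 := fun t ht => by
    rw [← Function.notMem_support, β.support_normed_eq, Metric.mem_ball, Real.dist_eq]
    intro hc
    rw [abs_lt] at hc
    change -(1 / 4 : ℝ) < _ ∧ _ < (1 / 4 : ℝ) at hc
    exact ht ⟨by linarith [hc.1], by linarith [hc.2]⟩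
  refine ⟨β.normed volume, isTest_of_support β.contDiff_normed (a' := 1 / 4) (b' := 3 / 4)
    (by norm_num) (by norm_num) hs, ?_⟩
  rw [intervalIntegral.integral_eq_integral_of_support_subset, β.integral_normed]
  intro t ht
  by_contra hc
  exact ht (hs t fun h => hc ⟨by linarith [h.1], by linarith [h.2]⟩)

theorem integral_lam (f : ℝ → ℝ) : ∫ x, f x ∂lam = ∫ x in (0 : ℝ)..1, f x := by
  rw [lam, intervalIntegral.integral_of_le zero_le_one, Measure.restrict_congr_set Ioo_ae_eq_Ioc]

/-- Integration by parts for the weak derivative against a bounded function of mean zero. The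
difference of the two sides is an identity between operators, and these are determined by smooth
test functions. -/
theorem WeakPair.pr_unit {m : Fin d} {w w₁ : L2Cube d} (hw : WeakPair m w w₁)
    {φ : Fin d → ℝ → ℝ} (hφ : ∀ j, BddMeas (φ j)) {ψ : ℝ → ℝ} (hψ : BddMeas ψ)
    (h0 : ∫ x in (0 : ℝ)..1, ψ x = 0) :
    pr w (Function.update φ m ψ) =
      -pr w₁ (Function.update φ m (kact (antiKer (fun j => (j : ℝ)) 1) ψ)) := by
  -- subtracting a multiple of `ρ` gives a test function mean zero, hence a primitive
  obtain ⟨ρ, hρ, hρ1⟩ := exists_isTest_integral_one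
  obtain ⟨C, hC⟩ := hρ.bddMeas.bound
  have hR : SchurKernel (fun _ t => ρ t) C := by
    refine ⟨hρ.bddMeas.measurable.comp measurable_snd, ⟨C, fun _ t => hC t⟩, fun _ => ?_,
      fun t => ?_⟩
    · have := integral_mono hρ.bddMeas.integrable.norm (integrable_const C) (μ := lam) hC
      simpa using this
    · simpa using hC t
  have hRact : ∀ φ t, kact (fun _ t => ρ t) φ t = ρ t * ∫ x in (0 : ℝ)..1, φ x := fun φ t => by
    rw [kact, integral_const_mul, integral_lam]
  have hJ := acts_kernelOp m (schurKernel_antiKer isGrid_unit)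
  have hZ := (Acts.one m).sub (acts_kernelOp m hR)
  have hZJ := hZ.mul hJ
  set J := kernelOp m (antiKer (fun j => (j : ℝ)) 1)
  set Z := 1 - kernelOp m fun _ t => ρ t
  have key : Z w = -((Z * J) w₁) := by
    refine ext_pr_test fun φ hφ => ?_
    have hφb := fun j => (hφ j).bddMeas
    let χ : ℝ → ℝ := fun t => φ m t - kact (fun _ t => ρ t) (φ m) t
    have hχ : χ = fun t => φ m t - ρ t * ∫ x in (0 : ℝ)..1, φ m x := by
      funext t; simp only [χ, hRact]
    have hχb : BddMeas χ := hZ.bdd _ (hφb m)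
    have hχ0 : ∫ x in (0 : ℝ)..1, χ x = 0 := by
      have hi : IntervalIntegrable (fun t => ρ t * ∫ x in (0 : ℝ)..1, φ m x) volume 0 1 :=
        (hρ.smooth.continuous.mul continuous_const).intervalIntegrable _ _
      rw [hχ, intervalIntegral.integral_sub ((hφ m).smooth.continuous.intervalIntegrable _ _) hi,
        intervalIntegral.integral_mul_const, hρ1]
      ring
    have hχt : IsTest 0 1 χ := by
      obtain ⟨a, b, ha, hb, hab, hz⟩ := (hφ m).exists_Icc zero_lt_one
      obtain ⟨a', b', ha', hb', hab', hz'⟩ := hρ.exists_Icc zero_lt_one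
      refine isTest_of_support ?_ (lt_min ha ha') (max_lt hb hb') fun t ht => ?_
      · rw [hχ]; exact (hφ m).smooth.sub (hρ.smooth.mul contDiff_const)
      · rw [hχ]
        dsimp only
        rw [hz t fun hc => ht ⟨(min_le_left _ _).trans hc.1, hc.2.trans (le_max_left _ _)⟩,
          hz' t fun hc => ht ⟨(min_le_right _ _).trans hc.1, hc.2.trans (le_max_right _ _)⟩]
        ring
    obtain ⟨hΨ, hΨd⟩ := hχt.antideriv hχ0
    have h1 := hw (Function.update φ m fun t => ∫ x in (0 : ℝ)..t, χ x) (fun j => by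
      by_cases hj : j = m
      · subst hj; simpa using hΨ
      · simpa [hj] using hφ j)
    rw [Function.update_idem, Function.update_self, hΨd] at h1
    rw [hZ.pr_eq w φ hφb, pr_neg, hZJ.pr_eq w₁ φ hφb]
    change pr w (Function.update φ m χ) =
      -pr w₁ (Function.update φ m (kact (antiKer (fun j => (j : ℝ)) 1) χ))
    rw [h1, pr_update_congr w₁ hφb m hΨ.bddMeas (hJ.bdd _ hχb)]
    intro t ht
    exact (cellOrth_unit hχ0).integral_eq_anti isGrid_unit hχb ⟨ht.1.le, ht.2⟩
  have h2 := congrArg (fun f => pr f (Function.update φ m ψ)) key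
  have hb := BddMeas.forall_update hφ m hψ
  have h3 : (fun t => ψ t - kact (fun _ t => ρ t) ψ t) = ψ := by
    funext t; rw [hRact, h0]; ring
  simp only [pr_neg] at h2
  rw [hZ.pr_eq _ _ hb, hZJ.pr_eq _ _ hb] at h2
  simpa only [Function.update_self, Function.update_idem, h3] using h2

/-- Integration by parts against a function of mean zero on each cell of a grid. -/
theorem WeakPair.pr_cell (G : IsGrid τ M h) {m : Fin d} {w w₁ : L2Cube d} (hw : WeakPair m w w₁)
    {φ : Fin d → ℝ → ℝ} (hφ : ∀ j, BddMeas (φ j)) {ψ : ℝ → ℝ} (hψ : BddMeas ψ)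
    (ho : CellOrth τ M 1 ψ) :
    pr w (Function.update φ m ψ) = -pr w₁ (Function.update φ m (kact (antiKer τ M) ψ)) := by
  have h0 := ho.integral_zero_one G hψ
  rw [hw.pr_unit hφ hψ h0, pr_update_congr w₁ hφ m
    ((schurKernel_antiKer isGrid_unit).bddMeas_kact hψ) ((schurKernel_antiKer G).bddMeas_kact hψ)]
  intro t ht
  have ht' : t ∈ Ico (0 : ℝ) 1 := ⟨ht.1.le, ht.2⟩
  rw [← ho.integral_eq_anti G hψ ht',
    ← (cellOrth_unit h0).integral_eq_anti isGrid_unit hψ ht']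

/-- Repeated integration by parts, cell by cell: no boundary terms appear as long as the
antiderivatives keep mean zero on each cell. -/
theorem pr_chain (G : IsGrid τ M h) (m : Fin d) (r : ℕ) (w : ℕ → L2Cube d)
    (hw : ∀ j < r, WeakPair m (w j) (w (j + 1))) {φ : Fin d → ℝ → ℝ} (hφ : ∀ j, BddMeas (φ j))
    {ψ : ℝ → ℝ} (hψ : BddMeas ψ) (ho : CellOrth τ M r ψ) :
    pr (w 0) (Function.update φ m ψ) =
      (-1) ^ r * pr (w r) (Function.update φ m ((kact (antiKer τ M))^[r] ψ)) := by
  induction r generalizing w ψ with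
  | zero => simp
  | succ r ih =>
    rw [(hw 0 r.succ_pos).pr_cell G hφ hψ (ho.mono (by omega)),
      ih (fun j => w (j + 1)) (fun j hj => hw (j + 1) (by omega))
        ((schurKernel_antiKer G).bddMeas_kact hψ) (ho.anti G hψ), Function.iterate_succ_apply]
    ring

/-- An operator whose transpose produces functions orthogonal to the polynomials of degree less
than `r` on each cell factors through the `r`-th weak derivative. -/
theorem apply_chain (G : IsGrid τ M h) {m : Fin d} {r : ℕ} {w : ℕ → L2Cube d}
    (hw : ∀ j < r, WeakPair m (w j) (w (j + 1))) {A : L2Cube d →L[ℝ] L2Cube d}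
    {a : (ℝ → ℝ) → ℝ → ℝ} (hA : Acts m A a) (ho : ∀ φ, BddMeas φ → CellOrth τ M r (a φ)) :
    A (w 0) = ((-1 : ℝ) ^ r • (A * kernelOp m (antiKer τ M) ^ r)) (w r) := by
  refine ext_pr fun φ hφ => ?_
  have hJ := (acts_kernelOp m (schurKernel_antiKer G)).pow r
  rw [hA.pr_eq _ φ hφ, pr_chain G m r w hw hφ (hA.bdd _ (hφ m)) (ho _ (hφ m)),
    smul_apply, pr_smul, (hA.mul hJ).pr_eq _ φ hφ]

theorem norm_one_op_le (d : ℕ) : ‖(1 : L2Cube d →L[ℝ] L2Cube d)‖ ≤ 1 :=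
  ContinuousLinearMap.norm_id_le

theorem norm_pow_op_le (A : L2Cube d →L[ℝ] L2Cube d) (r : ℕ) : ‖A ^ r‖ ≤ ‖A‖ ^ r := by
  rcases Nat.eq_zero_or_pos r with rfl | hr
  · simpa using norm_one_op_le d
  · exact norm_pow_le' A hr

theorem norm_mul_pow_antiKer_le (G : IsGrid τ M h) (m : Fin d) (r : ℕ)
    (A : L2Cube d →L[ℝ] L2Cube d) :
    ‖(-1 : ℝ) ^ r • (A * kernelOp m (antiKer τ M) ^ r)‖ ≤ ‖A‖ * h ^ r := by
  rw [norm_smul, norm_pow, norm_neg, norm_one, one_pow, one_mul]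
  refine (norm_mul_le _ _).trans (mul_le_mul_of_nonneg_left ?_ (norm_nonneg _))
  exact (norm_pow_op_le _ _).trans
    (pow_le_pow_left₀ (norm_nonneg _) (norm_kernelOp_le m (schurKernel_antiKer G)) r)

/-! ### Approximation in one coordinate -/

/-- A bound, uniform over all grids, for the operators of the one-dimensional theory. -/
def schurConst (k : ℕ) : ℝ := Classical.choose (exists_schur_bound k)

theorem schurConst_nonneg (k : ℕ) : 0 ≤ schurConst k :=
  (Classical.choose_spec (exists_schur_bound k)).1

theorem schurKernel_projKer (k : ℕ) (G : IsGrid τ M h) :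
    SchurKernel (projKer k τ M) (schurConst k) :=
  ((Classical.choose_spec (exists_schur_bound k)).2 τ M h G).1

theorem schurKernel_derivKerScaled (k : ℕ) (G : IsGrid τ M h) :
    SchurKernel (derivKerScaled k τ M) (schurConst k) :=
  ((Classical.choose_spec (exists_schur_bound k)).2 τ M h G).2

theorem norm_one_sub_proj_le (k : ℕ) (G : IsGrid τ M h) (m : Fin d) :
    ‖1 - kernelOp m (projKer k τ M)‖ ≤ 1 + schurConst k :=
  (norm_sub_le _ _).trans
    (add_le_add (norm_one_op_le d) (norm_kernelOp_le m (schurKernel_projKer k G)))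

/-- The operator that produces the projection error from the `r`-th derivative. -/
def errOp (k r : ℕ) (τ : ℕ → ℝ) (M : ℕ) (m : Fin d) : L2Cube d →L[ℝ] L2Cube d :=
  (-1 : ℝ) ^ r • ((1 - kernelOp m (projKer k τ M)) * kernelOp m (antiKer τ M) ^ r)

theorem norm_errOp_le (k r : ℕ) (G : IsGrid τ M h) (m : Fin d) :
    ‖errOp k r τ M m‖ ≤ (1 + schurConst k) * h ^ r :=
  (norm_mul_pow_antiKer_le G m r _).trans
    (mul_le_mul_of_nonneg_right (norm_one_sub_proj_le k G m) (pow_nonneg G.mesh_pos.le r))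

/-- The projection error is a bounded operator, of norm of order `h ^ r`, applied to the `r`-th weak
derivative. -/
theorem one_sub_proj_apply {k r : ℕ} (hr : r ≤ k + 1) (G : IsGrid τ M h) {m : Fin d}
    {w : ℕ → L2Cube d} (hw : ∀ j < r, WeakPair m (w j) (w (j + 1))) :
    (1 - kernelOp m (projKer k τ M)) (w 0) = errOp k r τ M m (w r) := by
  have hP := acts_kernelOp m (schurKernel_projKer k G)
  exact apply_chain G hw ((Acts.one m).sub hP) fun φ hφ =>
    (cellOrth_sub_proj G hφ (hP.bdd _ hφ)).mono hr

/-- The derivative is approximated by the cellwise derivative `P'` of the projection. With `J` the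
cellwise integration, `w 1 - P' (w 0) = (1 + P' J) (w 1)`, and the transpose of `1 + P' J` produces
functions orthogonal to the polynomials of degree less than `k`. -/
theorem norm_sub_deriv_proj_le {k q : ℕ} (hq : q ≤ k) (G : IsGrid τ M h) {m : Fin d}
    {w : ℕ → L2Cube d} (hw : ∀ j < q + 1, WeakPair m (w j) (w (j + 1))) :
    ‖w 1 - kernelOp m (derivKer k τ M) (w 0)‖ ≤ (1 + schurConst k) * h ^ q * ‖w (q + 1)‖ := by
  obtain ⟨S, hS⟩ := exists_schurKernel_derivKer k G
  have hD := acts_kernelOp m hS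
  have hJ := acts_kernelOp m (schurKernel_antiKer G)
  have hDJ := hD.mul hJ
  have hA := (Acts.one m).add hDJ
  have h1 := apply_chain (r := 1) G (fun j hj => hw j (by omega)) hD fun φ hφ => cellOrth_deriv G hφ
  have h2 := apply_chain (r := q) (w := fun j => w (j + 1)) G (fun j hj => hw (j + 1) (by omega)) hA
    fun φ hφ => (cellOrth_add_anti_deriv G hφ (hD.bdd _ hφ)).mono hq
  have h3 : w 1 - kernelOp m (derivKer k τ M) (w 0) =
      (1 + kernelOp m (derivKer k τ M) * kernelOp m (antiKer τ M)) (w 1) := by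
    rw [h1]
    simp [sub_neg_eq_add]
  have h4 : kernelOp m (derivKer k τ M) * kernelOp m (antiKer τ M) =
      kernelOp m (derivKerScaled k τ M) * kernelOp m (antiKerScaled τ M) := by
    refine hDJ.ext ((acts_kernelOp m (schurKernel_derivKerScaled k G)).mul
      (acts_kernelOp m (schurKernel_antiKerScaled G))) fun φ _ t ht => ?_
    exact (kact_antiKerScaled_derivKerScaled G k φ ⟨ht.1.le, ht.2⟩).symm
  have h5 : ‖1 + kernelOp m (derivKer k τ M) * kernelOp m (antiKer τ M)‖ ≤ 1 + schurConst k := by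
    rw [h4]
    refine (norm_add_le _ _).trans (add_le_add (norm_one_op_le d) ((norm_mul_le _ _).trans ?_))
    calc _ ≤ schurConst k * 1 := mul_le_mul
          (norm_kernelOp_le m (schurKernel_derivKerScaled k G))
          (norm_kernelOp_le m (schurKernel_antiKerScaled G)) (norm_nonneg _) (schurConst_nonneg k)
      _ = _ := mul_one _
  rw [h3, h2]
  refine (ContinuousLinearMap.le_opNorm _ _).trans (mul_le_mul_of_nonneg_right ?_ (norm_nonneg _))
  exact (norm_mul_pow_antiKer_le G m q _).trans
    (mul_le_mul_of_nonneg_right h5 (pow_nonneg G.mesh_pos.le q))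

/-- Interpolation: a first derivative is controlled by the function and a higher derivative. This is
the estimate of `norm_sub_deriv_proj_le` on the grid with one cell. -/
theorem exists_interpolation_const (d k : ℕ) : ∃ c : ℝ, 0 ≤ c ∧ ∀ (q : ℕ) (m : Fin d)
    (w : ℕ → L2Cube d), q ≤ k → (∀ j < q + 1, WeakPair m (w j) (w (j + 1))) →
      ‖w 1‖ ≤ c * (‖w 0‖ + ‖w (q + 1)‖) := by
  obtain ⟨S, hS⟩ := exists_schurKernel_derivKer k isGrid_unit
  have hS0 := hS.nonneg
  have hC := schurConst_nonneg k
  refine ⟨(1 + schurConst k) + S, by positivity, fun q m w hq hw => ?_⟩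
  have h1 := norm_sub_deriv_proj_le hq isGrid_unit hw
  have h2 : ‖kernelOp m (derivKer k (fun j => (j : ℝ)) 1) (w 0)‖ ≤ S * ‖w 0‖ :=
    (ContinuousLinearMap.le_opNorm _ _).trans
      (mul_le_mul_of_nonneg_right (norm_kernelOp_le m hS) (norm_nonneg _))
  rw [one_pow, mul_one] at h1
  have h4 : ‖w 1‖ ≤ ‖w 1 - kernelOp m (derivKer k (fun j => (j : ℝ)) 1) (w 0)‖ +
      ‖kernelOp m (derivKer k (fun j => (j : ℝ)) 1) (w 0)‖ := by
    simpa using norm_add_le (w 1 - kernelOp m (derivKer k (fun j => (j : ℝ)) 1) (w 0))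
      (kernelOp m (derivKer k (fun j => (j : ℝ)) 1) (w 0))
  nlinarith [norm_nonneg (w 0), norm_nonneg (w (q + 1)), mul_nonneg hS0 (norm_nonneg (w (q + 1))),
    mul_nonneg hC (norm_nonneg (w 0))]

end OneCoordinate

section Sparse

/-! ### The dual grids -/

theorem meshSize_pos (n : ℕ) : 0 < meshSize n := by unfold meshSize; positivity

theorem meshSize_succ (n : ℕ) : meshSize n = 2 * meshSize (n + 1) := by
  unfold meshSize; rw [pow_succ]; field_simp

theorem meshSize_anti {m n : ℕ} (h : m ≤ n) : meshSize n ≤ meshSize m :=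
  one_div_le_one_div_of_le (by positivity) (pow_le_pow_right₀ one_le_two h)

theorem meshSize_mul (m n : ℕ) : meshSize m * meshSize n = meshSize (m + n) := by
  unfold meshSize; rw [pow_add]; field_simp

theorem pow_mul_meshSize (n : ℕ) : (2 : ℝ) ^ n * meshSize n = 1 := by
  unfold meshSize; field_simp

theorem dualGrid_zero (l N : ℕ) : dualGrid l N 0 = 0 := by simp [dualGrid]

theorem dualGrid_of_le {l N j : ℕ} (h0 : j ≠ 0) (hj : j ≤ 2 ^ l) :
    dualGrid l N j = j * meshSize l - meshSize N / 2 := by simp [dualGrid, h0, hj]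

theorem dualGrid_pow (l N : ℕ) : dualGrid l N (2 ^ l) = 1 - meshSize N / 2 := by
  rw [dualGrid_of_le (by positivity) le_rfl]
  push_cast
  rw [pow_mul_meshSize]

theorem dualGrid_last (l N : ℕ) : dualGrid l N (2 ^ l + 1) = 1 := by simp [dualGrid]

theorem isGrid_dual {n N : ℕ} (h : n ≤ N) : IsGrid (dualGrid n N) (2 ^ n + 1) (meshSize n) := by
  have hN := meshSize_pos N
  have hn := meshSize_anti h
  have key : ∀ j < 2 ^ n + 1, dualGrid n N j < dualGrid n N (j + 1) ∧
      dualGrid n N (j + 1) - dualGrid n N j ≤ meshSize n := by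
    intro j hj
    rcases Nat.eq_zero_or_pos j with rfl | h0
    · rw [dualGrid_zero, dualGrid_of_le (by omega) Nat.one_le_two_pow]
      push_cast
      constructor <;> linarith
    · rcases (Nat.le_of_lt_succ hj).eq_or_lt with rfl | hlt
      · rw [dualGrid_pow, dualGrid_last]
        constructor <;> linarith
      · rw [dualGrid_of_le h0.ne' hlt.le, dualGrid_of_le (by omega) hlt]
        push_cast
        constructor <;> linarith
  exact ⟨dualGrid_zero n N, dualGrid_last n N, fun j hj => (key j hj).1, fun j hj => (key j hj).2⟩

/-- Every cell of a dual grid lies in a cell of each coarser dual grid. -/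
theorem dualGrid_nested {l n N : ℕ} (hln : l ≤ n) (hnN : n ≤ N) {j : ℕ} (hj : j < 2 ^ n + 1) :
    ∃ i < 2 ^ l + 1, dualGrid l N i ≤ dualGrid n N j ∧
      dualGrid n N (j + 1) ≤ dualGrid l N (i + 1) := by
  induction n, hln using Nat.le_induction generalizing j with
  | base => exact ⟨j, hj, le_rfl, le_rfl⟩
  | succ n hln ih =>
    have hstep : dualGrid n N (j / 2) ≤ dualGrid (n + 1) N j ∧
        dualGrid (n + 1) N (j + 1) ≤ dualGrid n N (j / 2 + 1) := by
      have h2 : 2 ^ (n + 1) = 2 * 2 ^ n := by ring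
      have hm := meshSize_succ n
      have hp := meshSize_pos (n + 1)
      rcases (Nat.le_of_lt_succ hj).eq_or_lt with rfl | hlt
      · rw [h2, Nat.mul_div_cancel_left _ two_pos, ← h2, dualGrid_pow, dualGrid_pow, dualGrid_last,
          dualGrid_last]
        exact ⟨le_rfl, le_rfl⟩
      · have hdiv : j / 2 < 2 ^ n := by omega
        constructor
        · rcases Nat.eq_zero_or_pos (j / 2) with h0 | h0
          · rw [h0, dualGrid_zero]; exact (isGrid_dual hnN).nonneg hj.le
          · rw [dualGrid_of_le h0.ne' hdiv.le, dualGrid_of_le (by omega) hlt.le, hm]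
            have : (2 * (j / 2 : ℕ) : ℝ) ≤ j := by exact_mod_cast Nat.mul_div_le j 2
            nlinarith
        · rw [dualGrid_of_le (by omega) hdiv, dualGrid_of_le (by omega) hlt, hm]
          have : ((j + 1 : ℕ) : ℝ) ≤ 2 * (j / 2 + 1 : ℕ) := by
            exact_mod_cast (by omega : j + 1 ≤ 2 * (j / 2 + 1))
          nlinarith
    obtain ⟨i, hi, h3, h4⟩ := ih (by omega) (j := j / 2) (by
      have : 2 ^ (n + 1) = 2 * 2 ^ n := by ring
      omega)
    exact ⟨i, hi, h3.trans hstep.1, hstep.2.trans h4⟩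

/-! ### The sparse projection error, one coordinate at a time -/

variable {d : ℕ}

/-- The projection in the coordinate `i` onto piecewise polynomials on the dual grid of level `n`. -/
def dualProj (k N n : ℕ) (i : Fin d) : L2Cube d →L[ℝ] L2Cube d :=
  kernelOp i (projKer k (dualGrid n N) (2 ^ n + 1))

/-- The cellwise derivative of `dualProj`. -/
def dualDeriv (k N n : ℕ) (i : Fin d) : L2Cube d →L[ℝ] L2Cube d :=
  kernelOp i (derivKer k (dualGrid n N) (2 ^ n + 1))

/-- The hierarchical increments of the projections `dualProj`. -/
def dualIncr (k N : ℕ) : ℕ → Fin d → L2Cube d →L[ℝ] L2Cube d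
  | 0, i => dualProj k N 0 i
  | n + 1, i => dualProj k N (n + 1) i - dualProj k N n i

/-- `1 - ∑ Q_{l₁} ⊗ ⋯ ⊗ Q_{l_s}`, the sum over `l₁ + ⋯ + l_s ≤ n`, for the increments `Q` of the
projections in the coordinates of a list. -/
def sparseErr (k N : ℕ) : List (Fin d) → ℕ → L2Cube d →L[ℝ] L2Cube d
  | [], _ => 0
  | i :: s, n => (1 - dualProj k N n i) +
      ∑ a ∈ Finset.range (n + 1), dualIncr k N a i * sparseErr k N s (n - a)

/-- The cellwise derivative in the coordinate `m` of `sparseErr (s ++ [m]) n v`, where `w` is the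
weak derivative of `v` in this coordinate. Only the innermost factor of the recursion, which belongs
to the last coordinate, is differentiated. -/
def sparseErrDeriv (k N : ℕ) (m : Fin d) : List (Fin d) → ℕ → L2Cube d → L2Cube d → L2Cube d
  | [], n, v, w => w - dualDeriv k N n m v
  | i :: s, n, v, w => (1 - dualProj k N n i) w +
      ∑ a ∈ Finset.range (n + 1), dualIncr k N a i (sparseErrDeriv k N m s (n - a) v w)

theorem acts_dualProj (k : ℕ) {N n : ℕ} (h : n ≤ N) (i : Fin d) :
    Acts i (dualProj k N n i) (kact (projKer k (dualGrid n N) (2 ^ n + 1))) :=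
  acts_kernelOp i (schurKernel_projKer k (isGrid_dual h))

theorem acts_dualDeriv (k : ℕ) {N n : ℕ} (h : n ≤ N) (i : Fin d) :
    Acts i (dualDeriv k N n i) (kact (derivKer k (dualGrid n N) (2 ^ n + 1))) :=
  acts_kernelOp i (exists_schurKernel_derivKer k (isGrid_dual h)).choose_spec

theorem exists_acts_dualIncr (k : ℕ) {N n : ℕ} (h : n ≤ N) (i : Fin d) :
    ∃ a, Acts i (dualIncr k N n i) a := by
  cases n with
  | zero => exact ⟨_, acts_dualProj k h i⟩
  | succ n => exact ⟨_, (acts_dualProj k h i).sub (acts_dualProj k (by omega) i)⟩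

theorem sum_dualIncr (k N n : ℕ) (i : Fin d) :
    ∑ a ∈ Finset.range (n + 1), dualIncr k N a i = dualProj k N n i := by
  induction n with
  | zero => simp [dualIncr]
  | succ n ih => rw [Finset.sum_range_succ, ih]; simp [dualIncr]

theorem sparseErr_comm {k N : ℕ} {i : Fin d} {A : L2Cube d →L[ℝ] L2Cube d}
    {a : (ℝ → ℝ) → ℝ → ℝ} (hA : Acts i A a) {s : List (Fin d)} (hs : i ∉ s) {n : ℕ} (hn : n ≤ N)
    (f : L2Cube d) : sparseErr k N s n (A f) = A (sparseErr k N s n f) := by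
  induction s generalizing n with
  | nil => simp [sparseErr]
  | cons j s ih =>
    have hij : j ≠ i := fun h => hs (h ▸ List.mem_cons_self)
    have his : i ∉ s := fun h => hs (List.mem_cons_of_mem _ h)
    simp only [sparseErr, add_apply, sum_apply, mul_apply_eq_comp, map_add, map_sum]
    congr 1
    · exact ((Acts.one j).sub (acts_dualProj k hn j)).comm hij hA f
    · refine Finset.sum_congr rfl fun b hb => ?_
      have hb' := Finset.mem_range.1 hb
      obtain ⟨c, hc⟩ := exists_acts_dualIncr k (show b ≤ N by omega) j
      rw [ih his (by omega), hc.comm hij hA]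

theorem sparseErrDeriv_comm {k N : ℕ} {m i : Fin d} (him : i ≠ m) {A : L2Cube d →L[ℝ] L2Cube d}
    {a : (ℝ → ℝ) → ℝ → ℝ} (hA : Acts i A a) {s : List (Fin d)} (hs : i ∉ s) {n : ℕ} (hn : n ≤ N)
    (v w : L2Cube d) :
    sparseErrDeriv k N m s n (A v) (A w) = A (sparseErrDeriv k N m s n v w) := by
  induction s generalizing n with
  | nil =>
    simp only [sparseErrDeriv, map_sub]
    rw [(acts_dualDeriv k hn m).comm him.symm hA]
  | cons j s ih =>
    have hij : j ≠ i := fun h => hs (h ▸ List.mem_cons_self)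
    have his : i ∉ s := fun h => hs (List.mem_cons_of_mem _ h)
    simp only [sparseErrDeriv, map_add, map_sum]
    congr 1
    · exact ((Acts.one j).sub (acts_dualProj k hn j)).comm hij hA w
    · refine Finset.sum_congr rfl fun b hb => ?_
      have hb' := Finset.mem_range.1 hb
      obtain ⟨c, hc⟩ := exists_acts_dualIncr k (show b ≤ N by omega) j
      rw [ih his (by omega), hc.comm hij hA]

/-- The projection errors of `x` in the coordinate `i` are obtained from `x'`, as they are if `x'`
is the derivative of order `r` of `x` in this coordinate. -/
def ErrFrom (k r N : ℕ) (i : Fin d) (x x' : L2Cube d) : Prop :=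
  ∀ n ≤ N, (1 - dualProj k N n i) x = errOp k r (dualGrid n N) (2 ^ n + 1) i x'

theorem acts_errOp (k r : ℕ) {τ : ℕ → ℝ} {M : ℕ} {h : ℝ} (G : IsGrid τ M h) (i : Fin d) :
    ∃ a, Acts i (errOp k r τ M i) a := by
  have h1 := ((Acts.one i).sub (acts_kernelOp i (schurKernel_projKer k G))).mul
    ((acts_kernelOp i (schurKernel_antiKer G)).pow r)
  rcases Nat.even_or_odd r with hr | hr
  · exact ⟨_, by rw [errOp, hr.neg_one_pow, one_smul]; exact h1⟩
  · have h2 := ((Acts.one i).sub (Acts.one i)).sub h1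
    rw [sub_self, zero_sub] at h2
    exact ⟨_, by rw [errOp, hr.neg_one_pow, neg_one_smul]; exact h2⟩

theorem ErrFrom.sparseErr {k r N : ℕ} {i : Fin d} {x x' : L2Cube d} (hx : ErrFrom k r N i x x')
    {s : List (Fin d)} (hs : i ∉ s) {n : ℕ} (hn : n ≤ N) :
    ErrFrom k r N i (sparseErr k N s n x) (sparseErr k N s n x') := by
  intro l hl
  obtain ⟨a, ha⟩ := acts_errOp k r (isGrid_dual hl) i
  rw [← sparseErr_comm ((Acts.one i).sub (acts_dualProj k hl i)) hs hn, hx l hl,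
    sparseErr_comm ha hs hn]

theorem ErrFrom.sparseErrDeriv {k r N : ℕ} {m i : Fin d} (him : i ≠ m) {x x' y y' : L2Cube d}
    (hx : ErrFrom k r N i x x') (hy : ErrFrom k r N i y y')
    {s : List (Fin d)} (hs : i ∉ s) {n : ℕ} (hn : n ≤ N) :
    ErrFrom k r N i (sparseErrDeriv k N m s n x y) (sparseErrDeriv k N m s n x' y') := by
  intro l hl
  obtain ⟨a, ha⟩ := acts_errOp k r (isGrid_dual hl) i
  rw [← sparseErrDeriv_comm him ((Acts.one i).sub (acts_dualProj k hl i)) hs hn, hx l hl, hy l hl,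
    sparseErrDeriv_comm him ha hs hn]

/-- The constant in the estimate of one hierarchical increment. -/
def incrConst (k r : ℕ) : ℝ := (1 + schurConst k) * (2 ^ r + 1)

theorem incrConst_ge (k r : ℕ) : 1 + schurConst k ≤ incrConst k r := by
  have h1 := schurConst_nonneg k
  have h2 : (0 : ℝ) ≤ 2 ^ r := by positivity
  unfold incrConst
  nlinarith

theorem incrConst_nonneg (k r : ℕ) : 0 ≤ incrConst k r :=
  (add_nonneg zero_le_one (schurConst_nonneg k)).trans (incrConst_ge k r)

theorem ErrFrom.norm_one_sub_le {k r N : ℕ} {i : Fin d} {x x' : L2Cube d}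
    (hx : ErrFrom k r N i x x') {n : ℕ} (hn : n ≤ N) {b : ℝ} (hb : ‖x'‖ ≤ b) :
    ‖(1 - dualProj k N n i) x‖ ≤ (1 + schurConst k) * meshSize n ^ r * b := by
  rw [hx n hn]
  refine (ContinuousLinearMap.le_opNorm _ _).trans ?_
  exact mul_le_mul (norm_errOp_le k r (isGrid_dual hn) i) hb (norm_nonneg _)
    (mul_nonneg (add_nonneg zero_le_one (schurConst_nonneg k)) (pow_nonneg (meshSize_pos n).le r))

theorem ErrFrom.norm_dualIncr_le {k r N : ℕ} {i : Fin d} {x x' : L2Cube d}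
    (hx : ErrFrom k r N i x x') {a : ℕ} (ha : a ≤ N) {b : ℝ} (hb : ‖x‖ ≤ b) (hb' : ‖x'‖ ≤ b) :
    ‖dualIncr k N a i x‖ ≤ incrConst k r * meshSize a ^ r * b := by
  have hb0 := (norm_nonneg _).trans hb
  have hC := schurConst_nonneg k
  cases a with
  | zero =>
    have h1 : ‖dualProj k N 0 i x‖ ≤ schurConst k * b :=
      (ContinuousLinearMap.le_opNorm _ _).trans
        (mul_le_mul (norm_kernelOp_le i (schurKernel_projKer k (isGrid_dual ha))) hb (norm_nonneg _)
          hC)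
    have h2 : meshSize 0 = 1 := by simp [meshSize]
    rw [h2, one_pow, mul_one]
    refine h1.trans (mul_le_mul_of_nonneg_right ?_ hb0)
    linarith [incrConst_ge k r]
  | succ a =>
    have h1 : dualIncr k N (a + 1) i x =
        (1 - dualProj k N a i) x - (1 - dualProj k N (a + 1) i) x := by
      simp [dualIncr]
    rw [h1]
    refine (norm_sub_le _ _).trans ((add_le_add (hx.norm_one_sub_le (by omega) hb')
      (hx.norm_one_sub_le ha hb')).trans (le_of_eq ?_))
    rw [meshSize_succ a, incrConst]
    ring

/-- The constant in the `L²` estimate for the sparse projection in `l` coordinates. -/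
def errConst (k r : ℕ) : ℕ → ℝ
  | 0 => 0
  | l + 1 => incrConst k r * (1 + errConst k r l)

theorem errConst_nonneg (k r l : ℕ) : 0 ≤ errConst k r l := by
  induction l with
  | zero => exact le_rfl
  | succ l ih => exact mul_nonneg (incrConst_nonneg k r) (by linarith)

/-- Each of the `n + 1` summands of `sparseErr` is of order `meshSize n ^ r`, as
`meshSize a * meshSize (n - a) = meshSize n`; hence one factor `n + 1` for each coordinate. -/
theorem norm_sparseErr_le {k r N : ℕ} {g : Finset (Fin d) → L2Cube d}
    (hg : ∀ L, ∀ i ∉ L, ErrFrom k r N i (g L) (g (insert i L))) {X : ℝ}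
    (hX : ∀ L : Finset (Fin d), L.Nonempty → ‖g L‖ ≤ X) (hX0 : 0 ≤ X)
    {s : List (Fin d)} (hs : s.Nodup) {n : ℕ} (hn : n ≤ N) (L : Finset (Fin d))
    (hL : ∀ i ∈ s, i ∉ L) :
    ‖sparseErr k N s n (g L)‖ ≤
      errConst k r s.length * ((n : ℝ) + 1) ^ s.length * meshSize n ^ r * X := by
  induction s generalizing n L with
  | nil => simp [sparseErr, errConst]
  | cons i s ih =>
    have hiL : i ∉ L := hL i List.mem_cons_self
    have his : i ∉ s := (List.nodup_cons.1 hs).1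
    have hA := incrConst_nonneg k r
    have hc := errConst_nonneg k r s.length
    have hρ : ∀ n, 0 ≤ meshSize n ^ r := fun n => pow_nonneg (meshSize_pos n).le r
    have hn1 : (1 : ℝ) ≤ (n : ℝ) + 1 := by linarith [n.cast_nonneg (α := ℝ)]
    simp only [sparseErr, add_apply, sum_apply, mul_apply_eq_comp]
    have h1 : ‖(1 - dualProj k N n i) (g L)‖ ≤ incrConst k r * meshSize n ^ r * X := by
      refine ((hg L i hiL).norm_one_sub_le hn (hX _ (Finset.insert_nonempty i L))).trans ?_
      exact mul_le_mul_of_nonneg_right (mul_le_mul_of_nonneg_right (incrConst_ge k r) (hρ n)) hX0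
    have h2 : ∀ a ∈ Finset.range (n + 1), ‖dualIncr k N a i (sparseErr k N s (n - a) (g L))‖ ≤
        incrConst k r * (errConst k r s.length * ((n : ℝ) + 1) ^ s.length * meshSize n ^ r * X) := by
      intro a ha
      have han : a ≤ n := Nat.le_of_lt_succ (Finset.mem_range.1 ha)
      have hna : ((n - a : ℕ) : ℝ) ≤ n := by exact_mod_cast Nat.sub_le n a
      have hmono : errConst k r s.length * (((n - a : ℕ) : ℝ) + 1) ^ s.length ≤
          errConst k r s.length * ((n : ℝ) + 1) ^ s.length :=
        mul_le_mul_of_nonneg_left (pow_le_pow_left₀ (by positivity) (by linarith) _) hc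
      have hb : ∀ L' : Finset (Fin d), (∀ j ∈ s, j ∉ L') → ‖sparseErr k N s (n - a) (g L')‖ ≤
          errConst k r s.length * ((n : ℝ) + 1) ^ s.length * meshSize (n - a) ^ r * X :=
        fun L' hL' => (ih (List.nodup_cons.1 hs).2 (by omega) L' hL').trans
          (mul_le_mul_of_nonneg_right (mul_le_mul_of_nonneg_right hmono (hρ _)) hX0)
      have h3 := ((hg L i hiL).sparseErr his (show n - a ≤ N by omega)).norm_dualIncr_le
        (show a ≤ N by omega) (hb L fun j hj => hL j (List.mem_cons_of_mem _ hj))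
        (hb (insert i L) fun j hj => by
          rw [Finset.mem_insert, not_or]
          exact ⟨fun h => his (h ▸ hj), hL j (List.mem_cons_of_mem _ hj)⟩)
      refine h3.trans (le_of_eq ?_)
      have h4 : meshSize a ^ r * meshSize (n - a) ^ r = meshSize n ^ r := by
        rw [← mul_pow, meshSize_mul, Nat.add_sub_cancel' han]
      rw [← h4]; ring
    refine (norm_add_le _ _).trans ((add_le_add h1 ((norm_sum_le _ _).trans
      (Finset.sum_le_sum h2))).trans ?_)
    rw [Finset.sum_const, Finset.card_range, nsmul_eq_mul, List.length_cons, errConst, pow_succ]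
    push_cast
    have h5 : (1 : ℝ) ≤ ((n : ℝ) + 1) ^ s.length * ((n : ℝ) + 1) :=
      one_le_mul_of_one_le_of_one_le (one_le_pow₀ hn1) hn1
    have h6 : 0 ≤ incrConst k r * meshSize n ^ r * X := mul_nonneg (mul_nonneg hA (hρ n)) hX0
    calc _ = incrConst k r * meshSize n ^ r * X * 1 + errConst k r s.length *
          (((n : ℝ) + 1) ^ s.length * ((n : ℝ) + 1)) * (incrConst k r * meshSize n ^ r * X) := by ring
      _ ≤ incrConst k r * meshSize n ^ r * X * (((n : ℝ) + 1) ^ s.length * ((n : ℝ) + 1)) +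
          errConst k r s.length *
          (((n : ℝ) + 1) ^ s.length * ((n : ℝ) + 1)) * (incrConst k r * meshSize n ^ r * X) := by
        gcongr
      _ = _ := by ring

theorem sum_meshSize_le (n : ℕ) : ∑ a ∈ Finset.range (n + 1), meshSize a ≤ 2 := by
  have : ∑ a ∈ Finset.range (n + 1), meshSize a = 2 - meshSize n := by
    induction n with
    | zero => norm_num [meshSize]
    | succ n ih => rw [Finset.sum_range_succ, ih, meshSize_succ n]; ring
  rw [this]; linarith [meshSize_pos n]

/-- The constant in the estimate of the derivative of the sparse projection error. -/
def errDerivConst (k r : ℕ) : ℕ → ℝ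
  | 0 => 1
  | l + 1 => incrConst k r * (1 + 2 * errDerivConst k r l)

theorem errDerivConst_nonneg (k r l : ℕ) : 0 ≤ errDerivConst k r l := by
  induction l with
  | zero => exact zero_le_one
  | succ l ih => exact mul_nonneg (incrConst_nonneg k r) (by linarith)

/-- No power of `n` appears for the derivative: the differentiated coordinate has one order less, so
the increment of level `a` in another coordinate has a surplus `meshSize a`, which is summable. -/
theorem norm_sparseErrDeriv_le {k q N : ℕ} {m : Fin d} {g w : Finset (Fin d) → L2Cube d}
    (hg : ∀ L, ∀ i ∉ L, i ≠ m → ErrFrom k (q + 1) N i (g L) (g (insert i L)))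
    (hw : ∀ L, ∀ i ∉ L, i ≠ m → ErrFrom k (q + 1) N i (w L) (w (insert i L))) {X : ℝ}
    (hX0 : 0 ≤ X) (hX : ∀ L : Finset (Fin d), L.Nonempty → m ∉ L → ‖w L‖ ≤ X)
    (hbase : ∀ L : Finset (Fin d), m ∉ L → ∀ n ≤ N,
      ‖w L - dualDeriv k N n m (g L)‖ ≤ meshSize n ^ q * X)
    {s : List (Fin d)} (hs : s.Nodup) (hms : m ∉ s) {n : ℕ} (hn : n ≤ N) (L : Finset (Fin d))
    (hmL : m ∉ L) (hL : ∀ i ∈ s, i ∉ L) :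
    ‖sparseErrDeriv k N m s n (g L) (w L)‖ ≤
      errDerivConst k (q + 1) s.length * meshSize n ^ q * X := by
  induction s generalizing n L with
  | nil => simpa [sparseErrDeriv, errDerivConst] using hbase L hmL n hn
  | cons i s ih =>
    have hiL : i ∉ L := hL i List.mem_cons_self
    have his : i ∉ s := (List.nodup_cons.1 hs).1
    have him : i ≠ m := fun h => hms (h ▸ List.mem_cons_self)
    have hms' : m ∉ s := fun h => hms (List.mem_cons_of_mem _ h)
    have hmL' : m ∉ insert i L := by
      rw [Finset.mem_insert, not_or]; exact ⟨him.symm, hmL⟩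
    have hA := incrConst_nonneg k (q + 1)
    have hc := errDerivConst_nonneg k (q + 1) s.length
    have hρ : ∀ n, 0 ≤ meshSize n ^ q := fun n => pow_nonneg (meshSize_pos n).le q
    simp only [sparseErrDeriv]
    have h1 : ‖(1 - dualProj k N n i) (w L)‖ ≤ incrConst k (q + 1) * meshSize n ^ q * X := by
      refine ((hw L i hiL him).norm_one_sub_le hn
        (hX _ (Finset.insert_nonempty i L) hmL')).trans ?_
      refine mul_le_mul_of_nonneg_right (mul_le_mul (incrConst_ge k _) ?_
        (pow_nonneg (meshSize_pos n).le _) hA) hX0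
      have h0 : meshSize n ≤ 1 := by
        have := meshSize_anti (Nat.zero_le n)
        simpa [meshSize] using this
      exact pow_le_pow_of_le_one (meshSize_pos n).le h0 q.le_succ
    have h2 : ∀ a ∈ Finset.range (n + 1),
        ‖dualIncr k N a i (sparseErrDeriv k N m s (n - a) (g L) (w L))‖ ≤
        meshSize a * (incrConst k (q + 1) * (errDerivConst k (q + 1) s.length *
          meshSize n ^ q * X)) := by
      intro a ha
      have han : a ≤ n := Nat.le_of_lt_succ (Finset.mem_range.1 ha)
      have h3 := (ErrFrom.sparseErrDeriv him (hg L i hiL him) (hw L i hiL him) his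
        (show n - a ≤ N by omega)).norm_dualIncr_le (show a ≤ N by omega)
        (ih (List.nodup_cons.1 hs).2 hms' (by omega) L hmL
          fun j hj => hL j (List.mem_cons_of_mem _ hj))
        (ih (List.nodup_cons.1 hs).2 hms' (by omega) (insert i L) hmL' fun j hj => by
          rw [Finset.mem_insert, not_or]
          exact ⟨fun h => his (h ▸ hj), hL j (List.mem_cons_of_mem _ hj)⟩)
      refine h3.trans (le_of_eq ?_)
      have h4 : meshSize a ^ q * meshSize (n - a) ^ q = meshSize n ^ q := by
        rw [← mul_pow, meshSize_mul, Nat.add_sub_cancel' han]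
      rw [← h4, pow_succ]; ring
    refine (norm_add_le _ _).trans ((add_le_add h1 ((norm_sum_le _ _).trans
      (Finset.sum_le_sum h2))).trans ?_)
    rw [← Finset.sum_mul, List.length_cons, errDerivConst]
    have h5 := mul_le_mul_of_nonneg_right (sum_meshSize_le n)
      (mul_nonneg hA (mul_nonneg (mul_nonneg hc (hρ n)) hX0))
    linarith

end Sparse

section SparseSpace

/-! ### Piecewise polynomials -/

section Piecewise

variable {k M : ℕ} {τ : ℕ → ℝ}

/-- The function equal to `P j` on the `j`-th cell, and to zero off the cells. -/
def glue (M : ℕ) (τ : ℕ → ℝ) (P : ℕ → Polynomial ℝ) (x : ℝ) : ℝ :=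
  ∑ j ∈ Finset.range M, (Ico (τ j) (τ (j + 1))).indicator (fun x => (P j).eval x) x

theorem glue_apply (hlt : ∀ j < M, τ j < τ (j + 1)) (P : ℕ → Polynomial ℝ) {j : ℕ} (hj : j < M)
    {x : ℝ} (hx : x ∈ Ico (τ j) (τ (j + 1))) : glue M τ P x = (P j).eval x := by
  rw [glue, Finset.sum_eq_single_of_mem j (Finset.mem_range.2 hj), indicator_of_mem hx]
  intro i hi hij
  exact indicator_of_notMem
    (fun hc => hij (grid_cell_unique hlt (Finset.mem_range.1 hi) hj hc hx)) _

theorem glue_eq_zero (hlt : ∀ j < M, τ j < τ (j + 1)) (P : ℕ → Polynomial ℝ) {x : ℝ}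
    (hx : x ∉ Ico (τ 0) (τ M)) : glue M τ P x = 0 :=
  Finset.sum_eq_zero fun j hj => indicator_of_notMem (fun hc => hx
    ⟨(grid_mono hlt (Nat.zero_le j) (Finset.mem_range.1 hj).le).trans hc.1,
      hc.2.trans_le (grid_mono hlt (Finset.mem_range.1 hj) le_rfl)⟩) _

theorem glue_mem (hlt : ∀ j < M, τ j < τ (j + 1)) {P : ℕ → Polynomial ℝ}
    (hP : ∀ j, (P j).natDegree ≤ k) : glue M τ P ∈ piecewisePoly k M τ :=
  ⟨fun j hj => ⟨P j, hP j, fun _ hx => glue_apply hlt P hj hx⟩, fun _ hx => glue_eq_zero hlt P hx⟩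

theorem exists_eq_glue (hlt : ∀ j < M, τ j < τ (j + 1)) {w : ℝ → ℝ}
    (hw : w ∈ piecewisePoly k M τ) :
    ∃ P : ℕ → Polynomial ℝ, (∀ j, (P j).natDegree ≤ k) ∧ w = glue M τ P := by
  have : ∀ j, ∃ P : Polynomial ℝ, P.natDegree ≤ k ∧
      (j < M → ∀ x ∈ Ico (τ j) (τ (j + 1)), w x = P.eval x) := fun j => by
    by_cases hj : j < M
    · obtain ⟨P, hP, hPw⟩ := hw.1 j hj
      exact ⟨P, hP, fun _ => hPw⟩
    · exact ⟨0, by simp, fun h => absurd h hj⟩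
  choose P hP hPw using this
  refine ⟨P, hP, funext fun x => ?_⟩
  by_cases hx : x ∈ Ico (τ 0) (τ M)
  · obtain ⟨j, hj, hxj⟩ := exists_grid_cell hx
    rw [glue_apply hlt P hj hxj, hPw j hj x hxj]
  · rw [glue_eq_zero hlt P hx, hw.2 x hx]

theorem BddMeas.zero : BddMeas fun _ => 0 := ⟨measurable_const, 0, by simp⟩

theorem BddMeas.sum {ι : Type*} (s : Finset ι) {f : ι → ℝ → ℝ} (hf : ∀ j ∈ s, BddMeas (f j)) :
    BddMeas fun x => ∑ j ∈ s, f j x := by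
  classical
  induction s using Finset.induction_on with
  | empty => simpa using BddMeas.zero
  | insert a s ha ih =>
    simp only [Finset.sum_insert ha]
    exact (hf a (Finset.mem_insert_self a s)).add
      (ih fun j hj => hf j (Finset.mem_insert_of_mem hj))

theorem bddMeas_indicator_Ico {f : ℝ → ℝ} (hf : Continuous f) (a b : ℝ) :
    BddMeas ((Ico a b).indicator f) := by
  obtain ⟨C, hC⟩ := (isCompact_Icc (a := a) (b := b)).exists_bound_of_continuousOn hf.continuousOn
  refine ⟨hf.measurable.indicator measurableSet_Ico, |C|, fun x => ?_⟩
  by_cases hx : x ∈ Ico a b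
  · rw [indicator_of_mem hx]
    exact (hC x (Ico_subset_Icc_self hx)).trans (le_abs_self C)
  · rw [indicator_of_notMem hx]; simp

theorem bddMeas_glue (P : ℕ → Polynomial ℝ) : BddMeas (glue M τ P) :=
  BddMeas.sum _ fun j _ => bddMeas_indicator_Ico (P j).continuous _ _

theorem bddMeas_of_piecewisePoly (hlt : ∀ j < M, τ j < τ (j + 1)) {w : ℝ → ℝ}
    (hw : w ∈ piecewisePoly k M τ) : BddMeas w := by
  obtain ⟨P, -, rfl⟩ := exists_eq_glue hlt hw
  exact bddMeas_glue P

theorem piecewisePoly_sub {v w : ℝ → ℝ} (hv : v ∈ piecewisePoly k M τ)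
    (hw : w ∈ piecewisePoly k M τ) : (fun x => v x - w x) ∈ piecewisePoly k M τ := by
  refine ⟨fun j hj => ?_, fun x hx => by
    dsimp only
    rw [hv.2 x hx, hw.2 x hx, sub_zero]⟩
  obtain ⟨P, hP, hPv⟩ := hv.1 j hj
  obtain ⟨Q, hQ, hQw⟩ := hw.1 j hj
  refine ⟨P - Q, (Polynomial.natDegree_sub_le _ _).trans (max_le hP hQ), fun x hx => ?_⟩
  dsimp only
  rw [hPv x hx, hQw x hx, Polynomial.eval_sub]

theorem piecewisePoly_refine {M' : ℕ} {σ : ℕ → ℝ} (h0 : σ 0 = τ 0) (h1 : σ M' = τ M)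
    (h : ∀ j < M', ∃ i < M, τ i ≤ σ j ∧ σ (j + 1) ≤ τ (i + 1)) {w : ℝ → ℝ}
    (hw : w ∈ piecewisePoly k M τ) : w ∈ piecewisePoly k M' σ := by
  refine ⟨fun j hj => ?_, fun x hx => hw.2 x (by rwa [h0, h1] at hx)⟩
  obtain ⟨i, hi, hl, hr⟩ := h j hj
  obtain ⟨P, hP, hPw⟩ := hw.1 i hi
  exact ⟨P, hP, fun x hx => hPw x ⟨hl.trans hx.1, hx.2.trans_le hr⟩⟩

open Polynomial in
/-- Integration against the reproducing kernel produces polynomials. -/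
theorem exists_poly_integral_polyKer (k : ℕ) (a ℓ b c : ℝ) {F : ℝ → ℝ} (hF : BddMeas F) :
    ∃ P : ℝ[X], P.natDegree ≤ k ∧ ∀ t, ∫ x in b..c, polyKer k a ℓ x t * F x = P.eval t := by
  refine ⟨∑ n ∈ Finset.range (k + 1), C (ℓ⁻¹ * ∫ x in b..c, F x * (refBasis k n).eval ((x - a) / ℓ)) *
    (refBasis k n).comp (C ℓ⁻¹ * X + C (-a / ℓ)), ?_, fun t => ?_⟩
  · refine natDegree_sum_le_of_forall_le _ _ fun n hn => (natDegree_C_mul_le _ _).trans ?_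
    refine natDegree_comp_le.trans ?_
    exact (Nat.mul_le_mul (natDegree_refBasis hn) natDegree_linear_le).trans (by simp)
  · rw [eval_finsetSum]
    simp only [polyKer, Finset.mul_sum, Finset.sum_mul]
    rw [intervalIntegral.integral_finsetSum]
    · refine Finset.sum_congr rfl fun n _ => ?_
      simp only [eval_mul, eval_C, eval_comp, eval_add, eval_X]
      have h1 : ℓ⁻¹ * t + -a / ℓ = (t - a) / ℓ := by ring
      rw [h1, ← intervalIntegral.integral_const_mul, ← intervalIntegral.integral_mul_const]
      congr 1; ext x; ring
    · intro n _
      have h2 := intervalIntegrable_mul_continuous hF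
        (g := fun x => ℓ⁻¹ * ((refBasis k n).eval ((x - a) / ℓ) *
          (refBasis k n).eval ((t - a) / ℓ))) (by fun_prop) b c
      simpa only [mul_comm (F _)] using h2

/-- The `L²` projection of a bounded function onto the piecewise polynomials on a grid. -/
theorem exists_piecewise_projection (k : ℕ) (hlt : ∀ j < M, τ j < τ (j + 1)) {F : ℝ → ℝ}
    (hF : BddMeas F) : ∃ F' ∈ piecewisePoly k M τ, ∀ u ∈ piecewisePoly k M τ,
      ∫ x in τ 0..τ M, (F x - F' x) * u x = 0 := by
  choose P hP hPF using fun j : ℕ =>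
    exists_poly_integral_polyKer k (τ j) (τ (j + 1) - τ j) (τ j) (τ (j + 1)) hF
  refine ⟨glue M τ P, glue_mem hlt hP, fun u hu => ?_⟩
  have hub := bddMeas_of_piecewisePoly hlt hu
  have hii : ∀ a b, IntervalIntegrable (fun x => (F x - glue M τ P x) * u x) volume a b := fun a b => by
    simpa using intervalIntegrable_mul_continuous ((hF.sub (bddMeas_glue P)).mul hub)
      (continuous_const (y := (1 : ℝ))) a b
  rw [← intervalIntegral.sum_integral_adjacent_intervals fun j _ => hii _ _]
  refine Finset.sum_eq_zero fun j hj => ?_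
  have hj := Finset.mem_range.1 hj
  obtain ⟨p, hp, hpu⟩ := hu.1 j hj
  rw [integral_congr_Ico (hlt j hj).le
    (g := fun x => F x * p.eval x - (∫ y in τ j..τ (j + 1),
      polyKer k (τ j) (τ (j + 1) - τ j) y x * F y) * p.eval x) fun x hx => by
      rw [hpu x hx, glue_apply hlt P hj hx, hPF]; ring]
  obtain ⟨β, hβ⟩ := exists_abs_le_of_continuous (continuous_polyKer k (τ j) (τ (j + 1) - τ j)) (τ j)
    (τ (j + 1))
  rw [intervalIntegral.integral_sub (intervalIntegrable_mul_continuous hF p.continuous _ _),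
    integral_kernel_swap (continuous_polyKer _ _ _).measurable (hlt j hj).le hβ hF, sub_eq_zero]
  · congr 1; ext x
    have := integral_polyKer_mul (a := τ j) (sub_pos.2 (hlt j hj)) hp x
    rw [add_sub_cancel] at this
    rw [this]
  · simp only [hPF]
    exact ((P j).continuous.mul p.continuous).intervalIntegrable _ _

theorem kact_projKer_mem {h : ℝ} (G : IsGrid τ M h) (k : ℕ) {φ : ℝ → ℝ} (hφ : BddMeas φ) :
    kact (projKer k τ M) φ ∈ piecewisePoly k M τ := by
  refine ⟨fun j hj => ?_, fun x hx => ?_⟩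
  · obtain ⟨P, hP, hPφ⟩ :=
      exists_poly_integral_polyKer k (τ j) (τ (j + 1) - τ j) (τ j) (τ (j + 1)) hφ
    refine ⟨P, hP, fun t ht => ?_⟩
    rw [projKer, kact_cellKer G _ _ hj ht, hPφ]
  · rw [G.zero, G.last] at hx
    exact kact_cellKer_eq_zero G _ _ hx

theorem CellOrth.integral_mul_eq_zero {h : ℝ} (G : IsGrid τ M h) {χ ψ : ℝ → ℝ} (hχ : BddMeas χ)
    (ho : CellOrth τ M (k + 1) χ) (hψ : ψ ∈ piecewisePoly k M τ) :
    ∫ x in (0 : ℝ)..1, ψ x * χ x = 0 := by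
  have hii : ∀ a b, IntervalIntegrable (fun x => ψ x * χ x) volume a b := fun a b => by
    simpa using intervalIntegrable_mul_continuous ((bddMeas_of_piecewisePoly G.lt hψ).mul hχ)
      (continuous_const (y := (1 : ℝ))) a b
  suffices h : ∫ x in τ 0..τ M, ψ x * χ x = 0 by rwa [G.zero, G.last] at h
  rw [← intervalIntegral.sum_integral_adjacent_intervals (a := τ) (n := M) fun j _ => hii _ _]
  refine Finset.sum_eq_zero fun j hj => ?_
  have hj := Finset.mem_range.1 hj
  obtain ⟨p, hp, hpψ⟩ := hψ.1 j hj
  rw [integral_congr_Ico (G.lt j hj).le (g := fun x => χ x * p.eval x) fun x hx => by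
    rw [hpψ x hx]; ring]
  exact ho j hj p (Nat.lt_succ_of_le hp)

end Piecewise

/-! ### Splitting piecewise polynomials on the dual grids into the levels -/

variable {k N : ℕ}

theorem uniformGrid_shift (n N j : ℕ) :
    uniformGrid (-(meshSize N / 2)) (1 - meshSize N / 2) n j =
      j * meshSize n - meshSize N / 2 := by
  unfold uniformGrid; simp only [meshSize]; ring

theorem uniformGrid_shift_lt (n N j : ℕ) :
    uniformGrid (-(meshSize N / 2)) (1 - meshSize N / 2) n j <
      uniformGrid (-(meshSize N / 2)) (1 - meshSize N / 2) n (j + 1) := by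
  rw [uniformGrid_shift, uniformGrid_shift]
  push_cast
  linarith [meshSize_pos n]

theorem uniformGrid_shift_zero (n N : ℕ) :
    uniformGrid (-(meshSize N / 2)) (1 - meshSize N / 2) n 0 = -(meshSize N / 2) := by
  rw [uniformGrid_shift]; push_cast; ring

theorem uniformGrid_shift_pow (n N : ℕ) :
    uniformGrid (-(meshSize N / 2)) (1 - meshSize N / 2) n (2 ^ n) = 1 - meshSize N / 2 := by
  rw [uniformGrid_shift]; push_cast; rw [pow_mul_meshSize]

/-- Every dual cell but the last one is the part of a shifted primal cell in the unit interval. -/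
theorem dualGrid_cell_subset {n N j : ℕ} (hj : j < 2 ^ n) :
    Ico (dualGrid n N j) (dualGrid n N (j + 1)) ⊆
      Ico (uniformGrid (-(meshSize N / 2)) (1 - meshSize N / 2) n j)
        (uniformGrid (-(meshSize N / 2)) (1 - meshSize N / 2) n (j + 1)) := by
  intro x hx
  rw [dualGrid_of_le (j := j + 1) (by omega) hj] at hx
  rw [uniformGrid_shift, uniformGrid_shift]
  refine ⟨?_, hx.2⟩
  rcases Nat.eq_zero_or_pos j with rfl | h0
  · have := hx.1
    rw [dualGrid_zero] at this
    push_cast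
    linarith [meshSize_pos N]
  · have := hx.1
    rwa [dualGrid_of_le h0.ne' hj.le] at this

theorem dualW_subset {l : ℕ} (hl : l ≤ N) {w : ℝ → ℝ} (hw : w ∈ dualW k N l) :
    w ∈ dualV k l N := by
  cases l with
  | zero => exact hw
  | succ l =>
    obtain ⟨w', hw', rfl⟩ := hw
    have G := isGrid_dual hl
    refine ⟨fun j hj => ?_, fun x hx => ?_⟩
    · rcases (Nat.le_of_lt_succ hj).eq_or_lt with rfl | hlt
      · refine ⟨0, by simp, fun x hx => ?_⟩
        dsimp only
        rw [indicator_of_mem (G.cell_subset hj hx), hw'.1.2, Polynomial.eval_zero]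
        rw [dualGrid_pow] at hx
        rw [uniformGrid_shift_pow]
        exact fun hc => absurd hc.2 (not_lt.2 hx.1)
      · obtain ⟨P, hP, hPw⟩ := hw'.1.1 j hlt
        refine ⟨P, hP, fun x hx => ?_⟩
        dsimp only
        rw [indicator_of_mem (G.cell_subset hj hx)]
        exact hPw x (dualGrid_cell_subset hlt hx)
    · rw [dualGrid_zero, dualGrid_last] at hx
      exact indicator_of_notMem hx _

theorem dualV_mono {l n : ℕ} (hln : l ≤ n) (hnN : n ≤ N) {w : ℝ → ℝ} (hw : w ∈ dualV k l N) :
    w ∈ dualV k n N :=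
  piecewisePoly_refine (σ := dualGrid n N) (τ := dualGrid l N) (M := 2 ^ l + 1) (M' := 2 ^ n + 1)
    (by rw [dualGrid_zero, dualGrid_zero])
    (by rw [dualGrid_last, dualGrid_last]) (fun _ hj => dualGrid_nested hln hnN hj) hw

theorem bddMeas_of_dualV {l : ℕ} (hl : l ≤ N) {w : ℝ → ℝ} (hw : w ∈ dualV k l N) : BddMeas w :=
  bddMeas_of_piecewisePoly (isGrid_dual hl).lt hw

theorem primalV_succ {n : ℕ} {w : ℝ → ℝ}
    (hw : w ∈ primalV k (-(meshSize N / 2)) (1 - meshSize N / 2) n) :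
    w ∈ primalV k (-(meshSize N / 2)) (1 - meshSize N / 2) (n + 1) := by
  refine piecewisePoly_refine ?_ ?_ (fun j hj => ⟨j / 2, ?_, ?_, ?_⟩) hw
  · rw [uniformGrid_shift_zero, uniformGrid_shift_zero]
  · rw [uniformGrid_shift_pow, uniformGrid_shift_pow]
  · have : 2 ^ (n + 1) = 2 * 2 ^ n := by ring
    omega
  · rw [uniformGrid_shift, uniformGrid_shift, meshSize_succ n]
    have : (2 * (j / 2 : ℕ) : ℝ) ≤ j := by exact_mod_cast Nat.mul_div_le j 2
    nlinarith [meshSize_pos (n + 1)]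
  · rw [uniformGrid_shift, uniformGrid_shift, meshSize_succ n]
    have : ((j + 1 : ℕ) : ℝ) ≤ 2 * (j / 2 + 1 : ℕ) := by
      exact_mod_cast (by omega : j + 1 ≤ 2 * (j / 2 + 1))
    nlinarith [meshSize_pos (n + 1)]

/-- The level spaces `W` up to level `n` span the piecewise polynomials on the dual grid of level
`n`: subtract from a function its primal projection to the next coarser level. -/
theorem exists_dualW_sum {n : ℕ} (hn : n ≤ N) {φ : ℝ → ℝ} (hφ : φ ∈ dualV k n N) :
    ∃ w : ℕ → ℝ → ℝ, (∀ a ≤ n, w a ∈ dualW k N a) ∧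
      ∀ x, φ x = ∑ a ∈ Finset.range (n + 1), w a x := by
  induction n generalizing φ with
  | zero => exact ⟨fun _ => φ, fun a ha => by rw [Nat.le_zero.1 ha]; exact hφ, by simp⟩
  | succ n ih =>
    have G := isGrid_dual hn
    have G' := isGrid_dual (show n ≤ N by omega)
    obtain ⟨P, hP, hφP⟩ := exists_eq_glue G.lt hφ
    -- `F` below is the shifted primal function that agrees with `φ` off the last dual cell, which
    -- is common to all levels
    let ug := fun n => uniformGrid (-(meshSize N / 2)) (1 - meshSize N / 2) n
    have hug : ∀ n, ∀ j < 2 ^ n, ug n j < ug n (j + 1) := fun n j _ => uniformGrid_shift_lt n N j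
    let F := glue (2 ^ (n + 1)) (ug (n + 1)) P
    have hF : F ∈ primalV k (-(meshSize N / 2)) (1 - meshSize N / 2) (n + 1) :=
      glue_mem (hug (n + 1)) hP
    obtain ⟨F', hF', hFo⟩ := exists_piecewise_projection k (hug n) (bddMeas_glue (M := 2 ^ (n + 1))
      (τ := ug (n + 1)) P)
    have hw : (Ico (0 : ℝ) 1).indicator (fun x => F x - F' x) ∈ dualW k N (n + 1) := by
      refine ⟨fun x => F x - F' x, ⟨piecewisePoly_sub hF (primalV_succ hF'), fun u hu => ?_⟩, rfl⟩
      have := hFo u hu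
      simp only [ug] at this
      rwa [uniformGrid_shift_zero, uniformGrid_shift_pow] at this
    have hφF : ∀ j < 2 ^ n, ∀ x ∈ Ico (dualGrid n N j) (dualGrid n N (j + 1)), φ x = F x := by
      intro j hj x hx
      have hx1 := G'.cell_subset (show j < 2 ^ n + 1 by omega) hx
      obtain ⟨i, hi, hxi⟩ := G.exists_cell hx1
      have hi' : i < 2 ^ (n + 1) := by
        refine lt_of_le_of_ne (Nat.le_of_lt_succ hi) fun h => ?_
        have h1 := hxi.1
        rw [h, dualGrid_pow, ← dualGrid_pow n N] at h1
        exact absurd (hx.2.trans_le (G'.mono (show j + 1 ≤ 2 ^ n from hj) (by omega)))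
          (not_lt.2 h1)
      rw [hφP, glue_apply G.lt P hi hxi]
      exact (glue_apply (hug (n + 1)) P hi' (dualGrid_cell_subset hi' hxi)).symm
    have hφ' : (fun x => φ x - (Ico (0 : ℝ) 1).indicator (fun x => F x - F' x) x) ∈
        dualV k n N := by
      refine ⟨fun j hj => ?_, fun x hx => ?_⟩
      · rcases (Nat.le_of_lt_succ hj).eq_or_lt with rfl | hlt
        · refine ⟨P (2 ^ (n + 1)), hP _, fun x hx => ?_⟩
          have hx1 := G'.cell_subset hj hx
          rw [dualGrid_pow, dualGrid_last] at hx
          have h1 : F x = 0 := hF.2 x (by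
            rw [uniformGrid_shift_pow]; exact fun hc => absurd hc.2 (not_lt.2 hx.1))
          have h2 : F' x = 0 := hF'.2 x (by
            simp only [ug]
            rw [uniformGrid_shift_pow]; exact fun hc => absurd hc.2 (not_lt.2 hx.1))
          dsimp only
          rw [indicator_of_mem hx1, h1, h2, hφP,
            glue_apply G.lt P (j := 2 ^ (n + 1)) (by omega)
              (by rw [dualGrid_pow, dualGrid_last]; exact hx)]
          ring
        · obtain ⟨Q, hQ, hQF⟩ := hF'.1 j hlt
          refine ⟨Q, hQ, fun x hx => ?_⟩
          dsimp only
          rw [indicator_of_mem (G'.cell_subset hj hx), hφF j hlt x hx,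
            ← hQF x (dualGrid_cell_subset hlt hx)]
          ring
      · rw [dualGrid_zero, dualGrid_last] at hx
        dsimp only
        rw [indicator_of_notMem hx, sub_zero]
        exact hφ.2 x (by rwa [dualGrid_zero, dualGrid_last])
    obtain ⟨w, hw1, hw2⟩ := ih (by omega) hφ'
    refine ⟨fun a => if a ≤ n then w a else (Ico (0 : ℝ) 1).indicator (fun x => F x - F' x), ?_, ?_⟩
    · intro a ha
      by_cases h : a ≤ n
      · simp only [h, if_true]; exact hw1 a h
      · have : a = n + 1 := by omega
        subst this
        simpa using hw
    · intro x
      have h1 : ∀ a ∈ Finset.range (n + 1), (if a ≤ n then w a else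
          (Ico (0 : ℝ) 1).indicator (fun x => F x - F' x)) x = w a x := fun a ha => by
        rw [if_pos (Nat.le_of_lt_succ (Finset.mem_range.1 ha))]
      rw [Finset.sum_range_succ, Finset.sum_congr rfl h1, ← hw2 x]
      simp

/-! ### The sparse space -/

variable {d : ℕ}

theorem tens_sum {ι : Type*} {φ : Fin d → ℝ → ℝ} {B : Fin d → Finset ι}
    {w : Fin d → ι → ℝ → ℝ} (h : ∀ i x, φ i x = ∑ a ∈ B i, w i a x) :
    tens φ = ∑ p ∈ Fintype.piFinset B, tens fun i => w i (p i) := by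
  classical
  funext x
  rw [tens, Finset.prod_congr rfl fun i _ => h i (x i), Finset.prod_univ_sum, Finset.sum_apply]
  rfl

/-- The tensor products of piecewise polynomials on the dual grids of levels `l i`, `|l|₁ ≤ N`. -/
def dualTensors (d k N : ℕ) : Set ((Fin d → ℝ) → ℝ) :=
  {f | ∃ (l : Fin d → ℕ) (φ : Fin d → ℝ → ℝ),
    ∑ i, l i ≤ N ∧ (∀ i, φ i ∈ dualV k (l i) N) ∧ f = tens φ}

theorem le_of_sum_le {l : Fin d → ℕ} (hl : ∑ i, l i ≤ N) (i : Fin d) : l i ≤ N :=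
  (Finset.single_le_sum (fun _ _ => Nat.zero_le _) (Finset.mem_univ i)).trans hl

theorem tens_mem_sparseSpace {l : Fin d → ℕ} (hl : ∑ i, l i ≤ N) {φ : Fin d → ℝ → ℝ}
    (hφ : ∀ i, φ i ∈ dualV k (l i) N) : tens φ ∈ sparseSpace d k N := by
  choose w hw hsum using fun i => exists_dualW_sum (le_of_sum_le hl i) (hφ i)
  rw [tens_sum hsum]
  refine Submodule.sum_mem _ fun p hp => ?_
  rw [Fintype.mem_piFinset] at hp
  have hp' : ∀ i, p i ≤ l i := fun i => Nat.le_of_lt_succ (Finset.mem_range.1 (hp i))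
  have hpN : ∑ i, p i ≤ N := (Finset.sum_le_sum fun i _ => hp' i).trans hl
  refine Submodule.mem_iSup_of_mem p (Submodule.mem_iSup_of_mem hpN (Submodule.subset_span ?_))
  exact ⟨fun i => w i (p i), fun i => hw i _ (hp' i), rfl⟩

theorem sparseSpace_eq_span (d k N : ℕ) :
    sparseSpace d k N = Submodule.span ℝ (dualTensors d k N) := by
  apply le_antisymm
  · refine iSup_le fun l => iSup_le fun hl => Submodule.span_mono ?_
    rintro f ⟨w, hw, rfl⟩
    exact ⟨l, w, hl, fun i => dualW_subset (le_of_sum_le hl i) (hw i), rfl⟩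
  · rw [Submodule.span_le]
    rintro f ⟨l, φ, hl, hφ, rfl⟩
    exact tens_mem_sparseSpace hl hφ

/-- Monomials cut off to a cell of the finest dual grid. -/
def cellMonomial (N : ℕ) (b : ℕ × ℕ) : ℝ → ℝ :=
  (Ico (dualGrid N N b.1) (dualGrid N N (b.1 + 1))).indicator fun x => x ^ b.2

theorem bddMeas_cellMonomial (N : ℕ) (b : ℕ × ℕ) : BddMeas (cellMonomial N b) :=
  bddMeas_indicator_Ico (continuous_pow _) _ _

/-- Indices of the tensor products of cell monomials of degree at most `k`. -/
def monomialIndex (d k N : ℕ) : Finset (Fin d → ℕ × ℕ) :=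
  Fintype.piFinset fun _ => Finset.range (2 ^ N + 1) ×ˢ Finset.range (k + 1)

theorem sparseSpace_le_span (d k N : ℕ) : sparseSpace d k N ≤ Submodule.span ℝ
    ((fun p : Fin d → ℕ × ℕ => tens fun i => cellMonomial N (p i)) '' monomialIndex d k N) := by
  rw [sparseSpace_eq_span, Submodule.span_le]
  rintro f ⟨l, φ, hl, hφ, rfl⟩
  have h1 : ∀ i, ∃ P : ℕ → Polynomial ℝ, (∀ j, (P j).natDegree ≤ k) ∧
      φ i = glue (2 ^ N + 1) (dualGrid N N) P := fun i =>
    exists_eq_glue (isGrid_dual le_rfl).lt (dualV_mono (le_of_sum_le hl i) le_rfl (hφ i))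
  choose P hP hPφ using h1
  have h2 : ∀ i x, φ i x = ∑ b ∈ Finset.range (2 ^ N + 1) ×ˢ Finset.range (k + 1),
      (P i b.1).coeff b.2 * cellMonomial N b x := by
    intro i x
    rw [hPφ, Finset.sum_product, glue]
    refine Finset.sum_congr rfl fun j _ => ?_
    by_cases hx : x ∈ Ico (dualGrid N N j) (dualGrid N N (j + 1))
    · rw [indicator_of_mem hx,
        Polynomial.eval_eq_sum_range' (Nat.lt_succ_of_le (hP i j))]
      refine Finset.sum_congr rfl fun n _ => ?_
      rw [cellMonomial, indicator_of_mem hx]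
    · rw [indicator_of_notMem hx]
      refine (Finset.sum_eq_zero fun n _ => ?_).symm
      rw [cellMonomial, indicator_of_notMem hx, mul_zero]
  rw [tens_sum h2]
  refine Submodule.sum_mem _ fun p hp => ?_
  have h3 : (tens fun i x => (P i (p i).1).coeff (p i).2 * cellMonomial N (p i) x) =
      (∏ i, (P i (p i).1).coeff (p i).2) • tens fun i => cellMonomial N (p i) := by
    funext x
    simp only [tens, Pi.smul_apply, smul_eq_mul, Finset.prod_mul_distrib]
  rw [h3]
  exact Submodule.smul_mem _ _ (Submodule.subset_span ⟨p, hp, rfl⟩)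

/-- The classes in `L²` of the elements of the sparse space. -/
def sparseLp (d k N : ℕ) : Submodule ℝ (L2Cube d) where
  carrier := {f | ∃ w ∈ sparseSpace d k N, f =ᵐ[mu d] w}
  add_mem' := by
    rintro f g ⟨v, hv, hfv⟩ ⟨w, hw, hgw⟩
    exact ⟨v + w, Submodule.add_mem _ hv hw, (Lp.coeFn_add f g).trans (hfv.add hgw)⟩
  zero_mem' := ⟨0, Submodule.zero_mem _, Lp.coeFn_zero ℝ 2 (mu d)⟩
  smul_mem' := by
    rintro c f ⟨v, hv, hfv⟩
    exact ⟨c • v, Submodule.smul_mem _ c hv, (Lp.coeFn_smul c f).trans (hfv.const_smul c)⟩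

theorem tensLp_mem_sparseLp {l : Fin d → ℕ} (hl : ∑ i, l i ≤ N) {φ : Fin d → ℝ → ℝ}
    (hφ : ∀ i, φ i ∈ dualV k (l i) N) : tensLp φ ∈ sparseLp d k N :=
  ⟨tens φ, tens_mem_sparseSpace hl hφ,
    coeFn_tensLp fun i => bddMeas_of_dualV (le_of_sum_le hl i) (hφ i)⟩

/-- Every function in the span of tensor products has a class in the span of their classes. -/
theorem exists_class_of_mem_span {T : Set (Fin d → ℝ → ℝ)} (hT : ∀ φ ∈ T, ∀ i, BddMeas (φ i))
    {w : (Fin d → ℝ) → ℝ} (hw : w ∈ Submodule.span ℝ (tens '' T)) :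
    ∃ f ∈ Submodule.span ℝ (tensLp '' T), f =ᵐ[mu d] w := by
  induction hw using Submodule.span_induction with
  | mem w hw =>
    obtain ⟨φ, hφ, rfl⟩ := hw
    exact ⟨tensLp φ, Submodule.subset_span ⟨φ, hφ, rfl⟩, coeFn_tensLp (hT φ hφ)⟩
  | zero => exact ⟨0, Submodule.zero_mem _, Lp.coeFn_zero ℝ 2 (mu d)⟩
  | add v w _ _ hv hw =>
    obtain ⟨f, hf, hfv⟩ := hv
    obtain ⟨g, hg, hgw⟩ := hw
    exact ⟨f + g, Submodule.add_mem _ hf hg, (Lp.coeFn_add f g).trans (hfv.add hgw)⟩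
  | smul c v _ hv =>
    obtain ⟨f, hf, hfv⟩ := hv
    exact ⟨c • f, Submodule.smul_mem _ c hf, (Lp.coeFn_smul c f).trans (hfv.const_smul c)⟩

theorem finiteDimensional_sparseLp (d k N : ℕ) : FiniteDimensional ℝ (sparseLp d k N) := by
  let T : Set (Fin d → ℝ → ℝ) :=
    (fun p : Fin d → ℕ × ℕ => fun i => cellMonomial N (p i)) '' monomialIndex d k N
  have hTf : T.Finite := (monomialIndex d k N).finite_toSet.image _
  have hle : sparseLp d k N ≤ Submodule.span ℝ (tensLp '' T) := by
    rintro f ⟨w, hw, hfw⟩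
    have h1 := sparseSpace_le_span d k N hw
    have h2 : w ∈ Submodule.span ℝ (tens '' T) := by rwa [image_image]
    obtain ⟨g, hg, hgw⟩ := exists_class_of_mem_span (by
      rintro φ ⟨p, -, rfl⟩ i; exact bddMeas_cellMonomial N _) h2
    rwa [Lp.ext (hfw.trans hgw.symm)]
  have : FiniteDimensional ℝ (Submodule.span ℝ (tensLp '' T)) :=
    FiniteDimensional.span_of_finite ℝ (hTf.image _)
  exact Submodule.finiteDimensional_of_le hle

theorem exists_class {w : (Fin d → ℝ) → ℝ} (hw : w ∈ sparseSpace d k N) :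
    ∃ f ∈ sparseLp d k N, f =ᵐ[mu d] w := by
  let T : Set (Fin d → ℝ → ℝ) :=
    (fun p : Fin d → ℕ × ℕ => fun i => cellMonomial N (p i)) '' monomialIndex d k N
  have h1 := sparseSpace_le_span d k N hw
  have h2 : w ∈ Submodule.span ℝ (tens '' T) := by rwa [image_image]
  obtain ⟨g, -, hgw⟩ := exists_class_of_mem_span (by
    rintro φ ⟨p, -, rfl⟩ i; exact bddMeas_cellMonomial N _) h2
  exact ⟨g, ⟨w, hw, hgw⟩, hgw⟩

/-! ### Identification of the sparse projection -/

theorem pr_tensLp {ψ φ : Fin d → ℝ → ℝ} (hψ : ∀ i, BddMeas (ψ i)) (hφ : ∀ i, BddMeas (φ i)) :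
    pr (tensLp ψ) φ = ∏ i, ∫ x in (0 : ℝ)..1, ψ i x * φ i x := by
  rw [pr_eq_integral _ hφ]
  have h1 : ∫ x, tensLp ψ x * tens φ x ∂mu d = ∫ x, ∏ i, (ψ i (x i) * φ i (x i)) ∂mu d := by
    apply integral_congr_ae
    filter_upwards [coeFn_tensLp hψ] with x hx
    rw [hx, tens, tens, Finset.prod_mul_distrib]
  rw [h1, mu, integral_fintype_prod_eq_prod (fun i (t : ℝ) => ψ i t * φ i t)]
  exact Finset.prod_congr rfl fun i _ => integral_lam _

theorem dualProj_tensLp {l n : ℕ} (hln : l ≤ n) (hn : n ≤ N) {ψ : Fin d → ℝ → ℝ}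
    (hψ : ∀ i, BddMeas (ψ i)) (i : Fin d) (hi : ψ i ∈ dualV k l N) :
    dualProj k N n i (tensLp ψ) = tensLp ψ := by
  have G := isGrid_dual hn
  refine ext_pr fun φ hφ => ?_
  have hP := acts_dualProj k hn i
  have hPb := hP.bdd _ (hφ i)
  rw [hP.pr_eq _ φ hφ, pr_tensLp hψ (BddMeas.forall_update hφ i hPb), pr_tensLp hψ hφ]
  refine Finset.prod_congr rfl fun j _ => ?_
  by_cases hj : j = i
  · subst hj
    rw [Function.update_self]
    have h1 := (cellOrth_sub_proj G (k := k) (hφ j) hPb).integral_mul_eq_zero G ((hφ j).sub hPb)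
      (dualV_mono hln hn hi)
    have hii : ∀ χ, BddMeas χ → IntervalIntegrable (fun x => ψ j x * χ x) volume 0 1 := fun χ hχ => by
      simpa using intervalIntegrable_mul_continuous ((hψ j).mul hχ)
        (continuous_const (y := (1 : ℝ))) 0 1
    simp only [mul_sub] at h1
    rw [intervalIntegral.integral_sub (hii _ (hφ j)) (hii _ hPb), sub_eq_zero] at h1
    exact h1.symm
  · rw [Function.update_of_ne hj]

/-- The error operator vanishes on functions invariant under the projections of high level. -/
theorem sparseErr_eq_zero {l : Fin d → ℕ} {f : L2Cube d}
    (hf : ∀ i, ∀ n ≤ N, l i ≤ n → dualProj k N n i f = f) {s : List (Fin d)} (hs : s.Nodup)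
    {n : ℕ} (hn : n ≤ N) (hl : (s.map l).sum ≤ n) : sparseErr k N s n f = 0 := by
  induction s generalizing n with
  | nil => rfl
  | cons i s ih =>
    have his : i ∉ s := (List.nodup_cons.1 hs).1
    rw [List.map_cons, List.sum_cons] at hl
    simp only [sparseErr, add_apply, sum_apply, mul_apply_eq_comp, sub_apply, one_apply_eq_self]
    rw [hf i n hn (by omega), sub_self, zero_add]
    refine Finset.sum_eq_zero fun a ha => ?_
    have ha := Finset.mem_range.1 ha
    rcases le_or_gt a (l i) with h | h
    · rw [ih (List.nodup_cons.1 hs).2 (by omega) (by omega), map_zero]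
    · obtain ⟨c, hc⟩ := exists_acts_dualIncr k (show a ≤ N by omega) i
      obtain ⟨b, rfl⟩ := Nat.exists_eq_succ_of_ne_zero (show a ≠ 0 by omega)
      rw [← sparseErr_comm hc his (by omega)]
      have : dualIncr k N b.succ i f = 0 := by
        simp only [dualIncr, sub_apply]
        rw [hf i _ (by omega) (by omega), hf i _ (by omega) (by omega), sub_self]
      rw [this, map_zero]

theorem sparseErr_eq_zero_of_mem {s : List (Fin d)} (hs : s.Nodup)
    (hall : ∀ l : Fin d → ℕ, (s.map l).sum = ∑ i, l i) {f : L2Cube d}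
    (hf : f ∈ sparseLp d k N) : sparseErr k N s N f = 0 := by
  obtain ⟨w, hw, hfw⟩ := hf
  rw [sparseSpace_eq_span] at hw
  let T : Set (Fin d → ℝ → ℝ) := {φ | ∃ l : Fin d → ℕ, ∑ i, l i ≤ N ∧ ∀ i, φ i ∈ dualV k (l i) N}
  have hT : dualTensors d k N ⊆ tens '' T := by
    rintro f ⟨l, φ, hl, hφ, rfl⟩
    exact ⟨φ, ⟨l, hl, hφ⟩, rfl⟩
  obtain ⟨g, hg, hgw⟩ := exists_class_of_mem_span (T := T) (by
    rintro φ ⟨l, hl, hφ⟩ i; exact bddMeas_of_dualV (le_of_sum_le hl i) (hφ i))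
    (Submodule.span_mono hT hw)
  rw [Lp.ext (hfw.trans hgw.symm)]
  have hle : Submodule.span ℝ (tensLp '' T) ≤
      LinearMap.ker (sparseErr k N s N : L2Cube d →ₗ[ℝ] L2Cube d) := by
    rw [Submodule.span_le]
    rintro _ ⟨φ, ⟨l, hl, hφ⟩, rfl⟩
    change sparseErr k N s N (tensLp φ) = 0
    exact sparseErr_eq_zero (l := l) (fun i n hn hin => dualProj_tensLp hin hn
      (fun j => bddMeas_of_dualV (le_of_sum_le hl j) (hφ j)) i (hφ i)) hs le_rfl
      ((hall l).trans_le hl)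
  exact hle hg

/-- The transpose of `1 - sparseErr` maps tensor products into the sparse space. In the induction the
coordinates off the list already carry piecewise polynomials, of levels `l`. -/
theorem exists_pr_eq_inner {s : List (Fin d)} (hs : s.Nodup) {n : ℕ} {l : Fin d → ℕ}
    (hln : ∑ i, l i + n ≤ N) (hls : ∀ i ∈ s, l i = 0) {φ : Fin d → ℝ → ℝ}
    (hφ : ∀ i, BddMeas (φ i)) (hφl : ∀ i ∉ s, φ i ∈ dualV k (l i) N) :
    ∃ w ∈ sparseLp d k N, ∀ f, pr ((1 - sparseErr k N s n) f) φ = inner ℝ f w := by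
  induction s generalizing n l φ with
  | nil =>
    exact ⟨tensLp φ, tensLp_mem_sparseLp (by omega) fun i => hφl i (by simp), fun f => by
      simp [sparseErr, pr]⟩
  | cons i s ih =>
    have his : i ∉ s := (List.nodup_cons.1 hs).1
    have hsn := (List.nodup_cons.1 hs).2
    have step : ∀ a ≤ n, ∀ b ≤ a, ∃ w ∈ sparseLp d k N, ∀ f,
        pr (dualProj k N b i ((1 - sparseErr k N s (n - a)) f)) φ = inner ℝ f w := by
      intro a ha b hb
      have hbN : b ≤ N := by omega
      have hP := acts_dualProj k hbN i
      have hPb := hP.bdd _ (hφ i)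
      have hsum : ∑ j, Function.update l i b j = ∑ j, l j + b := by
        rw [Finset.sum_update_of_mem (Finset.mem_univ i),
          ← Finset.add_sum_erase _ l (Finset.mem_univ i), hls i List.mem_cons_self,
          Finset.sdiff_singleton_eq_erase]
        omega
      obtain ⟨w, hw, hwf⟩ := ih hsn (n := n - a) (l := Function.update l i b)
        (φ := Function.update φ i (kact (projKer k (dualGrid b N) (2 ^ b + 1)) (φ i)))
        (by rw [hsum]; omega)
        (fun j hj => by
          rw [Function.update_of_ne (fun h : j = i => his (h ▸ hj))]
          exact hls j (List.mem_cons_of_mem _ hj))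
        (BddMeas.forall_update hφ i hPb)
        (fun j hj => by
          by_cases h : j = i
          · subst h
            rw [Function.update_self, Function.update_self]
            exact kact_projKer_mem (isGrid_dual hbN) k (hφ j)
          · rw [Function.update_of_ne h, Function.update_of_ne h]
            exact hφl j fun hc => (List.mem_cons.1 hc).elim h hj)
      exact ⟨w, hw, fun f => by rw [hP.pr_eq _ φ hφ, hwf]⟩
    have stepQ : ∀ a ∈ Finset.range (n + 1), ∃ w ∈ sparseLp d k N, ∀ f,
        pr (dualIncr k N a i ((1 - sparseErr k N s (n - a)) f)) φ = inner ℝ f w := by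
      intro a ha
      have ha := Nat.le_of_lt_succ (Finset.mem_range.1 ha)
      cases a with
      | zero => exact step 0 ha 0 le_rfl
      | succ a =>
        obtain ⟨w, hw, hwf⟩ := step (a + 1) ha (a + 1) le_rfl
        obtain ⟨w', hw', hwf'⟩ := step (a + 1) ha a (by omega)
        refine ⟨w - w', Submodule.sub_mem _ hw hw', fun f => ?_⟩
        rw [dualIncr, sub_apply, pr_sub, hwf, hwf', inner_sub_right]
    have hS : 1 - sparseErr k N (i :: s) n =
        ∑ a ∈ Finset.range (n + 1), dualIncr k N a i * (1 - sparseErr k N s (n - a)) := by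
      simp only [sparseErr, mul_sub, mul_one, Finset.sum_sub_distrib, sum_dualIncr]
      abel
    choose! w hw hwf using stepQ
    refine ⟨∑ a ∈ Finset.range (n + 1), w a, Submodule.sum_mem _ hw, fun f => ?_⟩
    rw [hS, sum_apply, pr_sum, inner_sum]
    exact Finset.sum_congr rfl fun a ha => by rw [mul_apply_eq_comp, hwf a ha]

/-- The error of the orthogonal projection onto the sparse space is given by `sparseErr`, for any
order of the coordinates: `sparseErr` vanishes on the sparse space, and `1 - sparseErr` annihilates
its orthogonal complement. -/
theorem sub_eq_neg_sparseErr {s : List (Fin d)} (hs : s.Nodup) (hmem : ∀ i, i ∈ s)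
    (hall : ∀ l : Fin d → ℕ, (s.map l).sum = ∑ i, l i) {u v : L2Cube d}
    (hu : u ∈ sparseLp d k N) (ho : ∀ w ∈ sparseLp d k N, inner ℝ (u - v) w = 0) :
    u - v = -sparseErr k N s N v := by
  have h1 : (1 - sparseErr k N s N) (u - v) = 0 := by
    refine ext_pr fun φ hφ => ?_
    obtain ⟨w, hw, hwf⟩ := exists_pr_eq_inner (k := k) (N := N) hs (n := N) (l := fun _ => 0)
      (by simp) (fun _ _ => rfl) hφ fun i hi => absurd (hmem i) hi
    rw [hwf, ho w hw]
    simp [pr]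
  have h2 := sparseErr_eq_zero_of_mem hs hall hu
  rw [sub_apply, one_apply_eq_self, map_sub, h2, zero_sub, sub_eq_zero] at h1
  exact h1

end SparseSpace

/-! ### Cellwise derivatives of the projection error -/

section CellDeriv

variable {d : ℕ} {k N : ℕ}

theorem IsTest.deriv {a b : ℝ} {φ : ℝ → ℝ} (h : IsTest a b φ) : IsTest a b (deriv φ) :=
  ⟨(contDiff_infty_iff_deriv.1 h.smooth).2, h.compact.deriv, tsupport_deriv_subset.trans h.supp⟩

theorem IsTest.hasDerivAt {a b : ℝ} {φ : ℝ → ℝ} (h : IsTest a b φ) (t : ℝ) :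
    HasDerivAt φ (_root_.deriv φ t) t :=
  (h.smooth.differentiable (by simp) t).hasDerivAt

theorem IsTest.mono {a b a' b' : ℝ} {φ : ℝ → ℝ} (h : IsTest a b φ) (ha : a' ≤ a) (hb : b ≤ b') :
    IsTest a' b' φ :=
  ⟨h.smooth, h.compact, h.supp.trans (Ioo_subset_Ioo ha hb)⟩

/-- Grid points of a coarse dual grid are not interior to the finest cells. -/
theorem dualGrid_notMem_Ioo {n : ℕ} (hn : n ≤ N) {i j : ℕ} (hi : i ≤ 2 ^ n + 1)
    (hj : j < 2 ^ N + 1) :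
    dualGrid n N i ∉ Ioo (dualGrid N N j) (dualGrid N N (j + 1)) := by
  obtain ⟨i₀, hi₀, hl, hr⟩ := dualGrid_nested hn le_rfl hj
  have G := isGrid_dual hn
  intro hc
  rcases le_or_gt i i₀ with h | h
  · exact absurd hc.1 (not_lt.2 ((G.mono h hi₀.le).trans hl))
  · exact absurd hc.2 (not_lt.2 (hr.trans (G.mono h hi)))

/-- Integration by parts on the cells: the test function vanishes at all grid points. -/
theorem kact_projKer_deriv {n : ℕ} (hn : n ≤ N) {j : ℕ} (hj : j < 2 ^ N + 1) {φ : ℝ → ℝ}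
    (hφ : IsTest (dualGrid N N j) (dualGrid N N (j + 1)) φ) (t : ℝ) :
    kact (projKer k (dualGrid n N) (2 ^ n + 1)) (deriv φ) t =
      -kact (derivKer k (dualGrid n N) (2 ^ n + 1)) φ t := by
  have G := isGrid_dual hn
  by_cases ht : t ∈ Ico (0 : ℝ) 1
  · obtain ⟨i, hi, hti⟩ := G.exists_cell ht
    have hz : ∀ i ≤ 2 ^ n + 1, φ (dualGrid n N i) = 0 := fun i hi =>
      hφ.eq_zero (dualGrid_notMem_Ioo hn hi hj)
    rw [projKer, derivKer, kact_cellKer G _ _ hi hti, kact_cellKer G _ _ hi hti,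
      intervalIntegral.integral_mul_deriv_eq_deriv_mul
        (fun x _ => hasDerivAt_polyKer k _ _ x t) (fun x _ => hφ.hasDerivAt x)
        (((continuous_polyKerDeriv k _ _).comp (by fun_prop : Continuous fun x : ℝ => (x, t))
          ).intervalIntegrable _ _)
        (hφ.deriv.smooth.continuous.intervalIntegrable _ _), hz _ hi, hz _ hi.le]
    simp
  · rw [projKer, derivKer, kact_cellKer_eq_zero G _ _ ht, kact_cellKer_eq_zero G _ _ ht, neg_zero]

/-- `g` is the derivative of `f` in the coordinate `m` on the cells of the finest dual mesh, tested
by tensor products that are smooth in this coordinate. -/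
def CellPair (N : ℕ) (m : Fin d) (f g : L2Cube d) : Prop :=
  ∀ φ : Fin d → ℝ → ℝ, (∀ i, BddMeas (φ i)) → ∀ j < 2 ^ N + 1,
    IsTest (dualGrid N N j) (dualGrid N N (j + 1)) (φ m) →
      pr f (Function.update φ m (deriv (φ m))) = -pr g φ

theorem CellPair.add {m : Fin d} {f g f' g' : L2Cube d} (h : CellPair N m f g)
    (h' : CellPair N m f' g') : CellPair N m (f + f') (g + g') := fun φ hφ j hj ht => by
  rw [pr_add, pr_add, h φ hφ j hj ht, h' φ hφ j hj ht, neg_add]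

theorem CellPair.sub {m : Fin d} {f g f' g' : L2Cube d} (h : CellPair N m f g)
    (h' : CellPair N m f' g') : CellPair N m (f - f') (g - g') := fun φ hφ j hj ht => by
  rw [pr_sub, pr_sub, h φ hφ j hj ht, h' φ hφ j hj ht]; ring

theorem CellPair.sum {m : Fin d} {ι : Type*} {s : Finset ι} {f g : ι → L2Cube d}
    (h : ∀ a ∈ s, CellPair N m (f a) (g a)) : CellPair N m (∑ a ∈ s, f a) (∑ a ∈ s, g a) :=
  fun φ hφ j hj ht => by
    rw [pr_sum, pr_sum, ← Finset.sum_neg_distrib]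
    exact Finset.sum_congr rfl fun a ha => h a ha φ hφ j hj ht

theorem CellPair.apply {m i : Fin d} (him : i ≠ m) {f g : L2Cube d} (h : CellPair N m f g)
    {A : L2Cube d →L[ℝ] L2Cube d} {a : (ℝ → ℝ) → ℝ → ℝ} (hA : Acts i A a) :
    CellPair N m (A f) (A g) := fun φ hφ j hj ht => by
  rw [hA.pr_eq _ _ (BddMeas.forall_update hφ m ht.deriv.bddMeas), hA.pr_eq _ _ hφ,
    Function.update_of_ne him, Function.update_comm him.symm]
  have h1 := h (Function.update φ i (a (φ i))) (BddMeas.forall_update hφ i (hA.bdd _ (hφ i))) j hj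
  rw [Function.update_of_ne him.symm] at h1
  exact h1 ht

/-- A weak derivative on the cube is one on the cells, also for tensor products whose other factors
are only bounded and measurable. -/
theorem WeakPair.cellPair {m : Fin d} {v w : L2Cube d} (hw : WeakPair m v w) :
    CellPair N m v w := fun φ hφ j hj ht => by
  have G := isGrid_dual (le_refl N)
  have ht' : IsTest 0 1 (φ m) := ht.mono (G.nonneg hj.le) (G.le_one hj)
  have hi : ∀ t, ∫ x in (0 : ℝ)..t, deriv (φ m) x = φ m t := fun t => by
    rw [intervalIntegral.integral_eq_sub_of_hasDerivAt (fun x _ => ht'.hasDerivAt x)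
      (ht'.deriv.smooth.continuous.intervalIntegrable _ _), ht'.eq_zero (t := 0) (by simp), sub_zero]
  have h0 : ∫ x in (0 : ℝ)..1, deriv (φ m) x = 0 := by rw [hi, ht'.eq_zero (by simp)]
  rw [hw.pr_unit hφ ht'.deriv.bddMeas h0, pr_update_congr w hφ m
    ((schurKernel_antiKer isGrid_unit).bddMeas_kact ht'.deriv.bddMeas) ht'.bddMeas,
    Function.update_eq_self]
  intro t ht
  rw [← (cellOrth_unit h0).integral_eq_anti isGrid_unit ht'.deriv.bddMeas (Ioo_subset_Ico_self ht),
    hi]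

theorem cellPair_dualProj {m : Fin d} {n : ℕ} (hn : n ≤ N) (v : L2Cube d) :
    CellPair N m (dualProj k N n m v) (dualDeriv k N n m v) := fun φ hφ j hj ht => by
  have hP := acts_dualProj k hn m
  have hD := acts_dualDeriv k hn m
  have hz : BddMeas fun _ => (0 : ℝ) := BddMeas.zero
  rw [hP.pr_eq _ _ (BddMeas.forall_update hφ m ht.deriv.bddMeas), hD.pr_eq _ _ hφ,
    Function.update_self, Function.update_idem]
  have h1 := pr_update_sub v hφ m hz (hD.bdd _ (hφ m))
  have h2 := pr_update_sub v hφ m hz hz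
  have h3 : kact (projKer k (dualGrid n N) (2 ^ n + 1)) (deriv (φ m)) =
      fun t => 0 - kact (derivKer k (dualGrid n N) (2 ^ n + 1)) (φ m) t := by
    funext t
    rw [kact_projKer_deriv hn hj ht, zero_sub]
  simp only [sub_self] at h2
  rw [h3, h1, h2, zero_sub]

/-- The operators in the other coordinates commute with the derivative in the coordinate `m`. -/
theorem cellPair_sparseErr {m : Fin d} {v w : L2Cube d} (hw : WeakPair m v w) {s : List (Fin d)}
    (hms : m ∉ s) {n : ℕ} (hn : n ≤ N) :
    CellPair N m (sparseErr k N (s ++ [m]) n v) (sparseErrDeriv k N m s n v w) := by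
  induction s generalizing n with
  | nil =>
    have : sparseErr k N ([] ++ [m]) n v = v - dualProj k N n m v := by
      simp [sparseErr]
    rw [this, sparseErrDeriv]
    exact hw.cellPair.sub (cellPair_dualProj hn v)
  | cons i s ih =>
    have him : i ≠ m := fun h => hms (h ▸ List.mem_cons_self)
    have hms' : m ∉ s := fun h => hms (List.mem_cons_of_mem _ h)
    simp only [List.cons_append, sparseErr, sparseErrDeriv, add_apply, sum_apply, mul_apply_eq_comp]
    refine (hw.cellPair.apply him ((Acts.one i).sub (acts_dualProj k hn i))).add
      (CellPair.sum fun a ha => ?_)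
    have ha := Finset.mem_range.1 ha
    obtain ⟨c, hc⟩ := exists_acts_dualIncr k (show a ≤ N by omega) i
    exact (ih hms' (by omega)).apply him hc

end CellDeriv

/-! ### Weak derivatives on open sets -/

section WeakDeriv

variable {d : ℕ}

theorem differentiable_tens {φ : Fin d → ℝ → ℝ} (hφ : ∀ i, Differentiable ℝ (φ i)) :
    Differentiable ℝ (tens φ) := by
  unfold tens
  fun_prop

theorem contDiff_tens {φ : Fin d → ℝ → ℝ} (hφ : ∀ i, ContDiff ℝ ∞ (φ i)) :
    ContDiff ℝ ∞ (tens φ) :=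
  contDiff_prod fun i _ => (hφ i).comp (contDiff_apply ℝ ℝ i)

theorem partialDeriv_tens {φ : Fin d → ℝ → ℝ} (hφ : ∀ i, Differentiable ℝ (φ i)) (i : Fin d) :
    partialDeriv i (tens φ) = tens (Function.update φ i (deriv (φ i))) := by
  funext x
  rw [partialDeriv, ← (differentiable_tens hφ x).lineDeriv_eq_fderiv, tens_update, lineDeriv]
  have h1 : (fun t : ℝ => tens φ (x + t • Pi.single i 1)) =
      fun t => φ i (x i + t) * ∏ j ∈ Finset.univ.erase i, φ j (x j) := by
    funext t
    rw [← tens_apply_update]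
    congr 1
    funext j
    by_cases h : j = i
    · subst h; simp
    · simp [h]
  rw [h1, deriv_mul_const_field, deriv_comp_const_add, add_zero]

theorem iterate_partialDeriv_tens {φ : Fin d → ℝ → ℝ} (hφ : ∀ i, ContDiff ℝ ∞ (φ i)) (i : Fin d)
    (n : ℕ) : (partialDeriv i)^[n] (tens φ) = tens (Function.update φ i (deriv^[n] (φ i))) := by
  induction n generalizing φ with
  | zero => simp
  | succ n ih =>
    have h1 : ∀ j, ContDiff ℝ ∞ (Function.update φ i (deriv (φ i)) j) := fun j => by
      by_cases h : j = i
      · subst h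
        rw [Function.update_self]
        exact (contDiff_infty_iff_deriv.1 (hφ j)).2
      · rw [Function.update_of_ne h]; exact hφ j
    rw [Function.iterate_succ_apply, Function.iterate_succ_apply,
      partialDeriv_tens (fun j => (hφ j).differentiable (by simp)), ih h1, Function.update_self,
      Function.update_idem]

theorem contDiff_iterate_deriv {φ : ℝ → ℝ} (hφ : ContDiff ℝ ∞ φ) (n : ℕ) :
    ContDiff ℝ ∞ (deriv^[n] φ) := by
  induction n generalizing φ with
  | zero => exact hφ
  | succ n ih => exact ih (contDiff_infty_iff_deriv.1 hφ).2

theorem multiDeriv_tens {φ : Fin d → ℝ → ℝ} (hφ : ∀ i, ContDiff ℝ ∞ (φ i)) (α : Fin d → ℕ) :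
    multiDeriv α (tens φ) = tens fun i => deriv^[α i] (φ i) := by
  have key : ∀ s : List (Fin d), s.Nodup →
      s.foldr (fun i g => (partialDeriv i)^[α i] g) (tens φ) =
        tens fun i => if i ∈ s then deriv^[α i] (φ i) else φ i := by
    intro s
    induction s with
    | nil => intro; simp
    | cons i s ih =>
      intro hs
      have his : i ∉ s := (List.nodup_cons.1 hs).1
      rw [List.foldr_cons, ih (List.nodup_cons.1 hs).2, iterate_partialDeriv_tens fun j => by
        by_cases h : j ∈ s
        · simp only [h, if_true]; exact contDiff_iterate_deriv (hφ j) _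
        · simp only [h, if_false]; exact hφ j]
      congr 1
      funext j
      by_cases h : j = i
      · subst h
        simp [his]
      · rw [Function.update_of_ne h]
        simp [h]
  rw [multiDeriv, key _ (List.nodup_finRange d)]
  simp

theorem multiDeriv_zero (f : (Fin d → ℝ) → ℝ) : multiDeriv 0 f = f := by
  unfold multiDeriv
  induction List.finRange d with
  | nil => rfl
  | cons i s ih => rw [List.foldr_cons, ih]; rfl

theorem multiDeriv_single (m : Fin d) (f : (Fin d → ℝ) → ℝ) :
    multiDeriv (Pi.single m 1) f = partialDeriv m f := by
  have key : ∀ s : List (Fin d), s.Nodup →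
      s.foldr (fun i g => (partialDeriv i)^[(Pi.single m 1 : Fin d → ℕ) i] g) f =
        if m ∈ s then partialDeriv m f else f := by
    intro s
    induction s with
    | nil => intro; simp
    | cons i s ih =>
      intro hs
      have his : i ∉ s := (List.nodup_cons.1 hs).1
      rw [List.foldr_cons, ih (List.nodup_cons.1 hs).2]
      by_cases h : i = m
      · subst h
        simp [his]
      · simp [h, Ne.symm h]
  rw [multiDeriv, key _ (List.nodup_finRange d)]
  simp

theorem tsupport_tens_subset (φ : Fin d → ℝ → ℝ) :
    tsupport (tens φ) ⊆ univ.pi fun i => tsupport (φ i) := by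
  refine closure_minimal (fun x hx i _ => subset_tsupport _ fun hc => hx ?_)
    (isClosed_set_pi fun i _ => isClosed_tsupport _)
  exact Finset.prod_eq_zero (Finset.mem_univ i) hc

theorem hasCompactSupport_tens {a b : Fin d → ℝ} {φ : Fin d → ℝ → ℝ}
    (hφ : ∀ i, IsTest (a i) (b i) (φ i)) : HasCompactSupport (tens φ) :=
  (isCompact_univ_pi fun i => (hφ i).compact).of_isClosed_subset (isClosed_tsupport _)
    (tsupport_tens_subset φ)

theorem tsupport_tens_subset_box {a b : Fin d → ℝ} {φ : Fin d → ℝ → ℝ}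
    (hφ : ∀ i, IsTest (a i) (b i) (φ i)) :
    tsupport (tens φ) ⊆ univ.pi fun i => Ioo (a i) (b i) :=
  (tsupport_tens_subset φ).trans (pi_mono fun i _ => (hφ i).supp)

theorem integrableOn_mul_of_hasCompactSupport {U : Set (Fin d → ℝ)} {f ψ : (Fin d → ℝ) → ℝ}
    (hf : LocallyIntegrableOn f U) (hψ : Continuous ψ) (hc : HasCompactSupport ψ)
    (hs : tsupport ψ ⊆ U) : IntegrableOn (fun x => f x * ψ x) U := by
  have h1 := (hf.integrableOn_compact_subset hs hc).mul_continuousOn hψ.continuousOn hc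
  refine ((integrableOn_iff_integrable_of_support_subset fun x hx => ?_).1 h1).integrableOn
  exact subset_tsupport _ fun h => hx (by simp [h])

theorem IsWeakDeriv.ae_eq {U : Set (Fin d → ℝ)} (hU : IsOpen U) {α : Fin d → ℕ}
    {v g g' : (Fin d → ℝ) → ℝ} (h : IsWeakDeriv U α v g) (h' : IsWeakDeriv U α v g') :
    g =ᵐ[volume.restrict U] g' := by
  have h0 := hU.ae_eq_zero_of_integral_contDiff_smul_eq_zero (μ := volume)
    (h.locallyIntegrableOn_deriv.sub h'.locallyIntegrableOn_deriv) fun φ hφ hc hs => by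
      have hint : ∀ f, LocallyIntegrableOn f U → IntegrableOn (fun x => f x * φ x) U :=
        fun f hf => integrableOn_mul_of_hasCompactSupport hf hφ.continuous hc hs
      have hz : ∀ x ∉ U, φ x • (g - g') x = 0 := fun x hx => by
        rw [image_eq_zero_of_notMem_tsupport fun hc => hx (hs hc), zero_smul]
      rw [← setIntegral_eq_integral_of_forall_compl_eq_zero hz]
      have h1 : ∀ x, φ x • (g - g') x = g x * φ x - g' x * φ x := fun x => by
        simp only [Pi.sub_apply, smul_eq_mul]; ring
      simp only [h1]
      rw [integral_sub (hint g h.locallyIntegrableOn_deriv) (hint g' h'.locallyIntegrableOn_deriv),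
        sub_eq_zero]
      have h2 := (h.integral_eq φ hφ hc hs).symm.trans (h'.integral_eq φ hφ hc hs)
      exact mul_left_cancel₀ (pow_ne_zero _ (by norm_num)) h2
  filter_upwards [(ae_restrict_iff' hU.measurableSet).2 h0] with x hx
  rwa [Pi.sub_apply, sub_eq_zero] at hx

theorem derivNorm_eq {U : Set (Fin d → ℝ)} (hU : IsOpen U) {α : Fin d → ℕ}
    {v g : (Fin d → ℝ) → ℝ} (h : IsWeakDeriv U α v g) :
    derivNorm U α v = eLpNorm g 2 (volume.restrict U) :=
  le_antisymm (iInf₂_le g h) (le_iInf₂ fun _ h' => (eLpNorm_congr_ae (h.ae_eq hU h')).le)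

theorem isWeakDeriv_zero {U : Set (Fin d → ℝ)} {v : (Fin d → ℝ) → ℝ}
    (hv : LocallyIntegrableOn v U) : IsWeakDeriv U 0 v v :=
  ⟨hv, hv, fun φ _ _ _ => by rw [multiDeriv_zero]; simp⟩

theorem tsupport_partialDeriv_subset (m : Fin d) (φ : (Fin d → ℝ) → ℝ) :
    tsupport (partialDeriv m φ) ⊆ tsupport φ := tsupport_fderiv_apply_subset ℝ _

theorem continuous_partialDeriv (m : Fin d) {φ : (Fin d → ℝ) → ℝ} (hφ : ContDiff ℝ ∞ φ) :
    Continuous (partialDeriv m φ) :=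
  (hφ.continuous_fderiv (by simp)).clm_apply continuous_const

/-- First weak derivatives restrict to smaller open sets. -/
theorem IsWeakDeriv.mono_single {U V : Set (Fin d → ℝ)} (hVU : V ⊆ U) {m : Fin d}
    {v g : (Fin d → ℝ) → ℝ} (h : IsWeakDeriv U (Pi.single m 1) v g) :
    IsWeakDeriv V (Pi.single m 1) v g := by
  refine ⟨h.locallyIntegrableOn.mono_set hVU, h.locallyIntegrableOn_deriv.mono_set hVU,
    fun φ hφ hc hs => ?_⟩
  have h1 := h.integral_eq φ hφ hc (hs.trans hVU)
  rw [multiDeriv_single] at h1 ⊢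
  have hz : ∀ f ψ : (Fin d → ℝ) → ℝ, tsupport ψ ⊆ V →
      ∫ x in U, f x * ψ x = ∫ x in V, f x * ψ x := fun f ψ hψ => by
    have h2 : ∀ W, V ⊆ W → ∀ x ∉ W, f x * ψ x = 0 := fun W hW x hx => by
      rw [image_eq_zero_of_notMem_tsupport fun hc => hx (hW (hψ hc)), mul_zero]
    rw [setIntegral_eq_integral_of_forall_compl_eq_zero (h2 U hVU),
      setIntegral_eq_integral_of_forall_compl_eq_zero (h2 V subset_rfl)]
  rwa [hz v _ ((tsupport_partialDeriv_subset m φ).trans hs), hz g _ hs] at h1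

/-- A function that agrees with a smooth function on an open set has its classical derivatives as
weak derivatives there. -/
theorem isWeakDeriv_of_contDiff {U : Set (Fin d → ℝ)} (hU : IsOpen U) {f F : (Fin d → ℝ) → ℝ}
    (hF : ContDiff ℝ ∞ F) (hf : ∀ x ∈ U, f x = F x) (m : Fin d) :
    IsWeakDeriv U (Pi.single m 1) f (partialDeriv m F) := by
  have hF' := continuous_partialDeriv m hF
  have hfF : LocallyIntegrableOn f U := by
    rw [locallyIntegrableOn_iff hU.isLocallyClosed]
    exact fun K hKU hK => (hF.continuous.continuousOn.integrableOn_compact hK).congr_fun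
      (fun x hx => (hf x (hKU hx)).symm) hK.measurableSet
  refine ⟨hfF, (hF'.locallyIntegrable (μ := volume)).locallyIntegrableOn U, fun φ hφ hc hs => ?_⟩
  have hφ' := continuous_partialDeriv m hφ
  have hc' : HasCompactSupport (partialDeriv m φ) :=
    hc.of_isClosed_subset (isClosed_tsupport _) (tsupport_partialDeriv_subset m φ)
  rw [multiDeriv_single, setIntegral_congr_fun hU.measurableSet
    (g := fun x => F x * partialDeriv m φ x) fun x hx => by
      simp only [hf x hx]]
  rw [setIntegral_eq_integral_of_forall_compl_eq_zero fun x hx => by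
      rw [image_eq_zero_of_notMem_tsupport fun h => hx (hs (tsupport_partialDeriv_subset m φ h)),
        mul_zero],
    setIntegral_eq_integral_of_forall_compl_eq_zero fun x hx => by
      rw [image_eq_zero_of_notMem_tsupport fun h => hx (hs h), mul_zero]]
  have h1 := integral_mul_fderiv_eq_neg_fderiv_mul_of_integrable (𝕜 := ℝ) (f := F) (g := φ)
    (v := Pi.single m 1) (μ := volume)
    ((hF'.mul hφ.continuous).integrable_of_hasCompactSupport hc.mul_left)
    ((hF.continuous.mul hφ').integrable_of_hasCompactSupport hc'.mul_left)
    ((hF.continuous.mul hφ.continuous).integrable_of_hasCompactSupport hc.mul_left)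
    (fun _ _ => hF.differentiable (by simp) _) (fun _ _ => hφ.differentiable (by simp) _)
  rw [show (∑ i, (Pi.single m 1 : Fin d → ℕ) i) = 1 by simp, pow_one, neg_one_mul]
  exact h1

theorem IsWeakDeriv.sub {U : Set (Fin d → ℝ)} {m : Fin d}
    {v g v' g' : (Fin d → ℝ) → ℝ} (h : IsWeakDeriv U (Pi.single m 1) v g)
    (h' : IsWeakDeriv U (Pi.single m 1) v' g') :
    IsWeakDeriv U (Pi.single m 1) (v - v') (g - g') := by
  refine ⟨h.locallyIntegrableOn.sub h'.locallyIntegrableOn,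
    h.locallyIntegrableOn_deriv.sub h'.locallyIntegrableOn_deriv, fun φ hφ hc hs => ?_⟩
  have h1 := h.integral_eq φ hφ hc hs
  have h2 := h'.integral_eq φ hφ hc hs
  rw [multiDeriv_single] at h1 h2 ⊢
  have hs' := tsupport_partialDeriv_subset m φ
  have hφ' := continuous_partialDeriv m hφ
  have hc' : HasCompactSupport (partialDeriv m φ) := hc.of_isClosed_subset (isClosed_tsupport _) hs'
  simp only [Pi.sub_apply, sub_mul]
  rw [integral_sub (integrableOn_mul_of_hasCompactSupport h.locallyIntegrableOn hφ' hc' (hs'.trans hs))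
    (integrableOn_mul_of_hasCompactSupport h'.locallyIntegrableOn hφ' hc' (hs'.trans hs)),
    integral_sub (integrableOn_mul_of_hasCompactSupport h.locallyIntegrableOn_deriv hφ.continuous hc hs)
    (integrableOn_mul_of_hasCompactSupport h'.locallyIntegrableOn_deriv hφ.continuous hc hs), h1, h2]
  ring

end WeakDeriv

/-! ### The classes of the mixed weak derivatives -/

section Classes

variable {d : ℕ}

theorem isOpen_unitCube (d : ℕ) : IsOpen (unitCube d) :=
  isOpen_set_pi finite_univ fun _ _ => isOpen_Ioo

theorem integral_mu (F : (Fin d → ℝ) → ℝ) : ∫ x, F x ∂mu d = ∫ x in unitCube d, F x := by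
  rw [restrict_unitCube]

theorem ae_of_ae_mu {P : (Fin d → ℝ) → Prop} (h : ∀ᵐ x ∂mu d, P x) :
    ∀ᵐ x ∂volume.restrict (unitCube d), P x := by
  rwa [restrict_unitCube]

theorem ae_mu_of_ae {P : (Fin d → ℝ) → Prop} (h : ∀ᵐ x ∂volume.restrict (unitCube d), P x) :
    ∀ᵐ x ∂mu d, P x := by
  rwa [restrict_unitCube] at h

theorem integrableOn_L2Cube (f : L2Cube d) : IntegrableOn f (unitCube d) := by
  rw [IntegrableOn, restrict_unitCube]
  exact (Lp.memLp f).integrable one_le_two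

theorem IsWeakDeriv.congr_ae {U : Set (Fin d → ℝ)} {α : Fin d → ℕ} {v g g' : (Fin d → ℝ) → ℝ}
    (h : IsWeakDeriv U α v g) (hg : g =ᵐ[volume.restrict U] g') (hg' : LocallyIntegrableOn g' U) :
    IsWeakDeriv U α v g' :=
  ⟨h.locallyIntegrableOn, hg', fun φ hφ hc hs => by
    rw [h.integral_eq φ hφ hc hs]
    congr 1
    exact integral_congr_ae (hg.mono fun x hx => by simp only [hx])⟩

theorem MemMixedSobolev.mono {U : Set (Fin d → ℝ)} {r r' : ℕ} (h : r ≤ r')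
    {v : (Fin d → ℝ) → ℝ} (hv : MemMixedSobolev U r' v) : MemMixedSobolev U r v :=
  ⟨hv.1, fun α hα => hv.2 α fun i => (hα i).trans h⟩

theorem exists_deriv_classes {r : ℕ} {v : (Fin d → ℝ) → ℝ}
    (hv : MemMixedSobolev (unitCube d) r v) :
    ∃ G : (Fin d → ℕ) → L2Cube d, ∀ α, (∀ i, α i ≤ r) → IsWeakDeriv (unitCube d) α v (G α) := by
  have h : ∀ α : Fin d → ℕ, ∃ g : L2Cube d,
      (∀ i, α i ≤ r) → IsWeakDeriv (unitCube d) α v g := fun α => by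
    by_cases hα : ∀ i, α i ≤ r
    · obtain ⟨g, hg, hgL⟩ := hv.2 α hα
      rw [restrict_unitCube] at hgL
      refine ⟨hgL.toLp g, fun _ => hg.congr_ae ?_ (integrableOn_L2Cube _).locallyIntegrableOn⟩
      rw [restrict_unitCube]
      exact hgL.coeFn_toLp.symm
    · exact ⟨0, fun h => absurd h hα⟩
  choose G hG using h
  exact ⟨G, hG⟩

theorem isTest_update {a b : Fin d → ℝ} {φ : Fin d → ℝ → ℝ} (hφ : ∀ i, IsTest (a i) (b i) (φ i))
    (m i : Fin d) : IsTest (a i) (b i) (Function.update φ m (deriv (φ m)) i) := by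
  by_cases h : i = m
  · subst h; rw [Function.update_self]; exact (hφ i).deriv
  · rw [Function.update_of_ne h]; exact hφ i

theorem weakPair_of_isWeakDeriv {v : (Fin d → ℝ) → ℝ} {α : Fin d → ℕ} {m : Fin d}
    {f g : L2Cube d} (hf : IsWeakDeriv (unitCube d) α v f)
    (hg : IsWeakDeriv (unitCube d) (Function.update α m (α m + 1)) v g) : WeakPair m f g := by
  intro φ hφ
  have hψ := isTest_update hφ m
  have h1 := hf.integral_eq _ (contDiff_tens fun i => (hψ i).smooth) (hasCompactSupport_tens hψ)
    (tsupport_tens_subset_box hψ)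
  have h2 := hg.integral_eq _ (contDiff_tens fun i => (hφ i).smooth) (hasCompactSupport_tens hφ)
    (tsupport_tens_subset_box hφ)
  have h3 : multiDeriv α (tens (Function.update φ m (deriv (φ m)))) =
      multiDeriv (Function.update α m (α m + 1)) (tens φ) := by
    rw [multiDeriv_tens fun i => (hψ i).smooth, multiDeriv_tens fun i => (hφ i).smooth]
    congr 1
    funext i
    by_cases h : i = m
    · subst h
      rw [Function.update_self, Function.update_self, Function.iterate_succ_apply]
    · rw [Function.update_of_ne h, Function.update_of_ne h]
  have h4 : ∑ i, Function.update α m (α m + 1) i = ∑ i, α i + 1 := by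
    rw [Finset.sum_update_of_mem (Finset.mem_univ m),
      ← Finset.add_sum_erase _ α (Finset.mem_univ m), Finset.sdiff_singleton_eq_erase]
    omega
  rw [h3, h2, h4, pow_succ, mul_assoc] at h1
  have h5 := mul_left_cancel₀ (pow_ne_zero _ (by norm_num)) h1
  rw [pr_eq_integral _ fun i => (hψ i).bddMeas, pr_eq_integral _ fun i => (hφ i).bddMeas,
    integral_mu, integral_mu, ← h5]
  ring

/-- The multi-index equal to `r` on `L` and to zero elsewhere. -/
def cornerIndex (r : ℕ) (L : Finset (Fin d)) : Fin d → ℕ := fun i => if i ∈ L then r else 0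

theorem cornerIndex_empty (r : ℕ) : cornerIndex r (∅ : Finset (Fin d)) = 0 := by
  funext i; simp [cornerIndex]

theorem update_cornerIndex (r : ℕ) (L : Finset (Fin d)) (i : Fin d) :
    Function.update (cornerIndex r L) i r = cornerIndex r (insert i L) := by
  funext j
  by_cases h : j = i
  · subst h; simp [cornerIndex]
  · simp [cornerIndex, h]

theorem cornerIndex_le (r : ℕ) (L : Finset (Fin d)) (i : Fin d) : cornerIndex r L i ≤ r := by
  unfold cornerIndex; split_ifs <;> omega

theorem cornerIndex_of_notMem (r : ℕ) {L : Finset (Fin d)} {i : Fin d} (h : i ∉ L) :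
    cornerIndex r L i = 0 := if_neg h

theorem update_le {r c : ℕ} {α : Fin d → ℕ} (hα : ∀ i, α i ≤ r) (m : Fin d) (hc : c ≤ r)
    (i : Fin d) : Function.update α m c i ≤ r := by
  by_cases h : i = m
  · subst h; rwa [Function.update_self]
  · rw [Function.update_of_ne h]; exact hα i

/-- The estimates of the sparse projection error and of its cellwise derivatives for a family of
functions that are weak derivatives of each other. -/
theorem exists_sparseErr_bound (d k q : ℕ) (hq : q ≤ k) : ∃ C : ℝ, 0 ≤ C ∧ ∀ (N : ℕ)
    (G : (Fin d → ℕ) → L2Cube d), (∀ α m, (∀ i, α i ≤ q + 1) → α m < q + 1 →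
      WeakPair m (G α) (G (Function.update α m (α m + 1)))) →
    ∀ X : ℝ, 0 ≤ X → (∀ L : Finset (Fin d), L.Nonempty → ‖G (cornerIndex (q + 1) L)‖ ≤ X) →
      ‖sparseErr k N (List.finRange d) N (G 0)‖ ≤
          C * ((N : ℝ) + 1) ^ d * meshSize N ^ (q + 1) * X ∧
        ∀ m, ‖sparseErrDeriv k N m ((List.finRange d).erase m) N (G 0) (G (Pi.single m 1))‖ ≤
          C * meshSize N ^ q * X := by
  obtain ⟨c, hc0, hc⟩ := exists_interpolation_const d k
  have hS := schurConst_nonneg k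
  have hC0 := errConst_nonneg k (q + 1) d
  have hC1 := errDerivConst_nonneg k (q + 1) (d - 1)
  -- `2 * c` bounds the mixed first derivatives, the rest is the one-dimensional approximation
  set K : ℝ := 2 * c + (1 + schurConst k) with hK
  have hK0 : 0 ≤ K := by positivity
  refine ⟨errConst k (q + 1) d + errDerivConst k (q + 1) (d - 1) * K, by positivity,
    fun N G hG X hX0 hX => ?_⟩
  have hmesh : ∀ r, 0 ≤ meshSize N ^ r := fun r => pow_nonneg (meshSize_pos N).le r
  have hchain : ∀ α m, (∀ i, α i ≤ q + 1) → ∀ j < q + 1,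
      WeakPair m (G (Function.update α m j)) (G (Function.update α m (j + 1))) := by
    intro α m hα j hj
    have h1 := hG (Function.update α m j) m (update_le hα m hj.le) (by rwa [Function.update_self])
    rwa [Function.update_self, Function.update_idem] at h1
  have herr : ∀ α i, (∀ i, α i ≤ q + 1) → α i = 0 →
      ErrFrom k (q + 1) N i (G α) (G (Function.update α i (q + 1))) := by
    intro α i hα h0 n hn
    have h1 := one_sub_proj_apply (k := k) (Nat.succ_le_succ hq) (isGrid_dual hn)
      (w := fun j => G (Function.update α i j)) (hchain α i hα)
    rw [← h0, Function.update_eq_self] at h1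
    exact h1
  constructor
  · have h1 := norm_sparseErr_le (k := k) (N := N) (r := q + 1)
      (g := fun L => G (cornerIndex (q + 1) L)) (fun L i hi => by
        have h2 := herr _ i (cornerIndex_le (q + 1) L) (cornerIndex_of_notMem _ hi)
        rwa [update_cornerIndex] at h2) hX hX0 (List.nodup_finRange d) le_rfl ∅ (by simp)
    rw [cornerIndex_empty, List.length_finRange] at h1
    refine h1.trans ?_
    have h3 : 0 ≤ errDerivConst k (q + 1) (d - 1) * K := mul_nonneg hC1 hK0
    have := hmesh (q + 1)
    gcongr
    linarith
  · intro m
    have h0 : ∀ L : Finset (Fin d), m ∉ L →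
        Function.update (cornerIndex (q + 1) L) m 0 = cornerIndex (q + 1) L := fun L hL => by
      rw [← cornerIndex_of_notMem (q + 1) hL, Function.update_eq_self]
    have hXm : ∀ L : Finset (Fin d), L.Nonempty → m ∉ L →
        ‖G (Function.update (cornerIndex (q + 1) L) m 1)‖ ≤ K * X := fun L hL hmL => by
      have h1 := hc q m (fun j => G (Function.update (cornerIndex (q + 1) L) m j)) hq
        (hchain _ m (cornerIndex_le _ L))
      rw [h0 L hmL, update_cornerIndex] at h1
      refine h1.trans ?_
      have h2 := mul_le_mul_of_nonneg_left (add_le_add (hX L hL)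
        (hX (insert m L) (Finset.insert_nonempty m L))) hc0
      have h3 : 0 ≤ (1 + schurConst k) * X := by positivity
      rw [hK]
      linarith
    have hbase : ∀ L : Finset (Fin d), m ∉ L → ∀ n ≤ N,
        ‖G (Function.update (cornerIndex (q + 1) L) m 1) -
          dualDeriv k N n m (G (cornerIndex (q + 1) L))‖ ≤ meshSize n ^ q * (K * X) := by
      intro L hmL n hn
      have h1 := norm_sub_deriv_proj_le hq (isGrid_dual hn)
        (w := fun j => G (Function.update (cornerIndex (q + 1) L) m j))
        (hchain _ m (cornerIndex_le _ L))
      rw [h0 L hmL, update_cornerIndex] at h1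
      refine h1.trans ?_
      have h4 : 0 ≤ meshSize n ^ q := pow_nonneg (meshSize_pos n).le q
      have h5 := mul_le_mul (show 1 + schurConst k ≤ K by rw [hK]; linarith)
        (hX (insert m L) (Finset.insert_nonempty m L)) (norm_nonneg _) hK0
      have h6 := mul_le_mul_of_nonneg_left h5 h4
      linarith
    have hms : m ∉ (List.finRange d).erase m := (List.nodup_finRange d).not_mem_erase
    have hlen : ((List.finRange d).erase m).length = d - 1 := by
      rw [List.length_erase_of_mem (List.mem_finRange m), List.length_finRange]
    have h1 := norm_sparseErrDeriv_le (k := k) (N := N) (q := q) (m := m)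
      (g := fun L => G (cornerIndex (q + 1) L))
      (w := fun L => G (Function.update (cornerIndex (q + 1) L) m 1)) (fun L i hi _ => by
        have h2 := herr _ i (cornerIndex_le (q + 1) L) (cornerIndex_of_notMem _ hi)
        rwa [update_cornerIndex] at h2) (fun L i hi him => by
        have h2 := herr _ i (update_le (cornerIndex_le (q + 1) L) m (show 1 ≤ q + 1 by omega))
          (by rw [Function.update_of_ne him]; exact cornerIndex_of_notMem _ hi)
        rwa [Function.update_comm him.symm, update_cornerIndex] at h2)
      (mul_nonneg hK0 hX0) hXm hbase ((List.nodup_finRange d).erase m) hms le_rfl ∅ (by simp)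
      (by simp)
    rw [hlen, cornerIndex_empty] at h1
    refine h1.trans ?_
    have h3 : 0 ≤ errConst k (q + 1) d * meshSize N ^ q * X :=
      mul_nonneg (mul_nonneg hC0 (hmesh q)) hX0
    linarith

end Classes

/-! ### The cells of the dual mesh -/

section Cells

variable {d N : ℕ}

theorem isOpen_dualCell (j : Fin d → Fin (2 ^ N + 1)) : IsOpen (dualCell N j) :=
  isOpen_set_pi finite_univ fun _ _ => isOpen_Ioo

theorem dualCell_subset (j : Fin d → Fin (2 ^ N + 1)) : dualCell N j ⊆ unitCube d :=
  pi_mono fun i _ => Ioo_subset_Ioo ((isGrid_dual le_rfl).nonneg (j i).2.le)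
    ((isGrid_dual le_rfl).le_one (j i).2)

theorem disjoint_dualCell {i j : Fin d → Fin (2 ^ N + 1)} (hij : i ≠ j) :
    Disjoint (dualCell N i) (dualCell N j) := by
  rw [Set.disjoint_left]
  intro x hi hj
  refine hij (funext fun a => Fin.ext ?_)
  exact grid_cell_unique (isGrid_dual (le_refl N)).lt (i a).2 (j a).2
    (Ioo_subset_Ico_self (hi a (mem_univ a))) (Ioo_subset_Ico_self (hj a (mem_univ a)))

theorem sq_eLpNorm_two {μ : Measure (Fin d → ℝ)} (f : (Fin d → ℝ) → ℝ) :
    eLpNorm f 2 μ ^ 2 = ∫⁻ x, ‖f x‖ₑ ^ 2 ∂μ := by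
  rw [eLpNorm_eq_lintegral_rpow_enorm_toReal two_ne_zero ENNReal.ofNat_ne_top,
    ← ENNReal.rpow_natCast, ← ENNReal.rpow_mul]
  simp

theorem sum_sq_eLpNorm_dualCell_le (f : L2Cube d) :
    ∑ j : Fin d → Fin (2 ^ N + 1), eLpNorm f 2 (volume.restrict (dualCell N j)) ^ 2 ≤
      ENNReal.ofReal ‖f‖ ^ 2 := by
  have h1 : ENNReal.ofReal ‖f‖ = eLpNorm f 2 (volume.restrict (unitCube d)) := by
    rw [Lp.norm_def, ENNReal.ofReal_toReal (Lp.eLpNorm_ne_top f), restrict_unitCube]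
  rw [h1, sq_eLpNorm_two]
  simp only [sq_eLpNorm_two]
  rw [← lintegral_biUnion_finset (fun i _ j _ hij => disjoint_dualCell hij)
    fun j _ => (isOpen_dualCell j).measurableSet]
  exact lintegral_mono_set (iUnion₂_subset fun j _ => dualCell_subset j)

theorem setIntegral_dualCell_mul_tens (f : L2Cube d) {j : Fin d → Fin (2 ^ N + 1)}
    {φ : Fin d → ℝ → ℝ}
    (hφ : ∀ i, IsTest (dualGrid N N (j i)) (dualGrid N N (j i + 1)) (φ i)) :
    ∫ x in dualCell N j, f x * tens φ x = pr f φ := by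
  rw [pr_eq_integral f fun i => (hφ i).bddMeas, integral_mu]
  have h : ∀ W, dualCell N j ⊆ W → ∀ x ∉ W, f x * tens φ x = 0 := fun W hW x hx => by
    rw [image_eq_zero_of_notMem_tsupport fun hc => hx (hW (tsupport_tens_subset_box hφ hc)),
      mul_zero]
  rw [setIntegral_eq_integral_of_forall_compl_eq_zero (h _ subset_rfl),
    setIntegral_eq_integral_of_forall_compl_eq_zero (h _ (dualCell_subset j))]

/-- A weak derivative on a cell is determined by tensor products of test functions. -/
theorem CellPair.isWeakDeriv {m : Fin d} {f g : L2Cube d} (hfg : CellPair N m f g)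
    {j : Fin d → Fin (2 ^ N + 1)} {w g₀ : (Fin d → ℝ) → ℝ} (hw : f =ᵐ[mu d] w)
    (h : IsWeakDeriv (dualCell N j) (Pi.single m 1) w g₀)
    (hg₀ : IntegrableOn g₀ (dualCell N j)) :
    IsWeakDeriv (dualCell N j) (Pi.single m 1) w g := by
  have hg := (integrableOn_L2Cube g).mono_set (dualCell_subset j)
  refine h.congr_ae ?_ hg.locallyIntegrableOn
  have hcell : ∀ᵐ x ∂volume.restrict (dualCell N j), f x = w x :=
    ae_restrict_of_ae_restrict_of_subset (dualCell_subset j) (ae_of_ae_mu hw)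
  have h1 := ae_eq_zero_of_forall_tens (a := fun i => dualGrid N N (j i))
    (b := fun i => dualGrid N N (j i + 1)) (f := fun x => g₀ x - g x) (hg₀.sub hg) fun φ hφ => by
      have hψ := isTest_update hφ m
      have hsm := contDiff_tens fun i => (hφ i).smooth
      have hcs := hasCompactSupport_tens hφ
      have hts := tsupport_tens_subset_box hφ
      have h2 := h.integral_eq _ hsm hcs hts
      rw [multiDeriv_single, partialDeriv_tens fun i => (hφ i).smooth.differentiable (by simp),
        show (∑ i, (Pi.single m 1 : Fin d → ℕ) i) = 1 by simp, pow_one, neg_one_mul] at h2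
      have h3 : ∫ x in dualCell N j, w x * tens (Function.update φ m (deriv (φ m))) x =
          ∫ x in dualCell N j, f x * tens (Function.update φ m (deriv (φ m))) x :=
        integral_congr_ae (hcell.mono fun x hx => by simp only [hx])
      rw [h3, setIntegral_dualCell_mul_tens f hψ,
        hfg φ (fun i => (hφ i).bddMeas) (j m) (j m).2 (hφ m), neg_inj,
        ← setIntegral_dualCell_mul_tens g hφ] at h2
      simp only [sub_mul]
      have h4 := integrableOn_mul_of_hasCompactSupport hg₀.locallyIntegrableOn hsm.continuous hcs hts
      have h5 := integrableOn_mul_of_hasCompactSupport hg.locallyIntegrableOn hsm.continuous hcs hts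
      refine (integral_sub h4 h5).trans (sub_eq_zero.2 h2.symm)
  exact h1.mono fun x hx => sub_eq_zero.1 hx

theorem dualCell_subset_compact (j : Fin d → Fin (2 ^ N + 1)) :
    dualCell N j ⊆ univ.pi fun i => Icc (dualGrid N N (j i)) (dualGrid N N (j i + 1)) :=
  pi_mono fun _ _ => Ioo_subset_Icc_self

theorem integrableOn_dualCell_of_continuous {F : (Fin d → ℝ) → ℝ} (hF : Continuous F)
    (j : Fin d → Fin (2 ^ N + 1)) : IntegrableOn F (dualCell N j) :=
  (hF.continuousOn.integrableOn_compact (isCompact_univ_pi fun _ => isCompact_Icc)).mono_set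
    (dualCell_subset_compact j)

/-- The elements of the sparse space are smooth on the cells of the finest dual mesh. -/
theorem exists_contDiff_of_mem_sparseSpace {k : ℕ} {u : (Fin d → ℝ) → ℝ}
    (hu : u ∈ sparseSpace d k N) (j : Fin d → Fin (2 ^ N + 1)) :
    ∃ F : (Fin d → ℝ) → ℝ, ContDiff ℝ ∞ F ∧ ∀ x ∈ dualCell N j, u x = F x := by
  rw [sparseSpace_eq_span] at hu
  induction hu using Submodule.span_induction with
  | mem u hu =>
    obtain ⟨l, φ, hl, hφ, rfl⟩ := hu
    choose P hP hPφ using fun i =>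
      (dualV_mono (le_of_sum_le hl i) le_rfl (hφ i)).1 (j i) (j i).2
    refine ⟨tens fun i x => (P i).eval x, contDiff_tens fun i => by simpa using (P i).contDiff_aeval (R := ℝ) (𝕜 := ℝ) ∞, fun x hx => ?_⟩
    exact Finset.prod_congr rfl fun i _ => hPφ i _ (Ioo_subset_Ico_self (hx i (mem_univ i)))
  | zero => exact ⟨fun _ => 0, contDiff_const, fun _ _ => rfl⟩
  | add u w _ _ hu hw =>
    obtain ⟨F, hF, hFu⟩ := hu
    obtain ⟨H, hH, hHw⟩ := hw
    exact ⟨F + H, hF.add hH, fun x hx => by rw [Pi.add_apply, Pi.add_apply, hFu x hx, hHw x hx]⟩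
  | smul c u _ hu =>
    obtain ⟨F, hF, hFu⟩ := hu
    exact ⟨c • F, contDiff_const.smul hF, fun x hx => by
      rw [Pi.smul_apply, Pi.smul_apply, hFu x hx]⟩

end Cells

/-! ### The projection onto the sparse space -/

section Projection

variable {d k N : ℕ}

theorem inner_eq_integral (f g : L2Cube d) {f' g' : (Fin d → ℝ) → ℝ} (hf : f =ᵐ[mu d] f')
    (hg : g =ᵐ[mu d] g') : inner ℝ f g = ∫ x in unitCube d, f' x * g' x := by
  rw [L2.inner_def, ← integral_mu]
  apply integral_congr_ae
  filter_upwards [hf, hg] with x hx hy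
  rw [hx, hy]; simp [mul_comm]

theorem exists_isL2Projection {v : (Fin d → ℝ) → ℝ} {V : L2Cube d} (hV : V =ᵐ[mu d] v) :
    ∃ u, IsL2Projection (unitCube d) (sparseSpace d k N) v u := by
  have := finiteDimensional_sparseLp d k N
  obtain ⟨u, hu, hPu⟩ := (sparseLp d k N).starProjection_apply_mem V
  refine ⟨u, hu, fun w hw => ?_⟩
  obtain ⟨f, hf, hfw⟩ := exists_class hw
  have h1 := (sparseLp d k N).starProjection_inner_eq_zero V f hf
  have h2 := (Lp.coeFn_sub V ((sparseLp d k N).starProjection V)).trans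
    (hV.sub hPu)
  rw [inner_eq_integral _ _ h2 hfw] at h1
  rw [← neg_eq_zero, ← integral_neg, ← h1]
  congr 1; ext x
  simp only [Pi.sub_apply]; ring

/-- The class of a projection error solves the orthogonality relations in `L²`. -/
theorem IsL2Projection.exists_class {v u : (Fin d → ℝ) → ℝ} {V : L2Cube d} (hV : V =ᵐ[mu d] v)
    (hu : IsL2Projection (unitCube d) (sparseSpace d k N) v u) :
    ∃ f ∈ sparseLp d k N, f - V =ᵐ[mu d] u - v ∧ ∀ w ∈ sparseLp d k N, inner ℝ (f - V) w = 0 := by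
  obtain ⟨f, hf, hfu⟩ := SparseDual.exists_class hu.1
  have h1 := (Lp.coeFn_sub f V).trans (hfu.sub hV)
  refine ⟨f, hf, h1, fun g hg => ?_⟩
  obtain ⟨w, hw, hgw⟩ := hg
  rw [inner_eq_integral _ _ h1 hgw]
  exact hu.2 w hw

theorem isWeakDeriv_dualCell {v u : (Fin d → ℝ) → ℝ} (hu : u ∈ sparseSpace d k N) {m : Fin d}
    {e V w : L2Cube d} (hV : IsWeakDeriv (unitCube d) 0 v V)
    (hw : IsWeakDeriv (unitCube d) (Pi.single m 1) v w)
    (he : e =ᵐ[mu d] u - v) (heV : e = -sparseErr k N ((List.finRange d).erase m ++ [m]) N V)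
    (j : Fin d → Fin (2 ^ N + 1)) :
    IsWeakDeriv (dualCell N j) (Pi.single m 1) (u - v)
      ((-sparseErrDeriv k N m ((List.finRange d).erase m) N V w : L2Cube d)) := by
  obtain ⟨F, hF, huF⟩ := exists_contDiff_of_mem_sparseSpace hu j
  have h1 := (isWeakDeriv_of_contDiff (isOpen_dualCell j) hF huF m).sub
    (hw.mono_single (dualCell_subset j))
  have h2 : WeakPair m V w := weakPair_of_isWeakDeriv hV hw
  have h3 := (cellPair_sparseErr (k := k) (N := N) h2 (List.nodup_finRange d).not_mem_erase
    le_rfl)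
  have h4 : CellPair N m e (-sparseErrDeriv k N m ((List.finRange d).erase m) N V w) := by
    intro φ hφ j hj ht
    rw [heV, pr_neg, pr_neg, h3 φ hφ j hj ht]
  exact h4.isWeakDeriv he h1 ((integrableOn_dualCell_of_continuous
    (continuous_partialDeriv m hF) j).sub ((integrableOn_L2Cube w).mono_set (dualCell_subset j)))

theorem sum_map_finRange (l : Fin d → ℕ) : ((List.finRange d).map l).sum = ∑ i, l i :=
  (Fin.sum_univ_def l).symm

theorem perm_erase_append (m : Fin d) :
    ((List.finRange d).erase m ++ [m]).Perm (List.finRange d) :=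
  (List.perm_append_singleton m _).trans (List.perm_cons_erase (List.mem_finRange m)).symm

theorem eq_single_of_sum_eq_one {α : Fin d → ℕ} (h : ∑ i, α i = 1) :
    ∃ m, α = Pi.single m 1 := by
  obtain ⟨m, hm⟩ : ∃ m, α m ≠ 0 := by
    by_contra hc
    push Not at hc
    simp [hc] at h
  have h1 := Finset.add_sum_erase Finset.univ α (Finset.mem_univ m)
  have h2 : ∑ i ∈ Finset.univ.erase m, α i = 0 := by omega
  refine ⟨m, funext fun i => ?_⟩
  by_cases hi : i = m
  · subst hi; rw [Pi.single_eq_same]; omega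
  · rw [Pi.single_eq_of_ne hi]
    exact Finset.sum_eq_zero_iff.1 h2 i (Finset.mem_erase.2 ⟨hi, Finset.mem_univ i⟩)

/-- The broken semi-norm is controlled by functions that represent the derivatives on all cells. -/
theorem brokenSeminorm_le {s : ℕ} {w : (Fin d → ℝ) → ℝ} {B : ℝ≥0∞}
    (h : ∀ α ∈ Finset.piAntidiag (Finset.univ : Finset (Fin d)) s, ∃ g : L2Cube d,
      ENNReal.ofReal ‖g‖ ≤ B ∧ ∀ j, IsWeakDeriv (dualCell N j) α w g) :
    brokenSeminorm N s w ≤ (Finset.piAntidiag (Finset.univ : Finset (Fin d)) s).card * B := by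
  set A := Finset.piAntidiag (Finset.univ : Finset (Fin d)) s
  have h1 : ∀ α ∈ A, ∑ j : Fin d → Fin (2 ^ N + 1), derivNorm (dualCell N j) α w ^ 2 ≤ B ^ 2 := by
    intro α hα
    obtain ⟨g, hg, hgw⟩ := h α hα
    refine le_trans (Finset.sum_le_sum fun j _ => ?_)
      ((sum_sq_eLpNorm_dualCell_le (N := N) g).trans (pow_le_pow_left' hg 2))
    rw [derivNorm_eq (isOpen_dualCell j) (hgw j)]
  rw [brokenSeminorm, Finset.sum_comm]
  have h2 : ∑ α ∈ A, ∑ j : Fin d → Fin (2 ^ N + 1), derivNorm (dualCell N j) α w ^ 2 ≤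
      (A.card * B) ^ 2 := by
    refine (Finset.sum_le_sum h1).trans ?_
    rw [Finset.sum_const, nsmul_eq_mul, mul_pow]
    gcongr
    exact_mod_cast Nat.le_self_pow two_ne_zero A.card
  refine (ENNReal.rpow_le_rpow h2 (by norm_num)).trans (le_of_eq ?_)
  rw [← ENNReal.rpow_natCast, ← ENNReal.rpow_mul]
  norm_num

/-- The largest norm of the derivatives in the mixed semi-norm. -/
theorem exists_bound_le_mixedSeminorm (hd : 0 < d) {r : ℕ} {v : (Fin d → ℝ) → ℝ}
    {G : (Fin d → ℕ) → L2Cube d}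
    (hG : ∀ α, (∀ i, α i ≤ r) → IsWeakDeriv (unitCube d) α v (G α)) :
    ∃ X : ℝ, 0 ≤ X ∧ (∀ L : Finset (Fin d), L.Nonempty → ‖G (cornerIndex r L)‖ ≤ X) ∧
      ENNReal.ofReal X ≤ mixedSeminorm (unitCube d) r v := by
  classical
  have hne : (Finset.univ.filter fun L : Finset (Fin d) => L.Nonempty).Nonempty :=
    ⟨{⟨0, hd⟩}, by simp⟩
  obtain ⟨L₀, hL₀, hmax⟩ := Finset.exists_max_image _ (fun L => ‖G (cornerIndex r L)‖) hne
  refine ⟨‖G (cornerIndex r L₀)‖, norm_nonneg _, fun L hL => hmax L (by simpa using hL), ?_⟩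
  have h1 : ENNReal.ofReal ‖G (cornerIndex r L₀)‖ =
      derivNorm (unitCube d) (cornerIndex r L₀) v := by
    rw [derivNorm_eq (isOpen_unitCube d) (hG _ (cornerIndex_le r L₀)), Lp.norm_def,
      ENNReal.ofReal_toReal (Lp.eLpNorm_ne_top _), restrict_unitCube]
  rw [h1]
  exact le_iSup₂ (f := fun (L : Finset (Fin d)) (_ : L.Nonempty) =>
    derivNorm (unitCube d) (fun i => if i ∈ L then r else 0) v) L₀ (by simpa using hL₀)

/-- The estimates for the projection, with a constant that depends on `d`, `k` and `q` only. -/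
theorem exists_projection_error_const {p q : ℕ} (hd : 0 < d) (hqp : q ≤ p) (hqk : q ≤ k) :
    ∃ C : ℝ, 0 < C ∧ ∀ N : ℕ, 1 ≤ N → ∀ v : (Fin d → ℝ) → ℝ,
      MemMixedSobolev (unitCube d) (p + 1) v →
      (∃ u : (Fin d → ℝ) → ℝ, IsL2Projection (unitCube d)
        (sparseSpace d k N) v u) ∧
      ∀ u : (Fin d → ℝ) → ℝ, IsL2Projection (unitCube d)
          (sparseSpace d k N) v u →
        brokenSeminorm N 0 (u - v) ≤
            ENNReal.ofReal (C * (N : ℝ) ^ d * (1 / 2 : ℝ) ^ (N * (q + 1))) *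
              mixedSeminorm (unitCube d) (q + 1) v ∧
        brokenSeminorm N 1 (u - v) ≤
            ENNReal.ofReal (C * (1 / 2 : ℝ) ^ (N * q)) *
              mixedSeminorm (unitCube d) (q + 1) v := by
  obtain ⟨C, hC0, hC⟩ := exists_sparseErr_bound d k q hqk
  let c : ℕ → ℕ := fun s => (Finset.piAntidiag (Finset.univ : Finset (Fin d)) s).card
  refine ⟨c 0 * (C * 2 ^ d) + c 1 * C + 1, by positivity, fun N hN v hv => ?_⟩
  obtain ⟨G, hG⟩ := exists_deriv_classes (hv.mono (Nat.succ_le_succ hqp))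
  have hG0 := hG 0 fun _ => Nat.zero_le _
  have hV : G 0 =ᵐ[mu d] v := by
    have h1 := hG0.ae_eq (isOpen_unitCube d) (isWeakDeriv_zero hG0.locallyIntegrableOn)
    exact ae_mu_of_ae h1
  refine ⟨exists_isL2Projection hV, fun u hu => ?_⟩
  obtain ⟨X, hX0, hX, hXv⟩ := exists_bound_le_mixedSeminorm (hd) hG
  have hpair : ∀ α m, (∀ i, α i ≤ q + 1) → α m < q + 1 →
      WeakPair m (G α) (G (Function.update α m (α m + 1))) := fun α m hα hm =>
    weakPair_of_isWeakDeriv (hG α hα) (hG _ (update_le hα m hm))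
  obtain ⟨hE, hD⟩ := hC N G hpair X hX0 hX
  obtain ⟨f, hf, hfuv, ho⟩ := hu.exists_class hV
  have hmesh : ∀ r, meshSize N ^ r = (1 / 2 : ℝ) ^ (N * r) := fun r => by
    rw [meshSize, pow_mul, one_div_pow 2 N]
  -- the number of multi-indices and the constants are absorbed in `C`
  have key : ∀ s B D : ℝ, 0 ≤ B → s * B ≤ D → ENNReal.ofReal s * ENNReal.ofReal (B * X) ≤
      ENNReal.ofReal D * mixedSeminorm (unitCube d) (q + 1) v := fun s B D hB hD => by
    rcases le_or_gt s 0 with hs | hs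
    · simp [ENNReal.ofReal_of_nonpos hs]
    · rw [ENNReal.ofReal_mul hB, ← mul_assoc, ← ENNReal.ofReal_mul hs.le]
      exact mul_le_mul' (ENNReal.ofReal_le_ofReal hD) hXv
  have hpow : ∀ r, 0 ≤ (1 / 2 : ℝ) ^ r := fun r => by positivity
  constructor
  · have h1 := sub_eq_neg_sparseErr (k := k) (N := N) (List.nodup_finRange d) List.mem_finRange
      sum_map_finRange hf ho
    refine (brokenSeminorm_le (B := ENNReal.ofReal
      (C * ((N : ℝ) + 1) ^ d * meshSize N ^ (q + 1) * X)) fun α hα => ⟨f - G 0, ?_, fun j => ?_⟩).trans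
      ?_
    · rw [h1, norm_neg]
      exact ENNReal.ofReal_le_ofReal hE
    · obtain rfl : α = 0 := by
        have h2 := (Finset.mem_piAntidiag.1 hα).1
        exact funext fun i => Finset.sum_eq_zero_iff.1 h2 i (Finset.mem_univ i)
      have h3 := (integrableOn_L2Cube (f - G 0)).mono_set (dualCell_subset j)
      have h4 : f - G 0 =ᵐ[volume.restrict (dualCell N j)] u - v :=
        ae_restrict_of_ae_restrict_of_subset (dualCell_subset j) (ae_of_ae_mu hfuv)
      refine (isWeakDeriv_zero ?_).congr_ae h4.symm h3.locallyIntegrableOn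
      exact IntegrableOn.locallyIntegrableOn ((integrable_congr h4).1 h3)
    · have h2 := key (c 0) (C * ((N : ℝ) + 1) ^ d * meshSize N ^ (q + 1))
        ((c 0 * (C * 2 ^ d) + c 1 * C + 1) * (N : ℝ) ^ d * (1 / 2 : ℝ) ^ (N * (q + 1)))
        (mul_nonneg (by positivity) (pow_nonneg (meshSize_pos N).le _)) ?_
      · rwa [ENNReal.ofReal_natCast] at h2
      · have hN1 : (1 : ℝ) ≤ N := by exact_mod_cast hN
        have h3 : ((N : ℝ) + 1) ^ d ≤ 2 ^ d * (N : ℝ) ^ d := by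
          rw [← mul_pow]
          exact pow_le_pow_left₀ (by positivity) (by linarith) d
        rw [hmesh]
        calc (c 0 : ℝ) * (C * ((N : ℝ) + 1) ^ d * (1 / 2 : ℝ) ^ (N * (q + 1)))
            ≤ c 0 * (C * (2 ^ d * (N : ℝ) ^ d) * (1 / 2 : ℝ) ^ (N * (q + 1))) := by gcongr
          _ = c 0 * (C * 2 ^ d) * (N : ℝ) ^ d * (1 / 2 : ℝ) ^ (N * (q + 1)) := by ring
          _ ≤ _ := by
            gcongr
            have : (0 : ℝ) ≤ c 1 * C := by positivity
            linarith
  · refine (brokenSeminorm_le (B := ENNReal.ofReal (C * meshSize N ^ q * X)) fun α hα => ?_).trans ?_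
    · obtain ⟨m, rfl⟩ := eq_single_of_sum_eq_one (Finset.mem_piAntidiag.1 hα).1
      have hp := perm_erase_append m
      have h1 := sub_eq_neg_sparseErr (k := k) (N := N) (hp.nodup_iff.2 (List.nodup_finRange d))
        (fun i => hp.mem_iff.2 (List.mem_finRange i))
        (fun l => ((hp.map l).sum_eq).trans (sum_map_finRange l)) hf ho
      have hw := hG (Pi.single m 1) fun i =>
        update_le (α := 0) (fun _ => Nat.zero_le _) m (show 1 ≤ q + 1 by omega) i
      refine ⟨-sparseErrDeriv k N m ((List.finRange d).erase m) N (G 0) (G (Pi.single m 1)), ?_,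
        isWeakDeriv_dualCell hu.1 hG0 hw hfuv h1⟩
      rw [norm_neg]
      exact ENNReal.ofReal_le_ofReal (hD m)
    · have h2 := key (c 1) (C * meshSize N ^ q)
        ((c 0 * (C * 2 ^ d) + c 1 * C + 1) * (1 / 2 : ℝ) ^ (N * q))
        (mul_nonneg hC0 (pow_nonneg (meshSize_pos N).le _)) ?_
      · rwa [ENNReal.ofReal_natCast] at h2
      · rw [hmesh, ← mul_assoc]
        gcongr
        have : (0 : ℝ) ≤ c 0 * (C * 2 ^ d) := by positivity
        linarith

end Projection

end SparseDual

end

theorem lemma2 (d k p q : ℕ) (hd : 2 ≤ d) (hk : 1 ≤ k) (hq : 1 ≤ q) (hqpk : q ≤ min p k) :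
    ∃ C : ℝ, 0 < C ∧ ∀ N : ℕ, 1 ≤ N → ∀ v : (Fin d → ℝ) → ℝ,
      SparseDual.MemMixedSobolev (SparseDual.unitCube d) (p + 1) v →
      (∃ u : (Fin d → ℝ) → ℝ, SparseDual.IsL2Projection (SparseDual.unitCube d)
        (SparseDual.sparseSpace d k N) v u) ∧
      ∀ u : (Fin d → ℝ) → ℝ, SparseDual.IsL2Projection (SparseDual.unitCube d)
          (SparseDual.sparseSpace d k N) v u →
        SparseDual.brokenSeminorm N 0 (u - v) ≤
            ENNReal.ofReal (C * (N : ℝ) ^ d * (1 / 2 : ℝ) ^ (N * (q + 1))) *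
              SparseDual.mixedSeminorm (SparseDual.unitCube d) (q + 1) v ∧
        SparseDual.brokenSeminorm N 1 (u - v) ≤
            ENNReal.ofReal (C * (1 / 2 : ℝ) ^ (N * q)) *
              SparseDual.mixedSeminorm (SparseDual.unitCube d) (q + 1) v :=
  SparseDual.exists_projection_error_const (by omega) (hqpk.trans (min_le_left _ _))
    (hqpk.trans (min_le_right _ _))
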